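/- **Setting.** Let $(\mathcal A,d_{\mathcal A})$ be a (pseudo)metric space of mechanisms, $\mathcal B$ and $\mathcal H$ finite sets of behaviours and signals, $\mathcal U$ a measurable space of users with a probability law $\nu$, $sig:\mathcal A\times\mathcal B\times\mathcal U\to\mathcal H$ the signal function and $L:\mathcal A\times\mathcal B\times\mathcal U\to[-K,0]$ the loss, $K>0$ (both measurable in $u$; there is a countable set of mechanisms such that every $L(a,\cdot,\cdot)$ is a pointwise limit of a sequence of losses of mechanisms in this set). A behaviour model is a family $M=(M_h)_{h\in\mathcal H}$ of stochastic matrices on $\mathcal B$. For a mechanism $a$ and a model $M$, $(b^a_t,u_t)$ is the Markov chain on $\mathcal B\times\mathcal U$ in which the $u_t$ are i.i.d. with law $\nu$, $h_t=sig(a,b^a_t,u_t)$, and $b^a_{t+1}$ has law $M_{h_t}(b^a_t,\cdot)$; $\pi(a,M)$ is its stationary distribution, $\mathcal R(a,M)=E_{\pi(a,M)}L(a,b,u)$, and $\beta(a,m)$ is the $m$-th $\beta$-mixing coefficient of the stationary chain. Total variation is $d_{TV}(\mu,\mu')=\sup_E|\mu(E)-\mu'(E)|$. Let $M^*$ be the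 true behaviour model; assume that under $M^*$ the chains $(b^a_t,u_t)$ are uniformly ergodic with a rate common to all $a$, and that $a^*$ minimizes $\mathcal R(\cdot,M^*)$. **Bi-level ERM.** *(Behaviour learning.)* Historical data $b_1,\dots,b_{T_1+1}$, $h_1,\dots,h_{T_1}$ are generated by $M^*$ under a fixed mechanism $a_0$, from an arbitrary initial law, where some power of the transition matrix of the chain $(b_t,h_t)$ has only positive entries. The learned model $\hat M_{T_1}$ is either (non-parametric) given by the conditional frequencies $\hat M_h(b,b')=\#\{t\le T_1:b_{t+1}=b',b_t=b,h_t=h\}/\#\{t\le T_1:b_t=b,h_t=h\}$ (an arbitrary probability vector for pairs $(b,h)$ that do not occur), or (parametric) the maximum likelihood estimator in the family $M_h(b,b')\propto\exp(-(b'-\langle w,(b,h,1)\rangle)^2)$ with $w$ in a bounded set, the behaviours being encoded as numbers and the signals as vectors, and $M^*$ belonging to the family. *(Mechanism learning.)* Let $\delta>0$ and let $s_\delta:\mathcal A\to\mathcal A$ be a sample sharing map: $d_{\mathcal A}(a,s_\delta(a))\le\delta$ for all $a$, and at most $\mathcal N_{d_{\mathcal A}}(\delta,\mathcal A)$ mechanisms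 occur as values of $s_\delta$, where $\mathcal N_{d_{\mathcal A}}(\delta,\mathcal A)$ is the smallest size of a $\delta$-cover of $\mathcal A$. Given the historical data, for each value $g$ of $s_\delta$ the process $(b^g_t,u_t)_{t\le T_2}$ is the stationary chain for $(g,\hat M_{T_1})$, with the same users $u_t$ for all $g$, and $\hat a_{T_2}$ minimizes $\frac1{T_2}\sum_{t\le T_2}L(a,b^{s_\delta(a)}_t,u_t)$ over $a\in\mathcal A$. **Assumption.** There are $\alpha\ge0$, $\beta_0\ge0$, $\gamma>0$ and $r>0$ such that, for every value $M$ of $\hat M_{T_1}$ all of whose entries differ from those of $M^*$ by less than $r$: $d_{TV}(\pi(a,M),\pi(a',M))\le\alpha\,d_{\mathcal A}(a,a')$ for all $a,a'$, and under $M$, $\beta(a,m)\le\beta_0m^{-\gamma}$ for all $a$ and $m\ge1$. Let $\mathcal N_1(\eta,L\circ\mathcal A,T)$ be the maximum over $x_1,\dots,x_T\in\mathcal B\times\mathcal U$ of the smallest size of an $\eta$-cover of $\{(L(a,x_1),\dots,L(a,x_T)):a\in\mathcal A\}$ in the distance $\frac1T\sum_t|v_t-w_t|$. **Theorem 5.**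 There is an absolute constant $C>0$ such that the following holds in every such setting. Let $\epsilon>0$, $s\in(0,\gamma)$, $\delta>0$ with $2K\alpha\delta<\epsilon$, and $\Delta=\epsilon-2K\alpha\delta$. Then there are $C_1,c_1>0$, depending on neither $T_1$, $T_2$ nor the sample sharing map, the initial law of the historical data and the joint law of the samples of different mechanisms, such that for all $T_1\ge0$ and $T_2\ge1$ $$P\big(\mathcal R(\hat a_{T_2},M^*)-\mathcal R(a^*,M^*)\ge\epsilon\big)\le C_1e^{-c_1T_1}+\mathcal N_{d_{\mathcal A}}(\delta,\mathcal A)\Big(C\,\mathcal N_1\big(\tfrac{\Delta}{C},L\circ\mathcal A,T_2\big)\exp\Big(-\frac{\Delta^2}{CK^2}\,T_2^{\frac{s}{1+s}}\Big)+C\beta_0\,T_2^{\frac{s-\gamma}{1+s}}\Big).$$ -/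

import Mathlib

open MeasureTheory ProbabilityTheory Filter Topology
open scoped ENNReal NNReal

noncomputable section

namespace GTML

/-- Total variation distance `sup_E |μ(E) - ν(E)|` over measurable events. -/
def tvDist {X : Type*} [MeasurableSpace X] (μ ν : Measure X) : ℝ≥0∞ :=
  ⨆ (E : Set X) (_ : MeasurableSet E), ENNReal.ofReal |μ.real E - ν.real E|

/-- Law of the time-homogeneous Markov chain on `X` with initial law `μ` and transition
kernel `κ`, as a measure on the path space `ℕ → X`. -/
def pathLaw {X : Type*} [MeasurableSpace X] (μ : Measure X) (κ : Kernel X X)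
    [IsMarkovKernel κ] : Measure (ℕ → X) :=
  Kernel.trajMeasure (X := fun _ => X) μ
    (fun n => κ.comap (fun x : (Π _ : Finset.Iic n, X) => x ⟨n, Finset.mem_Iic.2 le_rfl⟩)
      (measurable_pi_apply _))

/-- `m`-th β-mixing coefficient of a process with path law `P`:
`sup_l ‖ Law((X_0,…,X_l),(X_{l+m},X_{l+m+1},…)) - Law(X_0,…,X_l) ⊗ Law(X_{l+m},…) ‖_TV`. -/
def betaMixing {X : Type*} [MeasurableSpace X] (P : Measure (ℕ → X)) (m : ℕ) : ℝ≥0∞ :=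
  ⨆ l : ℕ, tvDist
    (P.map (fun x => ((fun i : Fin (l + 1) => x i), (fun n : ℕ => x (l + m + n)))))
    ((P.map (fun x => (fun i : Fin (l + 1) => x i))).prod
      (P.map (fun x => (fun n : ℕ => x (l + m + n)))))

/-- A behaviour model: for each signal `h` and current behaviour `b`, the law of the next
behaviour, i.e. the row `M_h(b, ·)` of a stochastic matrix. -/
abbrev BehaviorModel (B H : Type*) := H → B → PMF B

/-- The entry `M_h(b, b')` as a real number. -/
def entry {B H : Type*} (M : BehaviorModel B H) (h : H) (b b' : B) : ℝ := (M h b b').toReal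

/-- A GTML environment: signal function, law of the (i.i.d.) users, and bounded loss. -/
structure Env (A B H U : Type*) [MeasurableSpace H] [MeasurableSpace U] where
  sig : A → B → U → H
  measurable_sig : ∀ a b, Measurable (sig a b)
  userLaw : Measure U
  isProb : IsProbabilityMeasure userLaw
  K : ℝ
  K_pos : 0 < K
  L : A → B → U → ℝ
  measurable_L : ∀ a b, Measurable (L a b)
  L_mem : ∀ a b u, L a b u ∈ Set.Icc (-K) 0

attribute [instance] Env.isProb

section Env

variable {A B H U : Type*}
variable [Fintype B] [MeasurableSpace B] [MeasurableSingletonClass B]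
variable [Fintype H] [MeasurableSpace H] [MeasurableSingletonClass H]
variable [MeasurableSpace U]

/-- Kernel `(h, b) ↦ M_h(b, ·)`. -/
def behaviorKernel (M : BehaviorModel B H) : Kernel (H × B) B :=
  Kernel.ofFunOfCountable (fun p => (M p.1 p.2).toMeasure)

instance (M : BehaviorModel B H) : IsMarkovKernel (behaviorKernel M) :=
  ⟨fun p => PMF.toMeasure.isProbabilityMeasure (M p.1 p.2)⟩

set_option linter.unusedSectionVars false in
lemma Env.measurable_signal (G : Env A B H U) (a : A) :
    Measurable (fun x : B × U => (G.sig a x.1 x.2, x.1)) :=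
  (measurable_from_prod_countable_right (fun b => G.measurable_sig a b)).prodMk measurable_fst

/-- Transition kernel of the process `(b_t^a, u_t)`: the signal is `h_t = sig(a, b_t, u_t)`,
the next behaviour has law `M_{h_t}(b_t, ·)`, the next user is drawn independently. -/
def Env.step (G : Env A B H U) (a : A) (M : BehaviorModel B H) : Kernel (B × U) (B × U) :=
  ((behaviorKernel M).comap (fun x : B × U => (G.sig a x.1 x.2, x.1)) (G.measurable_signal a)) ×ₖ
    (Kernel.const (B × U) G.userLaw)

instance (G : Env A B H U) (a : A) (M : BehaviorModel B H) : IsMarkovKernel (G.step a M) := by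
  unfold Env.step; infer_instance

open Classical in
/-- The stationary distribution `π(a, M)` of `(b_t^a, u_t)` under the behaviour model `M`. -/
def Env.stat (G : Env A B H U) (a : A) (M : BehaviorModel B H) : Measure (B × U) :=
  if h : ∃ μ : Measure (B × U), IsProbabilityMeasure μ ∧ (G.step a M).Invariant μ
  then h.choose else 0

/-- Expected risk `R(a, M) = E_{π(a, M)} L(a, b, u)`. -/
def Env.risk (G : Env A B H U) (a : A) (M : BehaviorModel B H) : ℝ :=
  ∫ x, G.L a x.1 x.2 ∂(G.stat a M)

/-- The β-mixing coefficient `β(a, m)` of the stationary chain `(b_t^a, u_t)` under `M`. -/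
def Env.beta (G : Env A B H U) (a : A) (M : BehaviorModel B H) (m : ℕ) : ℝ≥0∞ :=
  betaMixing (pathLaw (G.stat a M) (G.step a M)) m

/-- Under `M`, the chains `(b_t^a, u_t)` are uniformly ergodic, with a rate common to all
mechanisms `a`. -/
def Env.UniformlyErgodic (G : Env A B H U) (M : BehaviorModel B H) : Prop :=
  ∃ C ρ : ℝ, 0 ≤ ρ ∧ ρ < 1 ∧ ∀ (a : A) (n : ℕ) (x : B × U),
    tvDist ((G.step a M ^ n) x) (G.stat a M) ≤ ENNReal.ofReal (C * ρ ^ n)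

/-- Transition matrix of the chain `(b_t, h_t)` of behaviours and signals under mechanism `a`. -/
def Env.signalChain (G : Env A B H U) (a : A) (M : BehaviorModel B H) :
    Matrix (B × H) (B × H) ℝ :=
  fun p q => entry M p.2 p.1 q.1 * G.userLaw.real {u | G.sig a q.1 u = q.2}

/-- Some power of the transition matrix of `(b_t, h_t)` has only positive entries. -/
def Env.SignalChainErgodic [DecidableEq B] [DecidableEq H]
    (G : Env A B H U) (a : A) (M : BehaviorModel B H) : Prop :=
  ∃ N₀ : ℕ, ∀ p q, 0 < (G.signalChain a M ^ N₀) p q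

/-- The map `a ↦ π(a, M)` is `α`-Lipschitz in total variation and the β-mixing rate of the
chains `(b_t^a, u_t)` under `M` is algebraic, `β(a, m) ≤ β₀ m^{-γ}`. -/
def Env.LipschitzMixing [PseudoMetricSpace A] (G : Env A B H U) (M : BehaviorModel B H)
    (α β₀ γ : ℝ) : Prop :=
  (∀ a a' : A, tvDist (G.stat a M) (G.stat a' M) ≤ ENNReal.ofReal (α * dist a a')) ∧
  (∀ (a : A) (m : ℕ), 1 ≤ m → G.beta a M m ≤ ENNReal.ofReal (β₀ * (m : ℝ) ^ (-γ)))

/-- The loss class `{L(a, ·, ·)}` is pointwise separable: a countable set of mechanisms whose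
losses are pointwise sequentially dense (measurability of suprema over mechanisms). -/
def Env.PointwiseSeparable (G : Env A B H U) : Prop :=
  ∃ S : Set A, S.Countable ∧ ∀ a, ∃ x : ℕ → A, (∀ n, x n ∈ S) ∧
    ∀ b u, Tendsto (fun n => G.L (x n) b u) atTop (𝓝 (G.L a b u))

/-- The covering number `N_1(ε, L ∘ 𝓐, T)`: maximum over samples `x_1, …, x_T` of the smallest
size of an `ε`-cover of `{(L(a, x_1), …, L(a, x_T)) : a}` in the normalized distance
`T⁻¹ ∑ |v_t - w_t|`. -/
def Env.lossCover (G : Env A B H U) (ε : ℝ) (T : ℕ) : ℕ∞ :=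
  ⨆ x : Fin T → B × U, Metric.coveringNumber (X := PiLp 1 (fun _ : Fin T => ℝ))
    ((T : ℝ) * ε).toNNReal
    (Set.range (fun a => WithLp.toLp 1 (fun t => G.L a (x t).1 (x t).2)))

/-- Empirical risk with sample sharing: `T⁻¹ ∑_t L(a, b_t^{s(a)}, u_t)`. -/
def Env.empRisk (G : Env A B H U) (s : A → A) (T : ℕ) (b : A → ℕ → B) (u : ℕ → U) (a : A) : ℝ :=
  (T : ℝ)⁻¹ * ∑ t ∈ Finset.range T, G.L a (b (s a) t) (u t)

end Env

/-- The covering number `N_d(δ, 𝓐)` of the mechanism space. -/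
def mechCover (A : Type*) [PseudoMetricSpace A] (δ : ℝ) : ℕ∞ :=
  Metric.coveringNumber δ.toNNReal (Set.univ : Set A)

/-- A behaviour learning rule: from `b_0, …, b_T` and `h_0, …, h_{T-1}` to a behaviour model. -/
abbrev Learner (B H : Type*) :=
  (T : ℕ) → (Fin (T + 1) → B) → (Fin T → H) → BehaviorModel B H

/-- Non-parametric learning: conditional transition frequencies. Rows for pairs `(b, h)` that
were never observed are arbitrary probability vectors. -/
def IsFrequencyLearner {B H : Type*} (learn : Learner B H) : Prop :=
  ∀ (T : ℕ) (x : Fin (T + 1) → B) (y : Fin T → H) (h : H) (b b' : B),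
    {t : Fin T | x t.castSucc = b ∧ y t = h}.ncard ≠ 0 →
    entry (learn T x y) h b b' =
      ({t : Fin T | x t.succ = b' ∧ x t.castSucc = b ∧ y t = h}.ncard : ℝ) /
        ({t : Fin T | x t.castSucc = b ∧ y t = h}.ncard : ℝ)

/-- Likelihood of the observed transitions under `M`. -/
def likelihood {B H : Type*} {T : ℕ} (M : BehaviorModel B H) (x : Fin (T + 1) → B)
    (y : Fin T → H) : ℝ :=
  ∏ t : Fin T, entry M (y t) (x t.castSucc) (x t.succ)

/-- Unnormalized weight `exp(-(b' - ⟨w, (b, h, 1)⟩)²)`; behaviours are encoded as numbers by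
`bv`, signals as vectors by `hv`. -/
def gaussWeight {B H : Type*} {q : ℕ} (bv : B → ℝ) (hv : H → Fin q → ℝ)
    (w : ℝ × (Fin q → ℝ) × ℝ) (h : H) (b b' : B) : ℝ :=
  Real.exp (-(bv b' - (w.1 * bv b + ∑ i, w.2.1 i * hv h i + w.2.2)) ^ 2)

/-- `M_h(b, b') ∝ exp(-(b' - ⟨w, (b, h, 1)⟩)²)`. -/
def IsGaussModel {B H : Type*} [Fintype B] {q : ℕ} (bv : B → ℝ) (hv : H → Fin q → ℝ)
    (w : ℝ × (Fin q → ℝ) × ℝ) (M : BehaviorModel B H) : Prop :=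
  ∀ h b b', entry M h b b' = gaussWeight bv hv w h b b' / ∑ c, gaussWeight bv hv w h b c

/-- Parametric learning: the true model belongs to the truncated Gaussian family with parameter
in a bounded set `W`, and the learned model is the member of the family maximizing the
likelihood of the data. -/
def IsGaussMLE {B H : Type*} [Fintype B] (Mstar : BehaviorModel B H) (learn : Learner B H) :
    Prop :=
  ∃ (q : ℕ) (bv : B → ℝ) (hv : H → Fin q → ℝ) (W : Set (ℝ × (Fin q → ℝ) × ℝ)),
    Bornology.IsBounded W ∧ (∃ w ∈ W, IsGaussModel bv hv w Mstar) ∧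
    ∀ (T : ℕ) (x : Fin (T + 1) → B) (y : Fin T → H),
      (∃ w ∈ W, IsGaussModel bv hv w (learn T x y)) ∧
      ∀ w ∈ W, ∀ M, IsGaussModel bv hv w M → likelihood M x y ≤ likelihood (learn T x y) x y

/-- One run of bi-level empirical risk minimization, on a probability space `(Ω, P)`.
* `bH`, `uH`: historical behaviours and users, generated by the true model `Mstar` under the
  mechanism `a₀`; the training data are `b_0, …, b_{T₁}` and `h_t = sig(a₀, b_t, u_t)`, `t < T₁`;
* `b`, `u`: given the training data, for each mechanism `g` whose sample is generated,
  `(b_t^g, u_t)_{t < T₂}` is the stationary chain for `g` and the learned behaviour model;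
* `ahat` minimizes the empirical risk. -/
structure IsBilevelERM {A B H U Ω : Type*}
    [Fintype B] [MeasurableSpace B] [MeasurableSingletonClass B]
    [Fintype H] [MeasurableSpace H] [MeasurableSingletonClass H]
    [MeasurableSpace U] [MeasurableSpace Ω]
    (G : Env A B H U) (Mstar : BehaviorModel B H) (a₀ : A) (learn : Learner B H) (s : A → A)
    (T₁ T₂ : ℕ) (P : Measure Ω) (bH : ℕ → Ω → B) (uH : ℕ → Ω → U)
    (b : A → ℕ → Ω → B) (u : ℕ → Ω → U) (ahat : Ω → A) : Prop where
  measurable_bH : ∀ t, Measurable (bH t)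
  measurable_uH : ∀ t, Measurable (uH t)
  measurable_b : ∀ a t, Measurable (b a t)
  measurable_u : ∀ t, Measurable (u t)
  historical_law : ∃ μ₀ : Measure B, IsProbabilityMeasure μ₀ ∧
    P.map (fun ω t => (bH t ω, uH t ω)) = pathLaw (μ₀.prod G.userLaw) (G.step a₀ Mstar)
  simulated_law : ∀ (x : Fin (T₁ + 1) → B) (y : Fin T₁ → H),
    P {ω | (∀ t : Fin (T₁ + 1), bH t ω = x t) ∧
          ∀ t : Fin T₁, G.sig a₀ (bH t ω) (uH t ω) = y t} ≠ 0 →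
    ∀ g ∈ Set.range s,
      (cond P {ω | (∀ t : Fin (T₁ + 1), bH t ω = x t) ∧
          ∀ t : Fin T₁, G.sig a₀ (bH t ω) (uH t ω) = y t}).map
        (fun ω (t : Fin T₂) => (b g t ω, u t ω)) =
      (pathLaw (G.stat g (learn T₁ x y)) (G.step g (learn T₁ x y))).map
        (fun z (t : Fin T₂) => z t)
  ahat_min : ∀ᵐ ω ∂P, ∀ a, G.empRisk s T₂ (fun g t => b g t ω) (fun t => u t ω) (ahat ω) ≤
    G.empRisk s T₂ (fun g t => b g t ω) (fun t => u t ω) a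

end GTML

end

/-!
The excess risk of the learned mechanism is controlled in two stages.

*Behaviour learning.* Under the fixed mechanism, the pairs of behaviour and signal form a Markov
chain with finitely many states and a power of positive entries. Discounting each visit to a state
by `e⁻¹` gives a matrix whose powers contract constants geometrically, so that every pair is visited
linearly often, up to exponentially small probability. Given the past, the centred indicator of a
transition is a bounded martingale difference, whose sums are exponentially concentrated. Hence the
historical data are typical (`IsTypical`) up to probability `C₁ exp (-c₁ T₁)`, whatever the initial
law (`Env.SignalChainErgodic.exists_typical_bound`). On typical data both learning rules return a
model close to the true one in each entry (`exists_typical_radius`): for frequencies this is a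
division, and for maximum likelihood the average log-likelihood ratio is nearly a sum of
Kullback-Leibler divergences, which dominate the squared distances of the entries.

*Mechanism learning.* If the learned model is close to the true one, then so are the transition
kernels, uniformly in the mechanism. Iterating the true kernel a fixed number of times, after which
uniform ergodicity has brought it near its stationary law, shows that all stationary distributions
are within `Δ / (4 K)` of the true ones (`Env.exists_radius_stat_close`). Replacing a mechanism by
the one whose sample it shares moves the stationary distribution by at most `α δ`, which accounts
for the term `2 K α δ` in the comparison of two mechanisms. What is left is a uniform law of large
numbers for each of the stationary chains that are simulated. Time is cut into blocks of length
`⌊T₂^{1/(1+s)}⌋`; the blocks of one parity are separated by gaps, so `β`-mixing makes them nearly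
independent (`abs_measureReal_blocks_sub_pi_le`), and for independent blocks the largest deviation
has a sub-Gaussian exponential moment by symmetrization and covering
(`pi_measure_exists_deviation_le`). The two combine to
`measure_exists_deviation_le_of_algebraic_mixing`, and a union bound over the simulated mechanisms
gives `Env.measure_excess_risk_le`.

The stages are joined by conditioning on the historical data, which take finitely many values
(`measure_le_add_of_cond_le`).
-/

noncomputable section

namespace GTML

/-! ### The Markov property of the path law -/

section MarkovProperty

set_option linter.unusedSectionVars false

variable {X : Type*} [MeasurableSpace X] (μ : Measure X) [IsProbabilityMeasure μ]
  (κ : Kernel X X) [IsMarkovKernel κ]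

instance isProbabilityMeasure_pathLaw : IsProbabilityMeasure (pathLaw μ κ) := by
  unfold pathLaw; infer_instance

lemma map_eval_zero_pathLaw : (pathLaw μ κ).map (fun x => x 0) = μ := by
  have h0 : (fun x : ℕ → X => x 0) = (fun y : (Π _ : Finset.Iic 0, X) => y ⟨0, by simp⟩) ∘
      Preorder.frestrictLe (π := fun _ => X) 0 := rfl
  rw [h0, ← Measure.map_map (by fun_prop) (by fun_prop), pathLaw, Kernel.trajMeasure,
    Measure.map_comp _ _ (by fun_prop), Kernel.traj_map_frestrictLe, Kernel.partialTraj_self,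
    Measure.id_comp, Measure.map_map (by fun_prop) (by fun_prop)]
  convert Measure.map_id
  rfl

lemma lintegral_pathLaw_frestrictLe (n : ℕ) {F : (Π _ : Finset.Iic n, X) → ℝ≥0∞}
    (hF : Measurable F) {g : X → X → ℝ≥0∞} (hg : Measurable (Function.uncurry g)) :
    ∫⁻ x, F (Preorder.frestrictLe (π := fun _ => X) n x) * g (x n) (x (n + 1)) ∂(pathLaw μ κ) =
    ∫⁻ x, F (Preorder.frestrictLe (π := fun _ => X) n x) * ∫⁻ y, g (x n) y ∂(κ (x n))
      ∂(pathLaw μ κ) := by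
  have key := Kernel.map_frestrictLe_trajMeasure_compProd_eq_map_trajMeasure (X := fun _ => X)
    (μ₀ := μ) (κ := fun n => κ.comap (fun x : (Π _ : Finset.Iic n, X) =>
      x ⟨n, Finset.mem_Iic.2 le_rfl⟩) (measurable_pi_apply _)) (a := n)
  change (pathLaw μ κ).map _ ⊗ₘ _ = (pathLaw μ κ).map _ at key
  have hm : Measurable (fun p : (Π _ : Finset.Iic n, X) × X =>
      F p.1 * g (p.1 ⟨n, Finset.mem_Iic.2 le_rfl⟩) p.2) :=
    (hF.comp measurable_fst).mul (hg.comp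
      (f := fun p : (Π _ : Finset.Iic n, X) × X => (p.1 ⟨n, Finset.mem_Iic.2 le_rfl⟩, p.2))
      (((measurable_pi_apply _).comp measurable_fst).prodMk measurable_snd))
  have h := congrArg (fun ν => ∫⁻ p, F p.1 * g (p.1 ⟨n, Finset.mem_Iic.2 le_rfl⟩) p.2 ∂ν) key
  beta_reduce at h
  rw [lintegral_map hm (by fun_prop), Measure.lintegral_compProd hm] at h
  have hgy : ∀ z, Measurable (g z) := fun z => hg.comp (measurable_const.prodMk measurable_id)
  have hm2 : Measurable (fun y : (Π _ : Finset.Iic n, X) => ∫⁻ b, F y *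
      g (y ⟨n, Finset.mem_Iic.2 le_rfl⟩) b ∂((κ.comap (fun x : (Π _ : Finset.Iic n, X) =>
      x ⟨n, Finset.mem_Iic.2 le_rfl⟩) (measurable_pi_apply _)) y)) :=
    Measurable.lintegral_kernel_prod_right' (κ := κ.comap (fun x : (Π _ : Finset.Iic n, X) =>
      x ⟨n, Finset.mem_Iic.2 le_rfl⟩) (measurable_pi_apply _)) hm
  rw [lintegral_map hm2 (by fun_prop)] at h
  refine Eq.trans h.symm (lintegral_congr fun x => ?_)
  rw [lintegral_const_mul _ (hgy _)]
  rfl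

/-- The Markov property, for products of functions of consecutive pairs of states. -/
lemma lintegral_pathLaw_prod (n : ℕ) {G : ℕ → X → X → ℝ≥0∞}
    (hG : ∀ t, Measurable (Function.uncurry (G t)))
    {g : X → X → ℝ≥0∞} (hg : Measurable (Function.uncurry g)) :
    ∫⁻ x, (∏ t ∈ Finset.range n, G t (x t) (x (t + 1))) * g (x n) (x (n + 1)) ∂(pathLaw μ κ) =
    ∫⁻ x, (∏ t ∈ Finset.range n, G t (x t) (x (t + 1))) * ∫⁻ y, g (x n) y ∂(κ (x n))
      ∂(pathLaw μ κ) := by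
  let e : ℕ → Finset.Iic n := fun t => ⟨min t n, by simp⟩
  have hF : Measurable (fun y : (Π _ : Finset.Iic n, X) =>
      ∏ t ∈ Finset.range n, G t (y (e t)) (y (e (t + 1)))) :=
    Finset.measurable_prod _ fun t _ => (hG t).comp
      (f := fun y : (Π _ : Finset.Iic n, X) => (y (e t), y (e (t + 1))))
      ((measurable_pi_apply _).prodMk (measurable_pi_apply _))
  have hp : ∀ x : ℕ → X, ∏ t ∈ Finset.range n, G t (x t) (x (t + 1)) =
      ∏ t ∈ Finset.range n, G t (Preorder.frestrictLe (π := fun _ => X) n x (e t))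
        (Preorder.frestrictLe (π := fun _ => X) n x (e (t + 1))) := by
    intro x
    refine Finset.prod_congr rfl fun t ht => ?_
    have ht := Finset.mem_range.1 ht
    simp [e, Preorder.frestrictLe_apply, min_eq_left ht.le, min_eq_left (Nat.succ_le_of_lt ht)]
  rw [lintegral_congr fun x => congrArg (· * g (x n) (x (n + 1))) (hp x),
    lintegral_congr fun x => congrArg (· * ∫⁻ y, g (x n) y ∂(κ (x n))) (hp x)]
  exact lintegral_pathLaw_frestrictLe μ κ n hF hg

variable {μ κ} in
/-- A chain started from an invariant law has that law at all times. -/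
lemma map_eval_pathLaw (hinv : κ.Invariant μ) (n : ℕ) :
    (pathLaw μ κ).map (fun x => x n) = μ := by
  induction n with
  | zero => exact map_eval_zero_pathLaw μ κ
  | succ n ih =>
    ext E hE
    have hind : Measurable (E.indicator (1 : X → ℝ≥0∞)) := measurable_one.indicator hE
    have h := lintegral_pathLaw_frestrictLe μ κ n (F := fun _ => 1) measurable_const
      (g := fun _ y => E.indicator (1 : X → ℝ≥0∞) y) (hind.comp measurable_snd)
    simp_rw [one_mul] at h
    rw [lintegral_congr (fun x : ℕ → X => lintegral_indicator_one (μ := κ (x n)) hE)] at h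
    rw [← lintegral_indicator_one hE, lintegral_map hind (by fun_prop), h]
    have h2 : ∫⁻ z, κ z E ∂((pathLaw μ κ).map (fun x => x n)) = μ E := by
      rw [ih, ← Measure.bind_apply hE (Kernel.aemeasurable κ), hinv.def]
    rw [← h2, lintegral_map (Kernel.measurable_coe κ hE) (by fun_prop)]

end MarkovProperty

/-! ### Uniform deviations of sums of independent bounded variables -/

section Symmetrization

/-- The sign `±1` encoded by a Boolean. -/
def boolSign (s : Bool) : ℝ := if s then 1 else -1

lemma sum_exp_boolSign_le {J : Type*} [Fintype J] [DecidableEq J] {c lam : ℝ} (v : J → ℝ)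
    (hv : ∀ j, |v j| ≤ c) :
    ∑ σ : J → Bool, Real.exp (lam * ∑ j, boolSign (σ j) * v j) ≤
      2 ^ Fintype.card J * Real.exp (Fintype.card J * (lam ^ 2 * c ^ 2 / 2)) := by
  have h1 : ∀ σ : J → Bool, Real.exp (lam * ∑ j, boolSign (σ j) * v j) =
      ∏ j, Real.exp (lam * (boolSign (σ j) * v j)) := by
    intro σ
    rw [Finset.mul_sum, Real.exp_sum]
  have h2 : ∏ j, ∑ s : Bool, Real.exp (lam * (boolSign s * v j)) =
      ∑ σ : J → Bool, ∏ j, Real.exp (lam * (boolSign (σ j) * v j)) := by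
    rw [Finset.prod_univ_sum, Fintype.piFinset_univ]
  simp_rw [h1]
  rw [← h2]
  have h3 : ∀ j, ∑ s : Bool, Real.exp (lam * (boolSign s * v j)) ≤
      2 * Real.exp (lam ^ 2 * c ^ 2 / 2) := by
    intro j
    have hs : ∑ s : Bool, Real.exp (lam * (boolSign s * v j)) = 2 * Real.cosh (lam * v j) := by
      rw [Fintype.sum_bool, Real.cosh_eq]
      simp [boolSign]
      ring
    rw [hs]
    refine mul_le_mul_of_nonneg_left ((Real.cosh_le_exp_half_sq _).trans ?_) (by norm_num)
    refine Real.exp_le_exp.2 ?_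
    have : v j ^ 2 ≤ c ^ 2 := sq_le_sq' (abs_le.1 (hv j)).1 (abs_le.1 (hv j)).2
    have := mul_le_mul_of_nonneg_left this (sq_nonneg lam)
    nlinarith
  calc ∏ j, ∑ s : Bool, Real.exp (lam * (boolSign s * v j))
      ≤ ∏ _j : J, (2 * Real.exp (lam ^ 2 * c ^ 2 / 2)) :=
        Finset.prod_le_prod (fun j _ => Finset.sum_nonneg fun s _ => (Real.exp_pos _).le)
          fun j _ => h3 j
    _ = _ := by
        rw [Finset.prod_const, mul_pow, ← Real.exp_nat_mul]
        rfl

/-- Rademacher exponential moments of the coordinates of a family of vectors that has a cover of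
size `n` and `ℓ¹`-radius `η`: replacing each vector by the nearest centre costs `|λ| η` in the
exponent, and each centre has a sub-Gaussian moment. -/
lemma sum_iSup_exp_boolSign_le {J ι : Type*} [Fintype J] [DecidableEq J] {c lam η : ℝ} {n : ℕ}
    (f : ι → J → ℝ) (F : Finset (J → ℝ)) (hF : F.card ≤ n) (hFc : ∀ v ∈ F, ∀ j, |v j| ≤ c)
    (hcov : ∀ a, ∃ v ∈ F, ∑ j, |f a j - v j| ≤ η) :
    ∑ σ : J → Bool, ⨆ a, ENNReal.ofReal (Real.exp (lam * ∑ j, boolSign (σ j) * f a j)) ≤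
      2 ^ Fintype.card J * (n * ENNReal.ofReal
        (Real.exp (|lam| * η + Fintype.card J * (lam ^ 2 * c ^ 2 / 2)))) := by
  have h1 : ∀ σ : J → Bool,
      ⨆ a, ENNReal.ofReal (Real.exp (lam * ∑ j, boolSign (σ j) * f a j)) ≤
      ∑ v ∈ F, ENNReal.ofReal (Real.exp (|lam| * η + lam * ∑ j, boolSign (σ j) * v j)) := by
    intro σ
    refine iSup_le fun a => ?_
    obtain ⟨v, hv, hav⟩ := hcov a
    have hle : ENNReal.ofReal (Real.exp (|lam| * η + lam * ∑ j, boolSign (σ j) * v j)) ≤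
        ∑ v ∈ F, ENNReal.ofReal (Real.exp (|lam| * η + lam * ∑ j, boolSign (σ j) * v j)) :=
      Finset.single_le_sum_of_canonicallyOrdered (f := fun v : J → ℝ =>
        ENNReal.ofReal (Real.exp (|lam| * η + lam * ∑ j, boolSign (σ j) * v j))) hv
    refine le_trans ?_ hle
    refine ENNReal.ofReal_le_ofReal (Real.exp_le_exp.2 ?_)
    have e : lam * ∑ j, boolSign (σ j) * f a j = lam * ∑ j, boolSign (σ j) * (f a j - v j) +
        lam * ∑ j, boolSign (σ j) * v j := by
      rw [← mul_add, ← Finset.sum_add_distrib]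
      congr 1
      exact Finset.sum_congr rfl fun j _ => by ring
    rw [e]
    refine add_le_add ((le_abs_self _).trans ?_) le_rfl
    rw [abs_mul]
    refine mul_le_mul_of_nonneg_left (le_trans ?_ hav) (abs_nonneg _)
    refine (Finset.abs_sum_le_sum_abs _ _).trans (Finset.sum_le_sum fun j _ => ?_)
    rw [abs_mul]
    have : |boolSign (σ j)| = 1 := by unfold boolSign; split_ifs <;> simp
    rw [this, one_mul]
  calc _ ≤ ∑ σ : J → Bool, ∑ v ∈ F,
        ENNReal.ofReal (Real.exp (|lam| * η + lam * ∑ j, boolSign (σ j) * v j)) :=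
        Finset.sum_le_sum fun σ _ => h1 σ
    _ = ∑ v ∈ F, ENNReal.ofReal (∑ σ : J → Bool,
          Real.exp (|lam| * η + lam * ∑ j, boolSign (σ j) * v j)) := by
        rw [Finset.sum_comm]
        refine Finset.sum_congr rfl fun v _ => ?_
        rw [ENNReal.ofReal_sum_of_nonneg fun _ _ => (Real.exp_pos _).le]
    _ ≤ ∑ _v ∈ F, 2 ^ Fintype.card J * ENNReal.ofReal
          (Real.exp (|lam| * η + Fintype.card J * (lam ^ 2 * c ^ 2 / 2))) := by
        refine Finset.sum_le_sum fun v hv => ?_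
        have h2 : (2 : ℝ≥0∞) ^ Fintype.card J = ENNReal.ofReal (2 ^ Fintype.card J) := by
          rw [ENNReal.ofReal_pow (by norm_num)]; simp
        rw [h2, ← ENNReal.ofReal_mul (by positivity)]
        refine ENNReal.ofReal_le_ofReal ?_
        simp_rw [Real.exp_add]
        rw [← Finset.mul_sum, mul_left_comm]
        exact mul_le_mul_of_nonneg_left (sum_exp_boolSign_le v (hFc v hv)) (Real.exp_pos _).le
    _ ≤ _ := by
        rw [Finset.sum_const, nsmul_eq_mul, mul_left_comm]
        gcongr

variable {J E ι : Type*} [Fintype J] [DecidableEq J] [MeasurableSpace E] [Countable ι]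

/-- Jensen's inequality: centring is dominated by subtracting an independent copy. -/
lemma exp_sub_integral_le {E : Type*} [MeasurableSpace E] (μ : Measure E) [IsProbabilityMeasure μ]
    {g : E → ℝ} (hg : Measurable g) {c : ℝ} (hc : ∀ y, |g y| ≤ c) (x lam : ℝ) :
    ENNReal.ofReal (Real.exp (lam * (x - ∫ y, g y ∂μ))) ≤
      ∫⁻ y, ENNReal.ofReal (Real.exp (lam * (x - g y))) ∂μ := by
  have hgi : Integrable g μ := Integrable.of_bound hg.aestronglyMeasurable c (ae_of_all _ hc)
  have hi : Integrable (fun y => lam * (x - g y)) μ :=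
    ((integrable_const x).sub hgi).const_mul lam
  have he : Integrable (fun y => Real.exp (lam * (x - g y))) μ := by
    refine Integrable.of_bound (C := Real.exp (|lam| * (|x| + c)))
      (by fun_prop) (ae_of_all _ fun y => ?_)
    rw [Real.norm_eq_abs, abs_of_pos (Real.exp_pos _)]
    refine Real.exp_le_exp.2 ((le_abs_self _).trans ?_)
    rw [abs_mul]
    refine mul_le_mul_of_nonneg_left ((abs_sub _ _).trans ?_) (abs_nonneg _)
    linarith [hc y]
  have hJ := ConvexOn.map_integral_le (μ := μ) (f := fun y => lam * (x - g y)) convexOn_exp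
    Real.continuous_exp.continuousOn isClosed_univ (by simp) hi he
  rw [integral_const_mul, integral_sub (integrable_const x) hgi, integral_const] at hJ
  simp only [probReal_univ, one_smul] at hJ
  rw [← ofReal_integral_eq_lintegral_ofReal he (ae_of_all _ fun y => (Real.exp_pos _).le)]
  exact ENNReal.ofReal_le_ofReal hJ

omit [DecidableEq J] [Countable ι] in
lemma integral_pi_sum_eval (μ : J → Measure E) [∀ j, IsProbabilityMeasure (μ j)] {c : ℝ}
    (f : J → E → ℝ) (hf : ∀ j, Measurable (f j)) (hc : ∀ j y, |f j y| ≤ c) :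
    ∫ y, ∑ j, f j (y j) ∂(Measure.pi μ) = ∑ j, ∫ z, f j z ∂(μ j) := by
  rw [integral_finsetSum]
  · refine Finset.sum_congr rfl fun j _ => ?_
    exact integral_comp_eval (hf j).aestronglyMeasurable
  · intro j _
    refine Integrable.of_bound (C := c)
      ((hf j).comp (measurable_pi_apply j)).aestronglyMeasurable (ae_of_all _ fun y => ?_)
    exact hc j _

omit [DecidableEq J] in
/-- Swapping the two copies of some of the coordinates does not change the law of a sample
together with its independent copy. -/
lemma lintegral_pi_prod_swap (μ : J → Measure E) [∀ j, IsProbabilityMeasure (μ j)]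
    {G : (J → E × E) → ℝ≥0∞} (hG : Measurable G) (σ : J → Bool) :
    ∫⁻ w, G (fun j => if σ j then w j else (w j).swap) ∂(Measure.pi fun j => (μ j).prod (μ j)) =
      ∫⁻ w, G w ∂(Measure.pi fun j => (μ j).prod (μ j)) := by
  have h : MeasurePreserving (fun (w : J → E × E) j => if σ j then w j else (w j).swap)
      (Measure.pi fun j => (μ j).prod (μ j)) (Measure.pi fun j => (μ j).prod (μ j)) := by
    refine measurePreserving_pi _ _ (f := fun j (p : E × E) => if σ j then p else p.swap) fun j => ?_
    by_cases hj : σ j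
    · simp only [hj, if_true]; exact MeasurePreserving.id _
    · simp only [hj]; exact Measure.measurePreserving_swap
  exact h.lintegral_comp hG

/-- Exponential moment of the largest centred sum over a class of functions of independent
variables, in terms of the size of `ℓ¹`-covers of the class on samples. -/
lemma lintegral_iSup_exp_le (μ : J → Measure E) [∀ j, IsProbabilityMeasure (μ j)]
    {c lam η : ℝ} {n : ℕ} (f : ι → J → E → ℝ) (hf : ∀ a j, Measurable (f a j))
    (hc : ∀ a j y, |f a j y| ≤ c)
    (hcov : ∀ y : J → E, ∃ F : Finset (J → ℝ), F.card ≤ n ∧ (∀ v ∈ F, ∀ j, |v j| ≤ c) ∧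
      ∀ a, ∃ v ∈ F, ∑ j, |f a j (y j) - v j| ≤ η) :
    ∫⁻ y, ⨆ a, ENNReal.ofReal (Real.exp (lam * (∑ j, f a j (y j) - ∑ j, ∫ z, f a j z ∂(μ j))))
      ∂(Measure.pi μ) ≤ n * ENNReal.ofReal
        (Real.exp (2 * |lam| * η + Fintype.card J * (2 * lam ^ 2 * c ^ 2))) := by
  have hmeas : ∀ a, Measurable fun y : J → E => ∑ j, f a j (y j) := fun a =>
    Finset.measurable_sum _ fun j _ => (hf a j).comp (measurable_pi_apply j)
  let D : (J → E × E) → ℝ≥0∞ := fun w =>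
    ⨆ a, ENNReal.ofReal (Real.exp (lam * (∑ j, (f a j (w j).1 - f a j (w j).2))))
  have hD : Measurable D := by
    refine Measurable.iSup fun a => ENNReal.measurable_ofReal.comp (Real.measurable_exp.comp
      (Measurable.const_mul (Finset.measurable_sum _ fun j _ => ?_) lam))
    exact ((hf a j).comp (measurable_fst.comp (measurable_pi_apply j))).sub
      ((hf a j).comp (measurable_snd.comp (measurable_pi_apply j)))
  have step1 : ∫⁻ y, ⨆ a, ENNReal.ofReal
      (Real.exp (lam * (∑ j, f a j (y j) - ∑ j, ∫ z, f a j z ∂(μ j)))) ∂(Measure.pi μ) ≤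
      ∫⁻ w, D w ∂(Measure.pi fun j => (μ j).prod (μ j)) := by
    have hmp := measurePreserving_arrowProdEquivProdArrow E E J μ μ
    have e1 : ∫⁻ w, D w ∂(Measure.pi fun j => (μ j).prod (μ j)) =
        ∫⁻ p : (J → E) × (J → E), ⨆ a, ENNReal.ofReal (Real.exp (lam *
          (∑ j, f a j (p.1 j) - ∑ j, f a j (p.2 j)))) ∂((Measure.pi μ).prod (Measure.pi μ)) := by
      rw [← hmp.lintegral_comp_emb (MeasurableEquiv.measurableEmbedding _)]
      refine lintegral_congr fun w => ?_
      simp only [D, Finset.sum_sub_distrib]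
      rfl
    rw [e1, lintegral_prod _ (Measurable.aemeasurable ?_)]
    swap
    · refine Measurable.iSup fun a => ENNReal.measurable_ofReal.comp (Real.measurable_exp.comp
        (Measurable.const_mul ?_ lam))
      exact ((hmeas a).comp measurable_fst).sub ((hmeas a).comp measurable_snd)
    refine lintegral_mono fun y => iSup_le fun a => ?_
    rw [← integral_pi_sum_eval μ (f a) (hf a) (hc a)]
    refine (exp_sub_integral_le (Measure.pi μ) (hmeas a) (c := Fintype.card J * c) ?_ _ _).trans ?_
    · intro z
      refine (Finset.abs_sum_le_sum_abs _ _).trans ((Finset.sum_le_sum fun j _ =>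
        hc a j (z j)).trans ?_)
      rw [Finset.sum_const, nsmul_eq_mul]; rfl
    · exact lintegral_mono fun z => le_iSup (fun a => ENNReal.ofReal (Real.exp (lam *
          (∑ j, f a j (y j) - ∑ j, f a j (z j))))) a
  refine step1.trans ?_
  set R : ℝ≥0∞ := n * ENNReal.ofReal
        (Real.exp (2 * |lam| * η + Fintype.card J * (2 * lam ^ 2 * c ^ 2))) with hR
  -- Averaging over all sign patterns turns the difference of copies into Rademacher sums.
  have step2 : ∀ w : J → E × E,
      ∑ σ : J → Bool, D (fun j => if σ j then w j else (w j).swap) ≤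
        2 ^ Fintype.card J * R := by
    intro w
    have hw : ∀ σ : J → Bool, 2 * D (fun j => if σ j then w j else (w j).swap) ≤
        (⨆ a, ENNReal.ofReal (Real.exp ((2 * lam) * ∑ j, boolSign (σ j) * f a j (w j).1))) +
        ⨆ a, ENNReal.ofReal (Real.exp ((-(2 * lam)) * ∑ j, boolSign (σ j) * f a j (w j).2)) := by
      intro σ
      simp only [D, ENNReal.mul_iSup]
      refine iSup_le fun a => ?_
      refine le_trans ?_ (add_le_add (le_iSup _ a) (le_iSup _ a))
      rw [← ENNReal.ofReal_add (Real.exp_pos _).le (Real.exp_pos _).le,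
        show (2 : ℝ≥0∞) = ENNReal.ofReal 2 by simp, ← ENNReal.ofReal_mul (by norm_num)]
      refine ENNReal.ofReal_le_ofReal ?_
      have hs : ∑ j, (f a j (if σ j then w j else (w j).swap).1 -
          f a j (if σ j then w j else (w j).swap).2) =
          ∑ j, boolSign (σ j) * f a j (w j).1 - ∑ j, boolSign (σ j) * f a j (w j).2 := by
        rw [← Finset.sum_sub_distrib]
        refine Finset.sum_congr rfl fun j _ => ?_
        by_cases hj : σ j <;> simp [hj, boolSign]
        ring
      rw [hs]
      set p := lam * ∑ j, boolSign (σ j) * f a j (w j).1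
      set q := lam * ∑ j, boolSign (σ j) * f a j (w j).2
      have e : lam * (∑ j, boolSign (σ j) * f a j (w j).1 - ∑ j, boolSign (σ j) * f a j (w j).2)
          = p + -q := by simp only [p, q]; ring
      have e1 : 2 * lam * ∑ j, boolSign (σ j) * f a j (w j).1 = p + p := by
        simp only [p]; ring
      have e2 : -(2 * lam) * ∑ j, boolSign (σ j) * f a j (w j).2 = -q + -q := by
        simp only [q]; ring
      rw [e, e1, e2, Real.exp_add, Real.exp_add, Real.exp_add]
      nlinarith [sq_nonneg (Real.exp p - Real.exp (-q))]
    have hside : ∀ (y : J → E) (l : ℝ), |l| = 2 * |lam| → ∑ σ : J → Bool,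
        ⨆ a, ENNReal.ofReal (Real.exp (l * ∑ j, boolSign (σ j) * f a j (y j))) ≤
        2 ^ Fintype.card J * R := by
      intro y l hl
      obtain ⟨F, hF, hFc, hFcov⟩ := hcov y
      refine (sum_iSup_exp_boolSign_le (lam := l) (fun a j => f a j (y j)) F hF hFc
        hFcov).trans (le_of_eq ?_)
      have hl2 : l ^ 2 = 4 * lam ^ 2 := by rw [← sq_abs, hl, mul_pow, sq_abs]; norm_num
      rw [hR, hl, hl2]
      congr 5
      ring
    have h2 : 2 * ∑ σ : J → Bool, D (fun j => if σ j then w j else (w j).swap) ≤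
        2 * (2 ^ Fintype.card J * R) := by
      rw [Finset.mul_sum]
      refine (Finset.sum_le_sum fun σ _ => hw σ).trans ?_
      rw [Finset.sum_add_distrib, two_mul (2 ^ Fintype.card J * R)]
      refine add_le_add (hside _ _ ?_) (hside _ _ ?_)
      · rw [abs_mul]; simp
      · rw [abs_neg, abs_mul]; simp
    exact (ENNReal.mul_le_mul_iff_right (by norm_num) (by norm_num)).1 h2
  have h3 : 2 ^ Fintype.card J * ∫⁻ w, D w ∂(Measure.pi fun j => (μ j).prod (μ j)) ≤
      2 ^ Fintype.card J * R := by
    have hcard : (2 : ℝ≥0∞) ^ Fintype.card J * ∫⁻ w, D w ∂(Measure.pi fun j => (μ j).prod (μ j))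
        = ∑ σ : J → Bool, ∫⁻ w, D (fun j => if σ j then w j else (w j).swap)
          ∂(Measure.pi fun j => (μ j).prod (μ j)) := by
      rw [Finset.sum_congr rfl fun σ _ => lintegral_pi_prod_swap μ hD σ, Finset.sum_const,
        nsmul_eq_mul]
      simp
    rw [hcard, ← lintegral_finsetSum]
    · refine (lintegral_mono step2).trans ?_
      simp
    · intro σ _
      refine hD.comp (measurable_pi_lambda _ fun j => ?_)
      by_cases hj : σ j
      · simpa [hj] using measurable_pi_apply j
      · simp only [hj]; exact measurable_swap.comp (measurable_pi_apply j)
  exact (ENNReal.mul_le_mul_iff_right (by positivity) (by finiteness)).1 h3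

/-- Uniform deviation inequality for independent bounded variables. The sign `sgn = ±1` selects the
side of the deviation. -/
lemma pi_measure_exists_deviation_le (μ : J → Measure E) [∀ j, IsProbabilityMeasure (μ j)]
    {c t sgn : ℝ} {n : ℕ} (hsgn : |sgn| = 1) (ht : 0 < t) (hJ : 0 < Fintype.card J) (hc0 : 0 < c)
    (f : ι → J → E → ℝ) (hf : ∀ a j, Measurable (f a j))
    (hc : ∀ a j y, |f a j y| ≤ c)
    (hcov : ∀ y : J → E, ∃ F : Finset (J → ℝ), F.card ≤ n ∧ (∀ v ∈ F, ∀ j, |v j| ≤ c) ∧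
      ∀ a, ∃ v ∈ F, ∑ j, |f a j (y j) - v j| ≤ t / 4) :
    Measure.pi μ {y : J → E | ∃ a, t < sgn * (∑ j, f a j (y j) - ∑ j, ∫ z, f a j z ∂(μ j))} ≤
      n * ENNReal.ofReal (Real.exp (-(t ^ 2 / (32 * Fintype.card J * c ^ 2)))) := by
  set N : ℝ := (Fintype.card J : ℝ) with hN
  have hNpos : 0 < N := by rw [hN]; exact_mod_cast hJ
  -- The value of `λ` minimizing `-λ t / 2 + 2 λ² N c²`.
  set l : ℝ := t / (8 * N * c ^ 2) with hl
  have hlpos : 0 < l := by positivity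
  have hmgf := lintegral_iSup_exp_le (lam := sgn * l) μ f hf hc hcov
  have hsub : {y : J → E | ∃ a, t < sgn * (∑ j, f a j (y j) - ∑ j, ∫ z, f a j z ∂(μ j))} ⊆
      {y : J → E | ENNReal.ofReal (Real.exp (l * t)) ≤ ⨆ a, ENNReal.ofReal (Real.exp (sgn * l *
        (∑ j, f a j (y j) - ∑ j, ∫ z, f a j z ∂(μ j))))} := by
    rintro y ⟨a, ha⟩
    rw [Set.mem_ofPred_eq]
    refine le_trans ?_ (le_iSup _ a)
    refine ENNReal.ofReal_le_ofReal (Real.exp_le_exp.2 ?_)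
    have := mul_le_mul_of_nonneg_left ha.le hlpos.le
    linarith
  refine (measure_mono hsub).trans ((meas_ge_le_lintegral_div ?_ ?_ ?_).trans ?_)
  · refine (Measurable.iSup fun a => ENNReal.measurable_ofReal.comp (Real.measurable_exp.comp
      (Measurable.const_mul (Measurable.sub_const ?_ _) _))).aemeasurable
    exact Finset.measurable_sum _ fun j _ => (hf a j).comp (measurable_pi_apply j)
  · exact (ENNReal.ofReal_pos.2 (Real.exp_pos _)).ne'
  · exact ENNReal.ofReal_ne_top
  refine (ENNReal.div_le_div_right hmgf _).trans (le_of_eq ?_)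
  rw [mul_div_assoc, ← ENNReal.ofReal_div_of_pos (Real.exp_pos _), ← Real.exp_sub]
  congr 3
  rw [abs_mul, hsgn, abs_of_pos hlpos, mul_pow, ← sq_abs sgn, hsgn, hl]
  field_simp
  ring

end Symmetrization

/-! ### Total variation distance -/

section TotalVariation

lemma abs_sub_le_of_tvDist_le {X : Type*} [MeasurableSpace X] {μ ν : Measure X} {τ : ℝ}
    (hτ : 0 ≤ τ) (h : tvDist μ ν ≤ ENNReal.ofReal τ) {E : Set X} (hE : MeasurableSet E) :
    |μ.real E - ν.real E| ≤ τ :=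
  (ENNReal.ofReal_le_ofReal_iff hτ).1 ((le_iSup₂_of_le E hE le_rfl).trans h)

/-- Integrals of functions with values in `[0, K]` differ by at most `K` times the total variation
distance (layer-cake formula). -/
lemma abs_integral_sub_le_of_nonneg {X : Type*} [MeasurableSpace X] {μ ν : Measure X}
    [IsFiniteMeasure μ] [IsFiniteMeasure ν] {τ K : ℝ} (hK : 0 ≤ K)
    (h : ∀ E, MeasurableSet E → |μ.real E - ν.real E| ≤ τ) {f : X → ℝ} (hf : Measurable f)
    (hfK : ∀ x, f x ∈ Set.Icc 0 K) :
    |∫ x, f x ∂μ - ∫ x, f x ∂ν| ≤ K * τ := by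
  have hint : ∀ ρ : Measure X, IsFiniteMeasure ρ → Integrable f ρ := fun ρ _ =>
    Integrable.of_bound hf.aestronglyMeasurable K (ae_of_all _ fun x => by
      rw [Real.norm_eq_abs, abs_of_nonneg (hfK x).1]; exact (hfK x).2)
  have hlay : ∀ ρ : Measure X, IsFiniteMeasure ρ →
      ∫ x, f x ∂ρ = ∫ t in Set.Ioc 0 K, ρ.real {a | t ≤ f a} := fun ρ hρ =>
    (hint ρ hρ).integral_eq_integral_Ioc_meas_le (ae_of_all _ fun x => (hfK x).1)
      (ae_of_all _ fun x => (hfK x).2)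
  have htail : ∀ ρ : Measure X, IsFiniteMeasure ρ →
      IntegrableOn (fun t => ρ.real {a | t ≤ f a}) (Set.Ioc 0 K) := by
    intro ρ _
    have hanti : Antitone fun t => ρ.real {a | t ≤ f a} := fun s t hst =>
      measureReal_mono fun a (ha : t ≤ f a) => hst.trans ha
    refine Integrable.of_bound hanti.measurable.aestronglyMeasurable (ρ.real Set.univ)
      (ae_of_all _ fun t => ?_)
    rw [Real.norm_eq_abs, abs_of_nonneg measureReal_nonneg]
    exact measureReal_mono (Set.subset_univ _)
  rw [hlay μ inferInstance, hlay ν inferInstance,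
    ← integral_sub (htail μ inferInstance) (htail ν inferInstance), ← Real.norm_eq_abs]
  refine (norm_setIntegral_le_of_norm_le_const (C := τ) (by simp) fun t _ => ?_).trans ?_
  · exact h _ (measurableSet_le measurable_const hf)
  · rw [Real.volume_real_Ioc_of_le hK]; linarith

lemma abs_integral_sub_le_of_nonpos {X : Type*} [MeasurableSpace X] {μ ν : Measure X}
    [IsFiniteMeasure μ] [IsFiniteMeasure ν] {τ K : ℝ} (hK : 0 ≤ K)
    (h : ∀ E, MeasurableSet E → |μ.real E - ν.real E| ≤ τ) {f : X → ℝ} (hf : Measurable f)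
    (hfK : ∀ x, f x ∈ Set.Icc (-K) 0) :
    |∫ x, f x ∂μ - ∫ x, f x ∂ν| ≤ K * τ := by
  have := abs_integral_sub_le_of_nonneg hK h hf.neg (fun x =>
    ⟨neg_nonneg.2 (hfK x).2, neg_le.1 (hfK x).1⟩)
  simp only [Pi.neg_apply, integral_neg] at this
  rwa [← abs_neg, show -(∫ x, f x ∂μ - ∫ x, f x ∂ν) = -∫ x, f x ∂μ - -∫ x, f x ∂ν by ring]

lemma measureReal_prod_eq_integral {X Y : Type*} [MeasurableSpace X] [MeasurableSpace Y]
    (μ : Measure X) (ν : Measure Y) [IsFiniteMeasure μ] [IsFiniteMeasure ν] {S : Set (X × Y)}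
    (hS : MeasurableSet S) :
    (μ.prod ν).real S = ∫ x, ν.real (Prod.mk x ⁻¹' S) ∂μ := by
  rw [measureReal_def, Measure.prod_apply hS, ← integral_toReal]
  · rfl
  · exact (measurable_measure_prodMk_left hS).aemeasurable
  · exact ae_of_all _ fun x => measure_lt_top _ _

end TotalVariation

/-! ### Decoupling of blocks -/

section Decoupling

/-- If each `Y (k + 1)` is within `τ` of being independent of `(Y 0, …, Y k)`, then
`(Y 0, …, Y n)` is within `n τ` of an independent family with the same marginals. -/
lemma abs_measureReal_sub_pi_le {Ω E : Type*} [MeasurableSpace Ω] [MeasurableSpace E]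
    (P : Measure Ω) [IsProbabilityMeasure P] (Y : ℕ → Ω → E) (hY : ∀ j, Measurable (Y j)) {τ : ℝ}
    (h : ∀ (k : ℕ) (S : Set (E × (Fin (k + 1) → E))), MeasurableSet S →
      |P.real {ω | (Y (k + 1) ω, fun i : Fin (k + 1) => Y i ω) ∈ S} -
        ((P.map (Y (k + 1))).prod (P.map fun ω (i : Fin (k + 1)) => Y i ω)).real S| ≤ τ)
    (n : ℕ) (S : Set (Fin (n + 1) → E)) (hS : MeasurableSet S) :
    |P.real {ω | (fun i : Fin (n + 1) => Y i ω) ∈ S} -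
      (Measure.pi fun i : Fin (n + 1) => P.map (Y i)).real S| ≤ n * τ := by
  have hprob : ∀ j, IsProbabilityMeasure (P.map (Y j)) := fun j =>
    Measure.isProbabilityMeasure_map (hY j).aemeasurable
  induction n with
  | zero =>
    have e : P.map (fun ω (i : Fin 1) => Y i ω) = Measure.pi fun i : Fin 1 => P.map (Y i) := by
      symm
      refine Measure.pi_eq fun s hs => ?_
      rw [Measure.map_apply (measurable_pi_lambda _ fun i : Fin 1 => hY i)
        (MeasurableSet.univ_pi hs)]
      simp only [Finset.univ_unique, Finset.prod_singleton]
      rw [Measure.map_apply (hY _) (hs _)]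
      congr 1
      ext ω
      simp [Set.mem_pi]
    have e2 : P.real {ω | (fun i : Fin 1 => Y i ω) ∈ S} =
        (P.map (fun ω (i : Fin 1) => Y i ω)).real S :=
      (map_measureReal_apply (measurable_pi_lambda _ fun i : Fin 1 => hY i) hS).symm
    rw [e2, e]
    simp
  | succ n ih =>
    have hYn : Measurable fun ω (i : Fin (n + 1)) => Y i ω := measurable_pi_lambda _ fun i => hY i
    have hpast : IsProbabilityMeasure (P.map fun ω (i : Fin (n + 1)) => Y i ω) :=
      Measure.isProbabilityMeasure_map hYn.aemeasurable
    let e := MeasurableEquiv.piFinSuccAbove (fun _ : Fin (n + 2) => E) (Fin.last (n + 1))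
    have hS' : MeasurableSet (e.symm ⁻¹' S) := e.symm.measurable hS
    have hpi : (Measure.pi fun i : Fin (n + 2) => P.map (Y i)).real S =
        ((P.map (Y (n + 1))).prod (Measure.pi fun i : Fin (n + 1) => P.map (Y i))).real
          (e.symm ⁻¹' S) := by
      have hmp := (measurePreserving_piFinSuccAbove (fun i : Fin (n + 2) => P.map (Y i))
        (Fin.last (n + 1))).symm
      have := hmp.measureReal_preimage hS.nullMeasurableSet
      rw [← this]
      simp only [Fin.val_last, Fin.succAbove_last, Fin.val_castSucc]
      rfl
    have hP : {ω | (fun i : Fin (n + 2) => Y i ω) ∈ S} =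
        {ω | (Y (n + 1) ω, fun i : Fin (n + 1) => Y i ω) ∈ e.symm ⁻¹' S} := by
      ext ω
      have : e.symm (Y (n + 1) ω, fun i : Fin (n + 1) => Y i ω) = fun i : Fin (n + 2) => Y i ω := by
        rw [MeasurableEquiv.symm_apply_eq]
        refine Prod.ext rfl ?_
        funext i
        simp [e, MeasurableEquiv.piFinSuccAbove, Fin.init]
      simp [this]
    rw [hP, hpi]
    have h1 := h n _ hS'
    have h2 : |((P.map (Y (n + 1))).prod (P.map fun ω (i : Fin (n + 1)) => Y i ω)).real
        (e.symm ⁻¹' S) - ((P.map (Y (n + 1))).prod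
          (Measure.pi fun i : Fin (n + 1) => P.map (Y i))).real (e.symm ⁻¹' S)| ≤ n * τ := by
      have hint : ∀ ρ : Measure (Fin (n + 1) → E), IsProbabilityMeasure ρ →
          Integrable (fun y => ρ.real (Prod.mk y ⁻¹' (e.symm ⁻¹' S))) (P.map (Y (n + 1))) :=
        fun ρ _ => Integrable.of_bound
          (measurable_measure_prodMk_left hS').ennreal_toReal.aestronglyMeasurable 1
          (ae_of_all _ fun y => by
            rw [Real.norm_eq_abs, abs_of_nonneg measureReal_nonneg]; exact measureReal_le_one)
      rw [measureReal_prod_eq_integral _ _ hS', measureReal_prod_eq_integral _ _ hS',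
        ← integral_sub (hint _ inferInstance) (hint _ inferInstance), ← Real.norm_eq_abs]
      refine (norm_integral_le_of_norm_le_const (C := n * τ) (ae_of_all _ fun y => ?_)).trans ?_
      · have hy := ih _ (measurable_prodMk_left (x := y) hS')
        rwa [Real.norm_eq_abs, map_measureReal_apply hYn (measurable_prodMk_left hS')]
      · simp
    push_cast
    refine (abs_sub_le _ _ _).trans ((add_le_add h1 h2).trans (le_of_eq (by ring)))

/-- The block of coordinates `s, s + 1, …, s + m - 1` of a path. -/
def block {X : Type*} (m s : ℕ) (x : ℕ → X) : Fin m → X := fun i => x (s + i)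

lemma measurable_block {X : Type*} [MeasurableSpace X] (m s : ℕ) :
    Measurable (block m s : (ℕ → X) → Fin m → X) :=
  measurable_pi_lambda _ fun _ => measurable_pi_apply _

/-- Every second block of length `m` of a path: its blocks are nearly independent, since
consecutive ones are separated by a gap of `m + 1` time steps. The parity is `p`. -/
lemma abs_measureReal_blocks_sub_pi_le {X : Type*} [MeasurableSpace X] (P : Measure (ℕ → X))
    [IsProbabilityMeasure P] {m p : ℕ} (hm : 1 ≤ m) {τ : ℝ} (hτ : 0 ≤ τ)
    (hβ : betaMixing P (m + 1) ≤ ENNReal.ofReal τ) (n : ℕ) (S : Set (Fin (n + 1) → Fin m → X))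
    (hS : MeasurableSet S) :
    |P.real {x | (fun j : Fin (n + 1) => block m ((2 * j + p) * m) x) ∈ S} -
      (Measure.pi fun j : Fin (n + 1) => P.map (block m ((2 * j + p) * m))).real S| ≤ n * τ := by
  refine abs_measureReal_sub_pi_le P (fun j => block m ((2 * j + p) * m))
    (fun j => measurable_block _ _) (fun k S hS => ?_) n S hS
  -- The last time of block `k`.
  set l : ℕ := (2 * k + p) * m + (m - 1) with hl
  let past : (ℕ → X) → Fin (l + 1) → X := fun x i => x i
  let future : (ℕ → X) → ℕ → X := fun x i => x (l + (m + 1) + i)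
  have hpastm : Measurable past := measurable_pi_lambda _ fun _ => measurable_pi_apply _
  have hfutm : Measurable future := measurable_pi_lambda _ fun _ => measurable_pi_apply _
  have hle : ∀ (j : Fin (k + 1)) (i : Fin m), (2 * (j : ℕ) + p) * m + i < l + 1 := by
    intro j i
    have h1 : (2 * (j : ℕ) + p) * m ≤ (2 * k + p) * m := by
      refine Nat.mul_le_mul_right _ ?_
      have := j.2
      omega
    have := i.2
    omega
  let φ : (Fin (l + 1) → X) → Fin (k + 1) → Fin m → X := fun y j i => y ⟨_, hle j i⟩
  let ψ : (ℕ → X) → Fin m → X := fun y i => y i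
  have hφ : Measurable φ := measurable_pi_lambda _ fun _ => measurable_pi_lambda _ fun _ =>
    measurable_pi_apply _
  have hψ : Measurable ψ := measurable_pi_lambda _ fun _ => measurable_pi_apply _
  have hgap : l + (m + 1) = (2 * (k + 1) + p) * m := by
    have : (2 * (k + 1) + p) * m = (2 * k + p) * m + 2 * m := by ring
    omega
  have e1 : (fun x : ℕ → X => fun j : Fin (k + 1) => block m ((2 * (j : ℕ) + p) * m) x) =
      φ ∘ past := rfl
  have e2 : block m ((2 * (k + 1) + p) * m) = ψ ∘ future := by
    funext x i
    simp only [block, ψ, future, Function.comp_apply, hgap]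
  have m1 : MeasurableSet (Prod.swap ∘ Prod.map φ ψ ⁻¹' S) :=
    (measurable_swap.comp (hφ.prodMap hψ)) hS
  have hβl : tvDist (P.map fun x => (past x, future x)) ((P.map past).prod (P.map future)) ≤
      ENNReal.ofReal τ := iSup_le_iff.1 hβ l
  have htv := abs_sub_le_of_tvDist_le hτ hβl m1
  rw [map_measureReal_apply (hpastm.prodMk hfutm) m1] at htv
  have hpr : IsProbabilityMeasure (P.map past) :=
    Measure.isProbabilityMeasure_map hpastm.aemeasurable
  have hpr2 : IsProbabilityMeasure (P.map future) :=
    Measure.isProbabilityMeasure_map hfutm.aemeasurable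
  have e3 : ((P.map past).prod (P.map future)).real (Prod.swap ∘ Prod.map φ ψ ⁻¹' S) =
      ((P.map (block m ((2 * (k + 1) + p) * m))).prod
        (P.map fun x (j : Fin (k + 1)) => block m ((2 * (j : ℕ) + p) * m) x)).real S := by
    rw [e1, e2, ← Measure.map_map hφ hpastm, ← Measure.map_map hψ hfutm, ← Measure.prod_swap,
      Measure.map_prod_map _ _ hψ hφ, map_measureReal_apply measurable_swap m1,
      map_measureReal_apply (hψ.prodMap hφ) hS]
    rfl
  have e4 : ((fun x => (past x, future x)) ⁻¹' (Prod.swap ∘ Prod.map φ ψ ⁻¹' S)) =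
      {ω | (block m ((2 * (k + 1) + p) * m) ω,
        fun i : Fin (k + 1) => block m ((2 * (i : ℕ) + p) * m) ω) ∈ S} := by
    rw [e2]; rfl
  rw [← e3, ← e4]
  exact htv

end Decoupling

/-! ### Uniform deviations for stationary mixing processes -/

section MixingDeviation

/-- Cutting `0, …, T - 1` into blocks of length `m`, separated by the parity of their index. -/
lemma sum_range_eq_sum_blocks (h : ℕ → ℝ) {T N m : ℕ} (hT : T ≤ N * (2 * m)) :
    ∑ t ∈ Finset.range T, h t =
      (∑ j : Fin N, ∑ i : Fin m, if (2 * (j : ℕ) + 0) * m + i < T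
        then h ((2 * (j : ℕ) + 0) * m + i) else 0) +
      ∑ j : Fin N, ∑ i : Fin m, if (2 * (j : ℕ) + 1) * m + i < T
        then h ((2 * (j : ℕ) + 1) * m + i) else 0 := by
  set g : ℕ → ℝ := fun t => if t < T then h t else 0 with hg
  have h1 : ∑ t ∈ Finset.range T, h t = ∑ t ∈ Finset.range (N * (2 * m)), g t := by
    rw [← Finset.sum_subset (Finset.range_mono hT)]
    · exact Finset.sum_congr rfl fun t ht => by simp [hg, Finset.mem_range.1 ht]
    · intro t _ ht
      simp only [Finset.mem_range] at ht
      simp [hg, ht]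
  have h2 : ∀ N : ℕ, ∑ t ∈ Finset.range (N * (2 * m)), g t =
      (∑ j ∈ Finset.range N, ∑ i ∈ Finset.range m, g ((2 * j + 0) * m + i)) +
      ∑ j ∈ Finset.range N, ∑ i ∈ Finset.range m, g ((2 * j + 1) * m + i) := by
    intro N
    induction N with
    | zero => simp
    | succ N ih =>
      have e : (N + 1) * (2 * m) = N * (2 * m) + m + m := by ring
      rw [e, Finset.sum_range_add, Finset.sum_range_add, ih, Finset.sum_range_succ,
        Finset.sum_range_succ]
      have e1 : N * (2 * m) = (2 * N + 0) * m := by ring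
      have e2 : N * (2 * m) + m = (2 * N + 1) * m := by ring
      rw [e2, e1]
      ring
  rw [h1, h2]
  simp only [Finset.sum_range]
  rfl

variable {A X : Type*} [MeasurableSpace X]

/-- The sum of the losses over the times `< T` of a block that starts at time `s`. -/
def blockLoss (ℓ : A → X → ℝ) (T m s : ℕ) (a : A) (y : Fin m → X) : ℝ :=
  ∑ i : Fin m, if s + i < T then ℓ a (y i) else 0

lemma measurable_blockLoss {ℓ : A → X → ℝ} (hℓ : ∀ a, Measurable (ℓ a)) (T m s : ℕ) (a : A) :
    Measurable (blockLoss ℓ T m s a) := by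
  refine Finset.measurable_sum _ fun i _ => ?_
  split_ifs
  · exact (hℓ a).comp (measurable_pi_apply i)
  · exact measurable_const

omit [MeasurableSpace X] in
lemma abs_blockLoss_le {ℓ : A → X → ℝ} {K : ℝ} (hK : 0 ≤ K) (hℓK : ∀ a z, |ℓ a z| ≤ K)
    (T m s : ℕ) (a : A) (y : Fin m → X) : |blockLoss ℓ T m s a y| ≤ m * K := by
  refine (Finset.abs_sum_le_sum_abs _ _).trans ((Finset.sum_le_sum (g := fun _ => K)
    fun i _ => ?_).trans ?_)
  · split_ifs
    · exact hℓK _ _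
    · simpa using hK
  · simp

lemma integral_blockLoss {ℓ : A → X → ℝ} (hℓ : ∀ a, Measurable (ℓ a)) {K : ℝ}
    (hℓK : ∀ a z, |ℓ a z| ≤ K) {P : Measure (ℕ → X)} [IsProbabilityMeasure P] {π : Measure X}
    (hπ : ∀ t, P.map (fun x => x t) = π) (T m s : ℕ) (a : A) :
    ∫ y, blockLoss ℓ T m s a y ∂(P.map (block m s)) =
      ∑ i : Fin m, if s + i < T then ∫ z, ℓ a z ∂π else 0 := by
  rw [integral_map (measurable_block m s).aemeasurable
    (measurable_blockLoss hℓ T m s a).aestronglyMeasurable]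
  unfold blockLoss
  rw [integral_finsetSum]
  · refine Finset.sum_congr rfl fun i _ => ?_
    split_ifs
    · rw [← hπ (s + i), integral_map (measurable_pi_apply _).aemeasurable
        (hℓ a).aestronglyMeasurable]
      rfl
    · simp
  · intro i _
    split_ifs
    · refine Integrable.of_bound (C := K) ?_ (ae_of_all _ fun x => hℓK a _)
      exact ((hℓ a).comp (measurable_pi_apply _)).aestronglyMeasurable
    · exact integrable_const _

/-- Deviations of the sum of the losses over the blocks of one parity, on one side. -/
lemma measure_exists_block_deviation_le {ι : Type*} [Countable ι] {ℓ : A → X → ℝ}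
    (hℓ : ∀ a, Measurable (ℓ a)) {K : ℝ} (hK : 0 < K) (hℓK : ∀ a z, |ℓ a z| ≤ K)
    {P : Measure (ℕ → X)} [IsProbabilityMeasure P] {π : Measure X}
    (hπ : ∀ t, P.map (fun x => x t) = π) (idx : ι → A) {T m n q p : ℕ} (hm : 1 ≤ m) (hp : p ≤ 1)
    (hT : T ≤ (q + 1) * (2 * m)) {τ u sgn : ℝ} (hτ : 0 ≤ τ) (hu : 0 < u) (hsgn : |sgn| = 1)
    (hβ : betaMixing P (m + 1) ≤ ENNReal.ofReal τ)
    (hcov : ∀ x : Fin T → X, ∃ F : Finset A, F.card ≤ n ∧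
      ∀ a, ∃ a' ∈ F, ∑ t, |ℓ a (x t) - ℓ a' (x t)| ≤ u / 4) :
    P {x | ∃ a : ι, u < sgn * ∑ j : Fin (q + 1), ∑ i : Fin m,
        if (2 * (j : ℕ) + p) * m + i < T
        then ℓ (idx a) (x ((2 * (j : ℕ) + p) * m + i)) - ∫ z, ℓ (idx a) z ∂π else 0} ≤
      n * ENNReal.ofReal (Real.exp (-(u ^ 2 / (32 * (q + 1) * (m * K) ^ 2)))) +
        ENNReal.ofReal (q * τ) := by
  let f : ι → Fin (q + 1) → (Fin m → X) → ℝ := fun a j =>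
    blockLoss ℓ T m ((2 * (j : ℕ) + p) * m) (idx a)
  let μ : Fin (q + 1) → Measure (Fin m → X) := fun j => P.map (block m ((2 * (j : ℕ) + p) * m))
  have hμ : ∀ j, IsProbabilityMeasure (μ j) := fun j =>
    Measure.isProbabilityMeasure_map (measurable_block _ _).aemeasurable
  have hfm : ∀ a j, Measurable (f a j) := fun a j => measurable_blockLoss hℓ _ _ _ _
  let S : Set (Fin (q + 1) → Fin m → X) :=
    {y | ∃ a, u < sgn * (∑ j, f a j (y j) - ∑ j, ∫ z, f a j z ∂(μ j))}
  have hS : MeasurableSet S := by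
    have : S = ⋃ a, {y | u < sgn * (∑ j, f a j (y j) - ∑ j, ∫ z, f a j z ∂(μ j))} := by
      ext y; simp [S]
    rw [this]
    refine MeasurableSet.iUnion fun a => measurableSet_lt measurable_const
      (Measurable.const_mul (Measurable.sub_const ?_ _) _)
    exact Finset.measurable_sum _ fun j _ => (hfm a j).comp (measurable_pi_apply j)
  have hset : {x : ℕ → X | ∃ a : ι, u < sgn * ∑ j : Fin (q + 1), ∑ i : Fin m,
        if (2 * (j : ℕ) + p) * m + i < T
        then ℓ (idx a) (x ((2 * (j : ℕ) + p) * m + i)) - ∫ z, ℓ (idx a) z ∂π else 0} =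
      {x | (fun j : Fin (q + 1) => block m ((2 * j + p) * m) x) ∈ S} := by
    ext x
    simp only [S, Set.mem_ofPred_eq]
    refine exists_congr fun a => ?_
    have hI : ∀ j : Fin (q + 1), ∫ y, f a j y ∂(μ j) = ∑ i : Fin m,
        if (2 * (j : ℕ) + p) * m + i < T then ∫ z, ℓ (idx a) z ∂π else 0 := fun j =>
      integral_blockLoss hℓ hℓK hπ _ _ _ _
    rw [Finset.sum_congr rfl fun j _ => hI j]
    simp only [f, blockLoss, ← Finset.sum_sub_distrib]
    have : ∀ (j : Fin (q + 1)) (i : Fin m),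
        ((if (2 * (j : ℕ) + p) * m + i < T then ℓ (idx a) (block m ((2 * j + p) * m) x i) else 0) -
          if (2 * (j : ℕ) + p) * m + i < T then ∫ z, ℓ (idx a) z ∂π else 0) =
        if (2 * (j : ℕ) + p) * m + i < T
        then ℓ (idx a) (x ((2 * (j : ℕ) + p) * m + i)) - ∫ z, ℓ (idx a) z ∂π else 0 := by
      intro j i
      split_ifs <;> simp [block]
    simp_rw [this]
  have hmpos : (0 : ℝ) < m := by exact_mod_cast hm
  have hind : Measure.pi μ S ≤
      n * ENNReal.ofReal (Real.exp (-(u ^ 2 / (32 * (q + 1) * (m * K) ^ 2)))) := by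
    have := pi_measure_exists_deviation_le (n := n) μ hsgn hu (by simp) (mul_pos hmpos hK) f hfm
      (fun a j y => abs_blockLoss_le hK.le hℓK _ _ _ _ _) (fun y => ?_)
    · simpa using this
    -- A path whose blocks of parity `p` are the given ones.
    have hdiv : ∀ t : Fin T, (t : ℕ) / m / 2 < q + 1 := fun t => by
      rw [Nat.div_div_eq_div_mul, mul_comm]
      exact Nat.div_lt_of_lt_mul (by rw [mul_comm]; exact t.2.trans_le hT)
    let x : Fin T → X := fun t => y ⟨_, hdiv t⟩ ⟨t % m, Nat.mod_lt _ hm⟩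
    obtain ⟨F, hF, hFcov⟩ := hcov x
    classical
    refine ⟨F.image fun a' j => blockLoss ℓ T m ((2 * (j : ℕ) + p) * m) a' (y j),
      Finset.card_image_le.trans hF, ?_, fun a => ?_⟩
    · intro v hv j
      obtain ⟨a', -, rfl⟩ := Finset.mem_image.1 hv
      exact abs_blockLoss_le hK.le hℓK _ _ _ _ _
    obtain ⟨a', ha', hle⟩ := hFcov (idx a)
    refine ⟨_, Finset.mem_image_of_mem _ ha', le_trans ?_ hle⟩
    let h : ℕ → ℝ := fun t => if ht : t < T then |ℓ (idx a) (x ⟨t, ht⟩) - ℓ a' (x ⟨t, ht⟩)| else 0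
    have hh : ∀ t, 0 ≤ h t := fun t => by simp only [h]; split_ifs <;> positivity
    have hsum : ∑ t, |ℓ (idx a) (x t) - ℓ a' (x t)| = ∑ t ∈ Finset.range T, h t := by
      rw [Finset.sum_range]
      exact Finset.sum_congr rfl fun t _ => by simp [h]
    have hpar : ∑ j : Fin (q + 1), ∑ i : Fin m, (if (2 * (j : ℕ) + p) * m + i < T
        then h ((2 * (j : ℕ) + p) * m + i) else 0) ≤ ∑ t ∈ Finset.range T, h t := by
      rw [sum_range_eq_sum_blocks h hT]
      have hnn : ∀ r : ℕ, 0 ≤ ∑ j : Fin (q + 1), ∑ i : Fin m, if (2 * (j : ℕ) + r) * m + i < T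
          then h ((2 * (j : ℕ) + r) * m + i) else 0 := fun r =>
        Finset.sum_nonneg fun j _ => Finset.sum_nonneg fun i _ => by
          split_ifs
          · exact hh _
          · exact le_rfl
      interval_cases p
      · exact le_add_of_nonneg_right (hnn 1)
      · exact le_add_of_nonneg_left (hnn 0)
    rw [hsum]
    refine le_trans (Finset.sum_le_sum fun j _ => ?_) hpar
    simp only [f, blockLoss, ← Finset.sum_sub_distrib]
    refine (Finset.abs_sum_le_sum_abs _ _).trans (Finset.sum_le_sum fun i _ => ?_)
    split_ifs with hlt
    · have hx : x ⟨_, hlt⟩ = y j i := by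
        have hd : ((2 * (j : ℕ) + p) * m + i) / m = 2 * j + p := by
          rw [mul_comm, Nat.mul_add_div hm, Nat.div_eq_of_lt i.2, add_zero]
        simp only [x]
        congr 1
        · congr 1
          rw [hd]
          omega
        · ext
          simp [Nat.mod_eq_of_lt i.2]
      simp [h, hlt, hx]
    · simp
  have hdec := abs_measureReal_blocks_sub_pi_le P hm hτ hβ (p := p) q S hS
  rw [hset]
  have hreal : P.real {x | (fun j : Fin (q + 1) => block m ((2 * j + p) * m) x) ∈ S} ≤
      (Measure.pi μ).real S + q * τ := by
    have := (abs_le.1 hdec).2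
    linarith
  calc P {x | (fun j : Fin (q + 1) => block m ((2 * j + p) * m) x) ∈ S}
      = ENNReal.ofReal (P.real {x | (fun j : Fin (q + 1) => block m ((2 * j + p) * m) x) ∈ S}) := by
        rw [ofReal_measureReal]
    _ ≤ ENNReal.ofReal ((Measure.pi μ).real S + q * τ) := ENNReal.ofReal_le_ofReal hreal
    _ = Measure.pi μ S + ENNReal.ofReal (q * τ) := by
        rw [ENNReal.ofReal_add measureReal_nonneg (by positivity), ofReal_measureReal]
    _ ≤ _ := by gcongr

/-- Uniform deviations of the empirical mean over both parities and both sides. The class needs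
to be pointwise separable only to reduce to countably many functions. -/
lemma measure_exists_deviation_le {ℓ : A → X → ℝ}
    (hℓ : ∀ a, Measurable (ℓ a)) {K : ℝ} (hK : 0 < K) (hℓK : ∀ a z, |ℓ a z| ≤ K)
    (hsep : ∃ S : Set A, S.Countable ∧ ∀ a, ∃ x : ℕ → A, (∀ n, x n ∈ S) ∧
      ∀ z, Tendsto (fun n => ℓ (x n) z) atTop (𝓝 (ℓ a z)))
    {P : Measure (ℕ → X)} [IsProbabilityMeasure P] {π : Measure X} [IsProbabilityMeasure π]
    (hπ : ∀ t, P.map (fun x => x t) = π) {T m n q : ℕ} (hm : 1 ≤ m)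
    (hT : T ≤ (q + 1) * (2 * m)) {τ u : ℝ} (hτ : 0 ≤ τ) (hu : 0 < u)
    (hβ : betaMixing P (m + 1) ≤ ENNReal.ofReal τ)
    (hcov : ∀ x : Fin T → X, ∃ F : Finset A, F.card ≤ n ∧
      ∀ a, ∃ a' ∈ F, ∑ t, |ℓ a (x t) - ℓ a' (x t)| ≤ u / 4) :
    P {x | ∃ a : A, 2 * u < |∑ t ∈ Finset.range T, (ℓ a (x t) - ∫ z, ℓ a z ∂π)|} ≤
      4 * (n * ENNReal.ofReal (Real.exp (-(u ^ 2 / (32 * (q + 1) * (m * K) ^ 2)))) +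
        ENNReal.ofReal (q * τ)) := by
  obtain ⟨S, hSc, hS⟩ := hsep
  have : Countable S := hSc.to_subtype
  let Z : ℕ → ℝ → Set (ℕ → X) := fun p sgn =>
    {x | ∃ a : S, u < sgn * ∑ j : Fin (q + 1), ∑ i : Fin m,
        if (2 * (j : ℕ) + p) * m + i < T
        then ℓ a (x ((2 * (j : ℕ) + p) * m + i)) - ∫ z, ℓ a z ∂π else 0}
  have hZ : ∀ p sgn, p ≤ 1 → |sgn| = 1 → P (Z p sgn) ≤
      n * ENNReal.ofReal (Real.exp (-(u ^ 2 / (32 * (q + 1) * (m * K) ^ 2)))) +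
        ENNReal.ofReal (q * τ) := fun p sgn hp hsgn =>
    measure_exists_block_deviation_le hℓ hK hℓK hπ (fun a : S => (a : A)) hm hp hT hτ hu hsgn hβ
      hcov
  have hsub : {x : ℕ → X | ∃ a : A, 2 * u < |∑ t ∈ Finset.range T, (ℓ a (x t) - ∫ z, ℓ a z ∂π)|} ⊆
      (Z 0 1 ∪ Z 0 (-1)) ∪ (Z 1 1 ∪ Z 1 (-1)) := by
    rintro x ⟨a, ha⟩
    obtain ⟨v, hvS, hv⟩ := hS a
    have hlim : Tendsto (fun n => |∑ t ∈ Finset.range T, (ℓ (v n) (x t) - ∫ z, ℓ (v n) z ∂π)|)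
        atTop (𝓝 |∑ t ∈ Finset.range T, (ℓ a (x t) - ∫ z, ℓ a z ∂π)|) := by
      refine Tendsto.abs (tendsto_finsetSum _ fun t _ => (hv (x t)).sub ?_)
      exact tendsto_integral_of_dominated_convergence (fun _ => K)
        (fun n => (hℓ _).aestronglyMeasurable) (integrable_const _)
        (fun n => ae_of_all _ fun z => hℓK _ z) (ae_of_all _ hv)
    obtain ⟨k, hk⟩ := (hlim.eventually_const_lt ha).exists
    rw [sum_range_eq_sum_blocks (fun t => ℓ (v k) (x t) - ∫ z, ℓ (v k) z ∂π) hT] at hk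
    set s0 := ∑ j : Fin (q + 1), ∑ i : Fin m, if (2 * (j : ℕ) + 0) * m + i < T
        then ℓ (v k) (x ((2 * (j : ℕ) + 0) * m + i)) - ∫ z, ℓ (v k) z ∂π else 0 with hs0
    set s1 := ∑ j : Fin (q + 1), ∑ i : Fin m, if (2 * (j : ℕ) + 1) * m + i < T
        then ℓ (v k) (x ((2 * (j : ℕ) + 1) * m + i)) - ∫ z, ℓ (v k) z ∂π else 0 with hs1
    have hor : (u < 1 * s0 ∨ u < -1 * s0) ∨ (u < 1 * s1 ∨ u < -1 * s1) := by
      by_contra! hcon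
      obtain ⟨⟨c1, c2⟩, c3, c4⟩ := hcon
      have h0 : |s0| ≤ u := abs_le.2 ⟨by linarith, by linarith⟩
      have h1 : |s1| ≤ u := abs_le.2 ⟨by linarith, by linarith⟩
      have := abs_add_le s0 s1
      linarith
    rcases hor with (h | h) | (h | h)
    · exact Or.inl (Or.inl ⟨⟨v k, hvS k⟩, h⟩)
    · exact Or.inl (Or.inr ⟨⟨v k, hvS k⟩, h⟩)
    · exact Or.inr (Or.inl ⟨⟨v k, hvS k⟩, h⟩)
    · exact Or.inr (Or.inr ⟨⟨v k, hvS k⟩, h⟩)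
  refine (measure_mono hsub).trans ?_
  refine (measure_union_le _ _).trans ((add_le_add (measure_union_le _ _)
    (measure_union_le _ _)).trans ?_)
  refine (add_le_add (add_le_add (hZ 0 1 (by norm_num) (by norm_num))
    (hZ 0 (-1) (by norm_num) (by norm_num))) (add_le_add (hZ 1 1 (by norm_num) (by norm_num))
    (hZ 1 (-1) (by norm_num) (by norm_num)))).trans (le_of_eq ?_)
  ring

/-- Uniform deviations under algebraic mixing `β(m) ≤ β₀ m^{-γ}`, with blocks of length
`⌊T^{1/(1+s)}⌋`. -/
lemma measure_exists_deviation_le_of_algebraic_mixing {ℓ : A → X → ℝ}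
    (hℓ : ∀ a, Measurable (ℓ a)) {K : ℝ} (hK : 0 < K) (hℓK : ∀ a z, |ℓ a z| ≤ K)
    (hsep : ∃ S : Set A, S.Countable ∧ ∀ a, ∃ x : ℕ → A, (∀ n, x n ∈ S) ∧
      ∀ z, Tendsto (fun n => ℓ (x n) z) atTop (𝓝 (ℓ a z)))
    {P : Measure (ℕ → X)} [IsProbabilityMeasure P] {π : Measure X} [IsProbabilityMeasure π]
    (hπ : ∀ t, P.map (fun x => x t) = π) {T n : ℕ} (hT : 1 ≤ T) {D s γ β₀ : ℝ} (hD : 0 < D)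
    (hs : 0 < s) (hγ : 0 < γ) (hβ₀ : 0 ≤ β₀)
    (hβ : ∀ m : ℕ, 1 ≤ m → betaMixing P m ≤ ENNReal.ofReal (β₀ * (m : ℝ) ^ (-γ)))
    (hcov : ∀ x : Fin T → X, ∃ F : Finset A, F.card ≤ n ∧
      ∀ a, ∃ a' ∈ F, ∑ t, |ℓ a (x t) - ℓ a' (x t)| ≤ T * (D / 6400)) :
    P {x | ∃ a : A, T * D / 5 < |∑ t ∈ Finset.range T, (ℓ a (x t) - ∫ z, ℓ a z ∂π)|} ≤
      4 * (n * ENNReal.ofReal (Real.exp (-(D ^ 2 / (6400 * K ^ 2) * (T : ℝ) ^ (s / (1 + s))))) +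
        ENNReal.ofReal (2 * β₀ * (T : ℝ) ^ ((s - γ) / (1 + s)))) := by
  have hT0 : (0 : ℝ) < T := by exact_mod_cast hT
  have hT1 : (1 : ℝ) ≤ T := by exact_mod_cast hT
  set w : ℝ := (T : ℝ) ^ (1 / (1 + s)) with hw
  have hw1 : 1 ≤ w := Real.one_le_rpow hT1 (by positivity)
  have hw0 : 0 < w := by linarith
  set m : ℕ := ⌊w⌋₊ with hm
  have hm1 : 1 ≤ m := Nat.le_floor (by simpa using hw1)
  have hmw : (m : ℝ) ≤ w := Nat.floor_le hw0.le
  have hwm : w ≤ (m + 1 : ℕ) := by push_cast; exact (Nat.lt_floor_add_one w).le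
  have hm0 : (1 : ℝ) ≤ m := by exact_mod_cast hm1
  have hwm2 : w ≤ 2 * m := by push_cast at hwm; linarith
  have hmT : (m : ℝ) ≤ T := hmw.trans (by
    calc w ≤ (T : ℝ) ^ (1 : ℝ) := Real.rpow_le_rpow_of_exponent_le hT1
            (by rw [div_le_one (by positivity)]; linarith)
      _ = T := Real.rpow_one _)
  set q : ℕ := T / m with hq
  have hqm : (q : ℝ) * m ≤ T := by exact_mod_cast Nat.div_mul_le_self T m
  have hTq : T ≤ (q + 1) * (2 * m) := by
    have := Nat.lt_div_mul_add (a := T) (b := m) (by omega)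
    nlinarith
  have hTw : (T : ℝ) = w * (T : ℝ) ^ (s / (1 + s)) := by
    rw [hw, ← Real.rpow_add hT0, ← add_div, div_self (by positivity), Real.rpow_one]
  set z : ℝ := (T : ℝ) ^ (s / (1 + s)) with hz
  have hz0 : 0 < z := Real.rpow_pos_of_pos hT0 _
  have hτ : β₀ * ((m + 1 : ℕ) : ℝ) ^ (-γ) ≤ β₀ * w ^ (-γ) :=
    mul_le_mul_of_nonneg_left (Real.rpow_le_rpow_of_nonpos hw0 hwm (by linarith)) hβ₀
  have hτ0 : 0 ≤ β₀ * w ^ (-γ) := mul_nonneg hβ₀ (Real.rpow_nonneg hw0.le _)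
  have key := measure_exists_deviation_le hℓ hK hℓK hsep hπ (u := T * D / 10) hm1 hTq hτ0
    (by positivity) ((hβ (m + 1) (by omega)).trans (ENNReal.ofReal_le_ofReal hτ)) (n := n)
    (fun x => by
      obtain ⟨F, hF, h⟩ := hcov x
      refine ⟨F, hF, fun a => ?_⟩
      obtain ⟨a', ha', h'⟩ := h a
      refine ⟨a', ha', h'.trans ?_⟩
      have : 0 < T * D := by positivity
      linarith)
  have e : 2 * (T * D / 10) = T * D / 5 := by ring
  rw [e] at key
  refine key.trans ?_
  have hexp : D ^ 2 / (6400 * K ^ 2) * z ≤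
      (T * D / 10) ^ 2 / (32 * (q + 1) * (m * K) ^ 2) := by
    rw [div_mul_eq_mul_div, div_le_div_iff₀ (by positivity) (by positivity)]
    have h1 : ((q : ℝ) + 1) * m ≤ 2 * T := by linarith
    have h2 : z * m ≤ T := by rw [hTw, mul_comm w z]; exact mul_le_mul_of_nonneg_left hmw hz0.le
    have h3 : (((q : ℝ) + 1) * m) * (z * m) ≤ (2 * T) * T :=
      mul_le_mul h1 h2 (by positivity) (by positivity)
    have h4 := mul_le_mul_of_nonneg_left h3 (show 0 ≤ 32 * D ^ 2 * K ^ 2 by positivity)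
    nlinarith [h4]
  have hqτ : q * (β₀ * w ^ (-γ)) ≤ 2 * β₀ * (T : ℝ) ^ ((s - γ) / (1 + s)) := by
    have h1 : (q : ℝ) ≤ 2 * z := by
      have h5 : (q : ℝ) * m ≤ 2 * z * m := by
        refine hqm.trans ?_
        rw [hTw]
        nlinarith
      exact le_of_mul_le_mul_right h5 (by linarith)
    have h2 : w ^ (-γ) = (T : ℝ) ^ (-γ / (1 + s)) := by
      rw [hw, ← Real.rpow_mul hT0.le]
      congr 1
      ring
    have h3 : (T : ℝ) ^ ((s - γ) / (1 + s)) = z * w ^ (-γ) := by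
      rw [h2, hz, ← Real.rpow_add hT0, ← add_div]
      rfl
    rw [h3]
    calc q * (β₀ * w ^ (-γ)) ≤ 2 * z * (β₀ * w ^ (-γ)) := mul_le_mul_of_nonneg_right h1 hτ0
      _ = _ := by ring
  gcongr

/-- The event of a large deviation is measurable, since by pointwise separability countably many
functions decide it. -/
lemma measurableSet_exists_deviation {ℓ : A → X → ℝ}
    (hℓ : ∀ a, Measurable (ℓ a)) {K : ℝ} (hℓK : ∀ a z, |ℓ a z| ≤ K)
    (hsep : ∃ S : Set A, S.Countable ∧ ∀ a, ∃ x : ℕ → A, (∀ n, x n ∈ S) ∧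
      ∀ z, Tendsto (fun n => ℓ (x n) z) atTop (𝓝 (ℓ a z)))
    {π : Measure X} [IsProbabilityMeasure π] (T : ℕ) (u : ℝ) :
    MeasurableSet {v : Fin T → X | ∃ a : A, u < |∑ t, (ℓ a (v t) - ∫ z, ℓ a z ∂π)|} := by
  obtain ⟨S, hSc, hS⟩ := hsep
  have hset : {v : Fin T → X | ∃ a : A, u < |∑ t, (ℓ a (v t) - ∫ z, ℓ a z ∂π)|} =
      ⋃ a ∈ S, {v : Fin T → X | u < |∑ t, (ℓ a (v t) - ∫ z, ℓ a z ∂π)|} := by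
    ext v
    simp only [Set.mem_ofPred_eq, Set.mem_iUnion, exists_prop]
    refine ⟨fun ⟨a, ha⟩ => ?_, fun ⟨a, _, ha⟩ => ⟨a, ha⟩⟩
    obtain ⟨w, hwS, hw⟩ := hS a
    have hlim : Tendsto (fun n => |∑ t, (ℓ (w n) (v t) - ∫ z, ℓ (w n) z ∂π)|)
        atTop (𝓝 |∑ t, (ℓ a (v t) - ∫ z, ℓ a z ∂π)|) := by
      refine Tendsto.abs (tendsto_finsetSum _ fun t _ => (hw (v t)).sub ?_)
      exact tendsto_integral_of_dominated_convergence (fun _ => K)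
        (fun n => (hℓ _).aestronglyMeasurable) (integrable_const _)
        (fun n => ae_of_all _ fun z => hℓK _ z) (ae_of_all _ hw)
    obtain ⟨k, hk⟩ := (hlim.eventually_const_lt ha).exists
    exact ⟨w k, hwS k, hk⟩
  rw [hset]
  refine MeasurableSet.biUnion hSc fun a _ => measurableSet_lt measurable_const ?_
  exact (Finset.measurable_sum _ fun t _ =>
    ((hℓ a).comp (measurable_pi_apply t)).sub_const _).abs

end MixingDeviation

/-! ### The transition kernel and perturbation of the stationary distribution -/

section Perturbation

lemma isMarkovKernel_pow {X : Type*} [MeasurableSpace X] (κ : Kernel X X) [IsMarkovKernel κ]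
    (k : ℕ) : IsMarkovKernel (κ ^ k) := by
  induction k with
  | zero => rw [pow_zero]; exact inferInstanceAs (IsMarkovKernel Kernel.id)
  | succ k ih => rw [pow_succ]; exact inferInstanceAs (IsMarkovKernel ((κ ^ k) ∘ₖ κ))

/-- If `π` is invariant for `κ`, and `κ` is uniformly within `τ` of `κ'`, then `π` is within `n τ` of
the law after `n` steps of `κ'` started from `π`; so it is close to any law `π'` to which the
powers of `κ'` converge uniformly. -/
lemma abs_measureReal_sub_le_of_invariant {X : Type*} [MeasurableSpace X] {κ κ' : Kernel X X}
    [IsMarkovKernel κ] [IsMarkovKernel κ'] {π π' : Measure X} [IsProbabilityMeasure π]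
    (hπ : κ.Invariant π) {τ θ : ℝ} {n : ℕ}
    (hκ : ∀ x E, MeasurableSet E → |(κ x).real E - (κ' x).real E| ≤ τ)
    (hn : ∀ x E, MeasurableSet E → |((κ' ^ n) x).real E - π'.real E| ≤ θ)
    {E : Set X} (hE : MeasurableSet E) : |π.real E - π'.real E| ≤ n * τ + θ := by
  have hmk : ∀ k, IsMarkovKernel (κ' ^ k) := isMarkovKernel_pow κ'
  let p : ℕ → X → ℝ := fun k x => ((κ' ^ k) x).real E
  have hpm : ∀ k, Measurable (p k) := fun k => (Kernel.measurable_coe _ hE).ennreal_toReal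
  have hp01 : ∀ k x, p k x ∈ Set.Icc (0 : ℝ) 1 := fun k x =>
    ⟨measureReal_nonneg, measureReal_le_one⟩
  have hint : ∀ k (ρ : Measure X), IsFiniteMeasure ρ → Integrable (p k) ρ := fun k ρ _ =>
    Integrable.of_bound (hpm k).aestronglyMeasurable 1 (ae_of_all _ fun x => by
      rw [Real.norm_eq_abs, abs_of_nonneg (hp01 k x).1]; exact (hp01 k x).2)
  have hsucc : ∀ k x, p (k + 1) x = ∫ y, p k y ∂(κ' x) := by
    intro k x
    have : (κ' ^ (k + 1)) x E = ∫⁻ y, (κ' ^ k) y E ∂(κ' x) := by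
      rw [pow_succ]; exact Kernel.comp_apply' _ _ _ hE
    simp only [p, measureReal_def]
    rw [this, integral_toReal (Kernel.measurable_coe _ hE).aemeasurable
      (ae_of_all _ fun y => measure_lt_top _ _)]
  have hinv : ∀ k, ∫ x, p k x ∂π = ∫ x, ∫ y, p k y ∂(κ x) ∂π := by
    intro k
    have hc : (κ ∘ₖ Kernel.const Unit π) () = π := by
      rw [Kernel.comp_const, Kernel.const_apply, hπ.def]
    have h := Kernel.integral_comp (κ := Kernel.const Unit π) (η := κ) (a := ()) (f := p k)
      (by rw [hc]; exact hint k π inferInstance)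
    rwa [hc, Kernel.const_apply] at h
  have hm : ∀ k (η : Kernel X X), IsMarkovKernel η →
      Integrable (fun x => ∫ y, p k y ∂(η x)) π := by
    intro k η _
    refine Integrable.of_bound (C := 1) ?_ (ae_of_all _ fun x => ?_)
    · exact (StronglyMeasurable.integral_kernel_prod_right' (κ := η)
        (f := fun z : X × X => p k z.2)
        ((hpm k).comp measurable_snd).stronglyMeasurable).aestronglyMeasurable
    · refine (norm_integral_le_of_norm_le_const (C := 1) (ae_of_all _ fun y => ?_)).trans (by simp)
      rw [Real.norm_eq_abs, abs_of_nonneg (hp01 k y).1]; exact (hp01 k y).2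
  have hstep : ∀ k, |∫ x, p k x ∂π - ∫ x, p (k + 1) x ∂π| ≤ τ := by
    intro k
    rw [hinv k]
    simp_rw [hsucc k]
    rw [← integral_sub (hm k κ inferInstance) (hm k κ' inferInstance), ← Real.norm_eq_abs]
    refine (norm_integral_le_of_norm_le_const (C := τ) (ae_of_all _ fun x => ?_)).trans (by simp)
    have := abs_integral_sub_le_of_nonneg zero_le_one (hκ x) (hpm k) (hp01 k)
    simpa using this
  have hp0 : p 0 = E.indicator 1 := by
    funext x
    simp only [p, pow_zero]
    change (Kernel.id x).real E = _
    rw [Kernel.id_apply, measureReal_def, Measure.dirac_apply' _ hE]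
    by_cases hx : x ∈ E <;> simp [hx]
  have hnτ : ∀ k : ℕ, |π.real E - ∫ x, p k x ∂π| ≤ k * τ := by
    intro k
    induction k with
    | zero => simp [hp0, integral_indicator_one hE]
    | succ k ih =>
      push_cast
      refine (abs_sub_le _ _ _).trans ((add_le_add ih (hstep k)).trans (le_of_eq (by ring)))
  have hθ : |∫ x, p n x ∂π - π'.real E| ≤ θ := by
    have : ∫ x, p n x ∂π - π'.real E = ∫ x, (p n x - π'.real E) ∂π := by
      rw [integral_sub (hint n π inferInstance) (integrable_const _)]; simp
    rw [this, ← Real.norm_eq_abs]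
    refine (norm_integral_le_of_norm_le_const (C := θ)
      (ae_of_all _ fun x => hn x E hE)).trans (by simp)
  exact (abs_sub_le _ _ _).trans (add_le_add (hnτ n) hθ)

variable {A B H U : Type*}
variable [Fintype B] [MeasurableSpace B] [MeasurableSingletonClass B]
variable [Fintype H] [MeasurableSpace H] [MeasurableSingletonClass H]
variable [MeasurableSpace U]

lemma Env.step_apply (G : Env A B H U) (a : A) (M : BehaviorModel B H) (x : B × U) :
    G.step a M x = (M (G.sig a x.1 x.2) x.1).toMeasure.prod G.userLaw := by
  rw [Env.step, Kernel.prod_apply, Kernel.comap_apply, Kernel.const_apply]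
  rfl

lemma Env.lintegral_step (G : Env A B H U) (a : A) (M : BehaviorModel B H) (x : B × U)
    {g : B × U → ℝ≥0∞} (hg : Measurable g) :
    ∫⁻ y, g y ∂(G.step a M x) =
      ∑ b', M (G.sig a x.1 x.2) x.1 b' * ∫⁻ u, g (b', u) ∂G.userLaw := by
  rw [G.step_apply, lintegral_prod _ hg.aemeasurable, lintegral_fintype]
  refine Finset.sum_congr rfl fun b' _ => ?_
  rw [PMF.toMeasure_apply_singleton _ _ (measurableSet_singleton _), mul_comm]

lemma Env.step_real_apply (G : Env A B H U) (a : A) (M : BehaviorModel B H) (x : B × U)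
    {E : Set (B × U)} (hE : MeasurableSet E) :
    (G.step a M x).real E =
      ∑ b', entry M (G.sig a x.1 x.2) x.1 b' * G.userLaw.real (Prod.mk b' ⁻¹' E) := by
  rw [G.step_apply, measureReal_prod_eq_integral _ _ hE, integral_fintype .of_finite]
  refine Finset.sum_congr rfl fun b' _ => ?_
  rw [measureReal_def, PMF.toMeasure_apply_singleton _ _ (measurableSet_singleton _), smul_eq_mul]
  rfl

lemma entry_nonneg {B H : Type*} (M : BehaviorModel B H) (h : H) (b b' : B) :
    0 ≤ entry M h b b' := ENNReal.toReal_nonneg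

lemma sum_entry {B H : Type*} [Fintype B] (M : BehaviorModel B H) (h : H) (b : B) :
    ∑ b', entry M h b b' = 1 := by
  unfold entry
  rw [← ENNReal.toReal_sum fun b' _ => PMF.apply_ne_top _ _, ← tsum_fintype (L := .unconditional B),
    PMF.tsum_coe, ENNReal.toReal_one]

lemma Env.abs_step_sub_step_le (G : Env A B H U) (a : A) {M M' : BehaviorModel B H} {r : ℝ}
    (hr : ∀ h b b', |entry M h b b' - entry M' h b b'| ≤ r) (x : B × U)
    {E : Set (B × U)} (hE : MeasurableSet E) :
    |(G.step a M x).real E - (G.step a M' x).real E| ≤ Fintype.card B * r := by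
  rw [G.step_real_apply a M x hE, G.step_real_apply a M' x hE, ← Finset.sum_sub_distrib]
  refine (Finset.abs_sum_le_sum_abs _ _).trans ((Finset.sum_le_sum (g := fun _ => r)
    fun b' _ => ?_).trans (by simp))
  rw [← sub_mul, abs_mul, abs_of_nonneg (measureReal_nonneg (μ := G.userLaw))]
  exact (mul_le_of_le_one_right (abs_nonneg _) measureReal_le_one).trans (hr _ _ _)

lemma Env.stat_eq_zero_or (G : Env A B H U) (a : A) (M : BehaviorModel B H) :
    G.stat a M = 0 ∨ (IsProbabilityMeasure (G.stat a M) ∧ (G.step a M).Invariant (G.stat a M)) := by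
  unfold Env.stat
  split_ifs with h
  · exact Or.inr h.choose_spec
  · exact Or.inl rfl

/-- The stationary distributions of all mechanisms depend continuously, uniformly in the
mechanism, on the behaviour model at a uniformly ergodic model. -/
lemma Env.exists_radius_stat_close (G : Env A B H U) {Mstar : BehaviorModel B H}
    (hUE : G.UniformlyErgodic Mstar) {θ : ℝ} (hθ : 0 < θ) :
    ∃ r : ℝ, 0 < r ∧ ∀ M : BehaviorModel B H,
      (∀ h b b', |entry M h b b' - entry Mstar h b b'| < r) → ∀ a,
      G.stat a M ≠ 0 → ∀ E, MeasurableSet E →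
        |(G.stat a M).real E - (G.stat a Mstar).real E| ≤ θ := by
  obtain ⟨C, ρ, hρ0, hρ1, hC⟩ := hUE
  have hlim : Tendsto (fun n : ℕ => C * ρ ^ n) atTop (𝓝 0) := by
    simpa using (tendsto_pow_atTop_nhds_zero_of_lt_one hρ0 hρ1).const_mul C
  obtain ⟨n, hn⟩ := (hlim.eventually_lt_const (half_pos hθ)).exists
  refine ⟨θ / (2 * (n * Fintype.card B + 1)), by positivity, fun M hM a ha E hE => ?_⟩
  obtain h0 | ⟨hpr, hinv⟩ := G.stat_eq_zero_or a M
  · exact absurd h0 ha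
  refine (abs_measureReal_sub_le_of_invariant (n := n) (θ := θ / 2) hinv
    (fun x E hE => G.abs_step_sub_step_le a (fun h b b' => (hM h b b').le) x hE)
    (fun x E hE => abs_sub_le_of_tvDist_le (half_pos hθ).le
      ((hC a n x).trans (ENNReal.ofReal_le_ofReal hn.le)) hE) hE).trans ?_
  have : (n : ℝ) * (Fintype.card B * (θ / (2 * (n * Fintype.card B + 1)))) ≤ θ / 2 := by
    rw [← mul_assoc, mul_div_assoc', div_le_div_iff₀ (by positivity) (by positivity)]
    nlinarith
  linarith

/-- A uniformly ergodic chain has a stationary distribution. -/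
lemma Env.isProbabilityMeasure_stat (G : Env A B H U) {Mstar : BehaviorModel B H}
    (hUE : G.UniformlyErgodic Mstar) [Nonempty B] (a : A) :
    IsProbabilityMeasure (G.stat a Mstar) := by
  obtain h0 | h := G.stat_eq_zero_or a Mstar
  swap
  · exact h.1
  exfalso
  obtain ⟨C, ρ, hρ0, hρ1, hC⟩ := hUE
  have hlim : Tendsto (fun n : ℕ => C * ρ ^ n) atTop (𝓝 0) := by
    simpa using (tendsto_pow_atTop_nhds_zero_of_lt_one hρ0 hρ1).const_mul C
  obtain ⟨n, hn⟩ := (hlim.eventually_lt_const (half_pos one_pos)).exists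
  have hmk := isMarkovKernel_pow (G.step a Mstar) n
  have hU : Nonempty U := nonempty_of_isProbabilityMeasure G.userLaw
  have x : B × U := Classical.arbitrary _
  have h1 := abs_sub_le_of_tvDist_le (half_pos one_pos).le
    ((hC a n x).trans (ENNReal.ofReal_le_ofReal hn.le)) MeasurableSet.univ
  rw [h0] at h1
  norm_num at h1

end Perturbation

/-! ### Visits of the signal chain -/

section Concentration

set_option linter.unusedSectionVars false

lemma exists_pos_forall_le {ι : Type*} [Finite ι] (f : ι → ℝ) (hf : ∀ i, 0 < f i) :
    ∃ η : ℝ, 0 < η ∧ ∀ i, η ≤ f i := by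
  rcases isEmpty_or_nonempty ι with h | h
  · exact ⟨1, one_pos, fun i => h.elim i⟩
  · obtain ⟨i, hi⟩ := Finite.exists_min f
    exact ⟨f i, hf i, hi⟩

variable {A B H U : Type*}
variable [Fintype B] [DecidableEq B] [MeasurableSpace B] [MeasurableSingletonClass B]
variable [Fintype H] [DecidableEq H] [MeasurableSpace H] [MeasurableSingletonClass H]
variable [MeasurableSpace U]

/-- The pair of the current behaviour and the current signal. -/
def Env.signalState (G : Env A B H U) (a : A) (x : B × U) : B × H := (x.1, G.sig a x.1 x.2)

lemma Env.measurable_signalState (G : Env A B H U) (a : A) : Measurable (G.signalState a) :=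
  measurable_swap.comp (G.measurable_signal a)

lemma Env.measurable_comp_signalState {Y : Type*} [MeasurableSpace Y] (G : Env A B H U) (a : A)
    (V : B × H → Y) : Measurable fun x => V (G.signalState a x) :=
  (measurable_of_finite V).comp (G.measurable_signalState a)

lemma Env.sum_userLaw_signal (G : Env A B H U) (a : A) (b : B) :
    ∑ h, G.userLaw.real {u | G.sig a b u = h} = 1 := by
  have h1 := sum_measureReal_preimage_singleton (μ := G.userLaw) (Finset.univ : Finset H)
    (f := G.sig a b) (fun h _ => G.measurable_sig a b (measurableSet_singleton h))
  simpa [Set.preimage] using h1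

lemma Env.sum_signalChain (G : Env A B H U) (a : A) (M : BehaviorModel B H) (p : B × H) :
    ∑ q, G.signalChain a M p q = 1 := by
  rw [Fintype.sum_prod_type]
  simp only [Env.signalChain, ← Finset.mul_sum, G.sum_userLaw_signal a, mul_one]
  exact sum_entry M p.2 p.1

lemma Env.signalChain_nonneg (G : Env A B H U) (a : A) (M : BehaviorModel B H) (p q : B × H) :
    0 ≤ G.signalChain a M p q := mul_nonneg (entry_nonneg _ _ _ _) measureReal_nonneg

/-- The pair of behaviour and signal is itself a Markov chain, with matrix `signalChain`. -/
lemma Env.lintegral_step_signalState (G : Env A B H U) (a : A) (M : BehaviorModel B H)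
    (V : B × H → ℝ) (hV : ∀ q, 0 ≤ V q) (x : B × U) :
    ∫⁻ y, ENNReal.ofReal (V (G.signalState a y)) ∂(G.step a M x) =
      ENNReal.ofReal (((G.signalChain a M).mulVec V) (G.signalState a x)) := by
  rw [G.lintegral_step a M x (g := fun y => ENNReal.ofReal (V (G.signalState a y)))
    (ENNReal.measurable_ofReal.comp (G.measurable_comp_signalState a V))]
  have h1 : ∀ b', ∫⁻ u, ENNReal.ofReal (V (G.signalState a (b', u))) ∂G.userLaw =
      ENNReal.ofReal (∑ h, G.userLaw.real {u | G.sig a b' u = h} * V (b', h)) := by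
    intro b'
    have hmap := lintegral_map (μ := G.userLaw) (f := fun h => ENNReal.ofReal (V (b', h)))
      (measurable_of_finite _) (G.measurable_sig a b')
    rw [lintegral_fintype] at hmap
    simp only [Env.signalState]
    rw [← hmap, ENNReal.ofReal_sum_of_nonneg fun h _ => mul_nonneg measureReal_nonneg (hV _)]
    refine Finset.sum_congr rfl fun h _ => ?_
    rw [ENNReal.ofReal_mul measureReal_nonneg, ofReal_measureReal,
      Measure.map_apply (G.measurable_sig a b') (measurableSet_singleton h), mul_comm]
    rfl
  simp_rw [h1]
  have h2 : ∀ b', M (G.sig a x.1 x.2) x.1 b' =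
      ENNReal.ofReal (entry M (G.sig a x.1 x.2) x.1 b') := fun b' =>
    (ENNReal.ofReal_toReal (PMF.apply_ne_top _ _)).symm
  simp_rw [h2]
  rw [Matrix.mulVec, dotProduct, Fintype.sum_prod_type, ENNReal.ofReal_sum_of_nonneg]
  · refine Finset.sum_congr rfl fun b' _ => ?_
    rw [← ENNReal.ofReal_mul (entry_nonneg _ _ _ _), Finset.mul_sum]
    congr 1
    refine Finset.sum_congr rfl fun h _ => ?_
    simp only [Env.signalChain, Env.signalState]
    ring
  · exact fun b' _ => Finset.sum_nonneg fun h _ =>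
      mul_nonneg (G.signalChain_nonneg _ _ _ _) (hV _)

/-- Uniform minorization: some power of the signal chain, of exponent at least one, has entries
bounded away from zero. -/
lemma Env.SignalChainErgodic.exists_minorization {G : Env A B H U} {a : A}
    {M : BehaviorModel B H} (h : G.SignalChainErgodic a M) :
    ∃ (n : ℕ) (κ : ℝ), 0 < κ ∧ ∀ p q, κ ≤ (G.signalChain a M ^ (n + 1)) p q := by
  obtain ⟨n, hn⟩ := h
  have hpos : ∀ p q, 0 < (G.signalChain a M ^ (n + 1)) p q := by
    intro p q
    rw [pow_succ', Matrix.mul_apply]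
    have hnn : ∀ z ∈ Finset.univ, 0 ≤ G.signalChain a M p z * (G.signalChain a M ^ n) z q :=
      fun z _ => mul_nonneg (G.signalChain_nonneg _ _ _ _) (hn z q).le
    obtain ⟨z, hz⟩ : ∃ z, G.signalChain a M p z ≠ 0 := by
      by_contra! h0
      have := G.sum_signalChain a M p
      simp [h0] at this
    refine Finset.sum_pos' hnn ⟨z, Finset.mem_univ _, mul_pos ?_ (hn z q)⟩
    exact lt_of_le_of_ne (G.signalChain_nonneg _ _ _ _) hz.symm
  obtain ⟨κ, hκ, hle⟩ := exists_pos_forall_le (fun pq : (B × H) × (B × H) =>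
    (G.signalChain a M ^ (n + 1)) pq.1 pq.2) fun pq => hpos _ _
  exact ⟨n, κ, hκ, fun p q => hle (p, q)⟩

/-- The transition matrix in which arrivals at `q` are discounted by `e⁻¹`. -/
def discounted {Z : Type*} [DecidableEq Z] (Q : Matrix Z Z ℝ) (q : Z) : Matrix Z Z ℝ :=
  fun p z => Q p z * if z = q then Real.exp (-1) else 1

lemma mulVec_mono {Z : Type*} [Fintype Z] {Q : Matrix Z Z ℝ} (hQ : ∀ p z, 0 ≤ Q p z)
    {V W : Z → ℝ} (h : ∀ z, V z ≤ W z) (p : Z) : (Q.mulVec V) p ≤ (Q.mulVec W) p :=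
  Finset.sum_le_sum fun z _ => mul_le_mul_of_nonneg_left (h z) (hQ p z)

/-- The discounted matrix contracts constants geometrically, as soon as `q` is reached in `n + 1`
steps with probability at least `κ` from everywhere. -/
lemma discounted_pow_mulVec_one_le {Z : Type*} [Fintype Z] [DecidableEq Z] {Q : Matrix Z Z ℝ}
    (hQ : ∀ p z, 0 ≤ Q p z) (hQ1 : ∀ p, ∑ z, Q p z = 1) {q : Z} {n : ℕ} {κ : ℝ}
    (hκ : ∀ p, κ ≤ (Q ^ (n + 1)) p q) (k : ℕ) (p : Z) :
    ((discounted Q q ^ k).mulVec 1) p ≤ (1 - (1 - Real.exp (-1)) * κ) ^ (k / (n + 1)) := by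
  set D := discounted Q q with hD
  set lam : ℝ := 1 - (1 - Real.exp (-1)) * κ with hlam
  have he1 : Real.exp (-1) ≤ 1 := Real.exp_le_one_iff.2 (by norm_num)
  have hw01 : ∀ z, (0 : ℝ) ≤ (if z = q then Real.exp (-1) else 1) ∧
      (if z = q then Real.exp (-1) else (1 : ℝ)) ≤ 1 := by
    intro z
    split_ifs
    · exact ⟨(Real.exp_pos _).le, he1⟩
    · exact ⟨zero_le_one, le_rfl⟩
  have hD0 : ∀ p z, 0 ≤ D p z := fun p z => mul_nonneg (hQ p z) (hw01 z).1
  have hDQ : ∀ p z, D p z ≤ Q p z := fun p z => mul_le_of_le_one_right (hQ p z) (hw01 z).2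
  have hDk : ∀ k p z, 0 ≤ (D ^ k) p z := by
    intro k
    induction k with
    | zero => intro p z; rw [pow_zero, Matrix.one_apply]; split_ifs <;> norm_num
    | succ k ih =>
      intro p z
      rw [pow_succ, Matrix.mul_apply]
      exact Finset.sum_nonneg fun y _ => mul_nonneg (ih p y) (hD0 y z)
  have hDQV : ∀ k (V : Z → ℝ), (∀ z, 0 ≤ V z) → ∀ p,
      0 ≤ ((D ^ k).mulVec V) p ∧ ((D ^ k).mulVec V) p ≤ ((Q ^ k).mulVec V) p := by
    intro k V hV
    induction k with
    | zero => intro p; simpa using hV p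
    | succ k ih =>
      intro p
      rw [pow_succ', pow_succ', ← Matrix.mulVec_mulVec, ← Matrix.mulVec_mulVec]
      refine ⟨Finset.sum_nonneg fun z _ => mul_nonneg (hD0 p z) (ih z).1, ?_⟩
      refine (mulVec_mono hD0 (fun z => (ih z).2) p).trans ?_
      exact Finset.sum_le_sum fun z _ => mul_le_mul_of_nonneg_right (hDQ p z)
        ((ih z).1.trans (ih z).2)
  have hQk1 : ∀ k p, ∑ z, (Q ^ k) p z = 1 := by
    intro k
    induction k with
    | zero => intro p; simp [Matrix.one_apply]
    | succ k ih =>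
      intro p
      simp only [pow_succ', Matrix.mul_apply]
      rw [Finset.sum_comm]
      simp_rw [← Finset.mul_sum, ih, mul_one, hQ1]
  have hD1 : ∀ k p, ((D ^ k).mulVec 1) p ≤ 1 := by
    intro k p
    refine (hDQV k 1 (fun _ => zero_le_one) p).2.trans (le_of_eq ?_)
    simp [Matrix.mulVec, dotProduct, hQk1]
  have hblock : ∀ p, ((D ^ (n + 1)).mulVec 1) p ≤ lam := by
    intro p
    have e1 : D.mulVec 1 = Q.mulVec fun z => if z = q then Real.exp (-1) else 1 := by
      funext p
      simp [Matrix.mulVec, dotProduct, hD, discounted]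
    rw [pow_succ, ← Matrix.mulVec_mulVec]
    refine (hDQV n _ (fun z => ?_) p).2.trans ?_
    · rw [e1]; exact Finset.sum_nonneg fun y _ => mul_nonneg (hQ z y) (hw01 y).1
    rw [e1, Matrix.mulVec_mulVec, ← pow_succ]
    have e2 : ((Q ^ (n + 1)).mulVec fun z => if z = q then Real.exp (-1) else 1) p =
        1 - (1 - Real.exp (-1)) * (Q ^ (n + 1)) p q := by
      have : ∀ z, (Q ^ (n + 1)) p z * (if z = q then Real.exp (-1) else 1) =
          (Q ^ (n + 1)) p z - if z = q then (1 - Real.exp (-1)) * (Q ^ (n + 1)) p z else 0 := by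
        intro z; split_ifs <;> ring
      simp only [Matrix.mulVec, dotProduct, this, Finset.sum_sub_distrib, hQk1,
        Finset.sum_ite_eq', Finset.mem_univ, if_true]
    rw [e2, hlam]
    have := mul_le_mul_of_nonneg_left (hκ p) (sub_nonneg.2 he1)
    linarith
  have hlam0 : 0 ≤ lam := (hDQV _ 1 (fun _ => zero_le_one) p).1.trans (hblock p)
  have hpow : ∀ j i p, ((D ^ (j * (n + 1) + i)).mulVec 1) p ≤ lam ^ j := by
    intro j i
    induction j with
    | zero => intro p; simpa using hD1 i p
    | succ j ih =>
      intro p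
      have e : (j + 1) * (n + 1) + i = (j * (n + 1) + i) + (n + 1) := by ring
      rw [e, pow_add, ← Matrix.mulVec_mulVec]
      refine (mulVec_mono (hDk _) (W := fun _ => lam * 1) (fun z => ?_) p).trans ?_
      · simpa using hblock z
      · have e3 : ((D ^ (j * (n + 1) + i)).mulVec fun _ => lam * 1) p =
            lam * ((D ^ (j * (n + 1) + i)).mulVec 1) p := by
          simp [Matrix.mulVec, dotProduct, ← Finset.sum_mul, mul_comm]
        rw [e3, pow_succ']
        exact mul_le_mul_of_nonneg_left (ih p) hlam0
  have := hpow (k / (n + 1)) (k % (n + 1)) p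
  rwa [Nat.div_add_mod'] at this

/-- The weight `e⁻¹` at the state `q` of the signal chain, and `1` elsewhere. -/
def visitWeight {Z : Type*} [DecidableEq Z] (q z : Z) : ℝ := if z = q then Real.exp (-1) else 1

/-- Exponential moment of minus the number of visits, through powers of the discounted matrix. -/
lemma Env.lintegral_visitWeight_le (G : Env A B H U) (a : A) (M : BehaviorModel B H)
    (μ : Measure (B × U)) [IsProbabilityMeasure μ] (q : B × H) (k : ℕ) (V : B × H → ℝ)
    (hV : ∀ z, 0 ≤ V z) {β : ℝ} (hβ : ∀ p, ((discounted (G.signalChain a M) q ^ k).mulVec V) p ≤ β) :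
    ∫⁻ x, (∏ t ∈ Finset.range k, ENNReal.ofReal (visitWeight q (G.signalState a (x t)))) *
      ENNReal.ofReal (visitWeight q (G.signalState a (x k)) * V (G.signalState a (x k)))
      ∂(pathLaw μ (G.step a M)) ≤ ENNReal.ofReal β := by
  have hw0 : ∀ z, 0 ≤ visitWeight q z := fun z => by
    unfold visitWeight; split_ifs <;> positivity
  have hw1 : ∀ z, visitWeight q z ≤ 1 := fun z => by
    unfold visitWeight
    split_ifs
    · exact Real.exp_le_one_iff.2 (by norm_num)
    · exact le_rfl
  induction k generalizing V with
  | zero =>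
    refine (lintegral_mono (g := fun _ => ENNReal.ofReal β) fun x => ?_).trans (by simp)
    simp only [Finset.range_zero, Finset.prod_empty, one_mul]
    refine ENNReal.ofReal_le_ofReal ((mul_le_of_le_one_left (hV _) (hw1 _)).trans ?_)
    simpa using hβ (G.signalState a (x 0))
  | succ k ih =>
    have hD0 : ∀ z, 0 ≤ ((discounted (G.signalChain a M) q).mulVec V) z := fun z =>
      Finset.sum_nonneg fun y _ => mul_nonneg (mul_nonneg (G.signalChain_nonneg _ _ _ _) (hw0 y))
        (hV y)
    have ih' := ih ((discounted (G.signalChain a M) q).mulVec V) hD0 (fun p => by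
      rw [Matrix.mulVec_mulVec, ← pow_succ]; exact hβ p)
    refine le_trans (le_of_eq ?_) ih'
    have hmw : Measurable fun x : B × U =>
        ENNReal.ofReal (visitWeight q (G.signalState a x)) :=
      G.measurable_comp_signalState a fun z => ENNReal.ofReal (visitWeight q z)
    have hmV : Measurable fun x : B × U => ENNReal.ofReal
        (visitWeight q (G.signalState a x) * V (G.signalState a x)) :=
      G.measurable_comp_signalState a fun z => ENNReal.ofReal (visitWeight q z * V z)
    have hM := lintegral_pathLaw_prod μ (G.step a M) k
      (G := fun _ x _ => ENNReal.ofReal (visitWeight q (G.signalState a x)))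
      (fun _ => hmw.comp measurable_fst)
      (g := fun x y => ENNReal.ofReal (visitWeight q (G.signalState a x)) *
        ENNReal.ofReal (visitWeight q (G.signalState a y) * V (G.signalState a y)))
      ((hmw.comp measurable_fst).mul (hmV.comp measurable_snd))
    simp only [Finset.prod_range_succ]
    simp_rw [mul_assoc]
    refine Eq.trans hM (lintegral_congr fun x => ?_)
    congr 1
    rw [lintegral_const_mul _ hmV, ENNReal.ofReal_mul (hw0 _)]
    congr 1
    have := G.lintegral_step_signalState a M (fun z => visitWeight q z * V z)
      (fun z => mul_nonneg (hw0 z) (hV z)) (x k)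
    rw [this]
    congr 1
    refine Finset.sum_congr rfl fun z _ => ?_
    simp only [discounted, visitWeight]
    ring

/-- The number of visits of the signal chain to `q` before time `T`. -/
def Env.visits (G : Env A B H U) (a : A) (q : B × H) (T : ℕ) (x : ℕ → B × U) : ℝ :=
  ∑ t ∈ Finset.range T, if G.signalState a (x t) = q then 1 else 0

/-- Every pair of behaviour and signal is visited linearly often, up to exponentially small
probability. -/
lemma Env.SignalChainErgodic.exists_visits_bound {G : Env A B H U} {a : A}
    {M : BehaviorModel B H} (h : G.SignalChainErgodic a M) :
    ∃ c C c' : ℝ, 0 < c ∧ 0 < C ∧ 0 < c' ∧ ∀ (μ : Measure (B × U)) [IsProbabilityMeasure μ]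
      (q : B × H) (T : ℕ), pathLaw μ (G.step a M) {x | G.visits a q T x ≤ c * T} ≤
        ENNReal.ofReal (C * Real.exp (-(c' * T))) := by
  obtain ⟨n, κ, hκ0, hκ⟩ := h.exists_minorization
  have he0 := Real.exp_pos (-1)
  have he1 : Real.exp (-1) < 1 := by rw [Real.exp_lt_one_iff]; norm_num
  rcases isEmpty_or_nonempty (B × H) with hE | ⟨⟨q₀⟩⟩
  · exact ⟨1, 1, 1, one_pos, one_pos, one_pos, fun _ _ q => (hE.elim q)⟩
  have hQk1 : κ ≤ 1 := by
    refine (hκ q₀ q₀).trans ?_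
    have hrow : ∀ k p, (∀ z, 0 ≤ (G.signalChain a M ^ k) p z) ∧
        ∑ z, (G.signalChain a M ^ k) p z = 1 := by
      intro k
      induction k with
      | zero =>
        intro p
        refine ⟨fun z => ?_, by simp [Matrix.one_apply]⟩
        rw [pow_zero, Matrix.one_apply]; split_ifs <;> norm_num
      | succ k ih =>
        intro p
        refine ⟨fun z => ?_, ?_⟩
        · rw [pow_succ', Matrix.mul_apply]
          exact Finset.sum_nonneg fun y _ => mul_nonneg (G.signalChain_nonneg _ _ _ _) ((ih y).1 z)
        · simp only [pow_succ', Matrix.mul_apply]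
          rw [Finset.sum_comm]
          simp_rw [← Finset.mul_sum, (ih _).2, mul_one, G.sum_signalChain]
    rw [← (hrow (n + 1) q₀).2]
    exact Finset.single_le_sum (f := fun z => (G.signalChain a M ^ (n + 1)) q₀ z)
      (fun z _ => (hrow (n + 1) q₀).1 z) (Finset.mem_univ q₀)
  set lam : ℝ := 1 - (1 - Real.exp (-1)) * κ with hlam
  have hlam0 : 0 < lam := by rw [hlam]; nlinarith
  have hlam1 : lam < 1 := by rw [hlam]; nlinarith
  set c : ℝ := -Real.log lam / (2 * (n + 1)) with hc
  have hlog : Real.log lam < 0 := Real.log_neg hlam0 hlam1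
  have hc0 : 0 < c := div_pos (by linarith) (by positivity)
  refine ⟨c, 1 / lam, c, hc0, by positivity, hc0, fun μ _ q T => ?_⟩
  rcases Nat.eq_zero_or_pos T with rfl | hT
  · have : (1 : ℝ≥0∞) ≤ ENNReal.ofReal (1 / lam * Real.exp (-(c * (0 : ℕ)))) := by
      rw [← ENNReal.ofReal_one]
      refine ENNReal.ofReal_le_ofReal ?_
      simp only [Nat.cast_zero, mul_zero, neg_zero, Real.exp_zero, mul_one]
      rw [le_div_iff₀ hlam0]; linarith
    exact prob_le_one.trans this
  obtain ⟨k, rfl⟩ : ∃ k, T = k + 1 := ⟨T - 1, by omega⟩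
  have hmom := G.lintegral_visitWeight_le a M μ q k 1 (fun _ => zero_le_one)
    (discounted_pow_mulVec_one_le (G.signalChain_nonneg a M) (G.sum_signalChain a M)
      (fun p => hκ p q) k)
  have hprod : ∀ x : ℕ → B × U, ENNReal.ofReal (Real.exp (-(G.visits a q (k + 1) x))) =
      (∏ t ∈ Finset.range k, ENNReal.ofReal (visitWeight q (G.signalState a (x t)))) *
      ENNReal.ofReal (visitWeight q (G.signalState a (x k)) *
        (1 : B × H → ℝ) (G.signalState a (x k))) := by
    intro x
    have hw0 : ∀ z : B × H, 0 ≤ visitWeight q z := fun z => by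
      unfold visitWeight; split_ifs <;> positivity
    rw [Pi.one_apply, mul_one, ← Finset.prod_range_succ (fun t =>
      ENNReal.ofReal (visitWeight q (G.signalState a (x t)))),
      ← ENNReal.ofReal_prod_of_nonneg fun t _ => hw0 _]
    congr 1
    rw [Env.visits, ← Finset.sum_neg_distrib, Real.exp_sum]
    refine Finset.prod_congr rfl fun t _ => ?_
    unfold visitWeight
    split_ifs <;> simp
  rw [← lintegral_congr hprod] at hmom
  have hmeas : Measurable fun x : ℕ → B × U =>
      ENNReal.ofReal (Real.exp (-(G.visits a q (k + 1) x))) := by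
    refine ENNReal.measurable_ofReal.comp (Real.measurable_exp.comp (Measurable.neg ?_))
    exact Finset.measurable_sum _ fun t _ => (G.measurable_comp_signalState a
      (fun z => if z = q then (1 : ℝ) else 0)).comp (measurable_pi_apply t)
  have hsub : {x | G.visits a q (k + 1) x ≤ c * (k + 1 : ℕ)} ⊆
      {x | ENNReal.ofReal (Real.exp (-(c * (k + 1 : ℕ)))) ≤
        ENNReal.ofReal (Real.exp (-(G.visits a q (k + 1) x)))} := fun x hx =>
    ENNReal.ofReal_le_ofReal (Real.exp_le_exp.2 (neg_le_neg hx))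
  refine (measure_mono hsub).trans ((meas_ge_le_lintegral_div hmeas.aemeasurable
    (ENNReal.ofReal_pos.2 (Real.exp_pos _)).ne' ENNReal.ofReal_ne_top).trans ?_)
  refine (ENNReal.div_le_div_right hmom _).trans ?_
  rw [← ENNReal.ofReal_div_of_pos (Real.exp_pos _)]
  refine ENNReal.ofReal_le_ofReal ?_
  -- `⌊k / (n + 1)⌋ ≥ (k + 1) / (n + 1) - 1`, and `lam = exp (-2 c (n + 1))`.
  have hfl : ((k + 1 : ℕ) : ℝ) / (n + 1) - 1 ≤ ((k / (n + 1) : ℕ) : ℝ) := by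
    have h1 := Nat.lt_div_mul_add (a := k) (b := n + 1) (by omega)
    have h2 : k + 1 ≤ k / (n + 1) * (n + 1) + (n + 1) := h1
    have h3 : ((k + 1 : ℕ) : ℝ) ≤ (k / (n + 1) : ℕ) * ((n : ℝ) + 1) + (n + 1) := by
      exact_mod_cast h2
    rw [sub_le_iff_le_add, div_le_iff₀ (by positivity)]
    linarith
  have hl : Real.log lam = -(2 * (n + 1) * c) := by rw [hc]; field_simp
  have hlp : lam ^ (k / (n + 1)) = Real.exp (-(2 * (n + 1) * c) * (k / (n + 1) : ℕ)) := by
    rw [← hl, ← Real.rpow_natCast, Real.rpow_def_of_pos hlam0]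
  have hli : 1 / lam = Real.exp (2 * (n + 1) * c) := by
    rw [← neg_neg (2 * ((n : ℝ) + 1) * c), ← hl, Real.exp_neg, Real.exp_log hlam0, one_div]
  rw [hlp, hli, ← Real.exp_sub, ← Real.exp_add]
  refine Real.exp_le_exp.2 ?_
  have h4 := mul_le_mul_of_nonneg_left hfl (show 0 ≤ 2 * ((n : ℝ) + 1) * c by positivity)
  have h5 : 2 * ((n : ℝ) + 1) * c * (((k + 1 : ℕ) : ℝ) / (n + 1) - 1) =
      2 * c * ((k + 1 : ℕ) : ℝ) - 2 * (n + 1) * c := by field_simp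
  rw [h5] at h4
  linarith

end Concentration

/-! ### Typical historical data -/

section TypicalData

set_option linter.unusedSectionVars false

variable {A B H U : Type*}
variable [Fintype B] [DecidableEq B] [MeasurableSpace B] [MeasurableSingletonClass B]
variable [Fintype H] [DecidableEq H] [MeasurableSpace H] [MeasurableSingletonClass H]
variable [MeasurableSpace U]

/-- The centred indicator of a transition from `b` to `b'` under the signal `h`. -/
def Env.transitionNoise (G : Env A B H U) (a : A) (M : BehaviorModel B H) (h : H) (b b' : B)
    (x y : B × U) : ℝ :=
  if x.1 = b ∧ G.sig a x.1 x.2 = h then (if y.1 = b' then 1 else 0) - entry M h b b' else 0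

lemma Env.measurable_transitionNoise (G : Env A B H U) (a : A) (M : BehaviorModel B H) (h : H)
    (b b' : B) : Measurable (Function.uncurry (G.transitionNoise a M h b b')) := by
  have := (measurable_of_finite fun p : (B × H) × B =>
    if p.1.1 = b ∧ p.1.2 = h then (if p.2 = b' then (1 : ℝ) else 0) - entry M h b b' else 0).comp
    (((G.measurable_signalState a).comp measurable_fst).prodMk
      (measurable_fst.comp measurable_snd) : Measurable fun p : (B × U) × (B × U) =>
        (G.signalState a p.1, p.2.1))
  exact this

lemma entry_le_one {B H : Type*} (M : BehaviorModel B H) (h : H) (b b' : B) :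
    entry M h b b' ≤ 1 := by
  unfold entry
  rw [← ENNReal.toReal_one]
  exact ENNReal.toReal_mono ENNReal.one_ne_top (PMF.coe_le_one _ _)

/-- Conditionally on the past, the noise of a transition is centred and bounded by one, hence
has a sub-Gaussian exponential moment. -/
lemma Env.lintegral_exp_transitionNoise_le (G : Env A B H U) (a : A) (M : BehaviorModel B H)
    (h : H) (b b' : B) {l : ℝ} (hl : |l| ≤ 1) (x : B × U) :
    ∫⁻ y, ENNReal.ofReal (Real.exp (l * G.transitionNoise a M h b b' x y)) ∂(G.step a M x) ≤
      ENNReal.ofReal (Real.exp (l ^ 2)) := by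
  by_cases hx : x.1 = b ∧ G.sig a x.1 x.2 = h
  swap
  · simp only [Env.transitionNoise, hx, if_false, mul_zero, Real.exp_zero, lintegral_const,
      measure_univ, mul_one]
    exact ENNReal.ofReal_le_ofReal (Real.one_le_exp (sq_nonneg _))
  set p := entry M h b b' with hp
  let d : B → ℝ := fun c => (if c = b' then 1 else 0) - p
  have hmeas : Measurable fun y : B × U =>
      ENNReal.ofReal (Real.exp (l * G.transitionNoise a M h b b' x y)) :=
    ENNReal.measurable_ofReal.comp (Real.measurable_exp.comp (Measurable.const_mul
      ((G.measurable_transitionNoise a M h b b').comp measurable_prodMk_left) l))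
  have hd : ∀ (c : B) (u : U), G.transitionNoise a M h b b' x (c, u) = d c := by
    intro c u
    simp only [Env.transitionNoise]
    rw [if_pos hx]
  rw [G.lintegral_step a M x hmeas, hx.2, hx.1]
  simp only [hd, lintegral_const, measure_univ, mul_one]
  have h2 : ∀ c, M h b c = ENNReal.ofReal (entry M h b c) := fun c =>
    (ENNReal.ofReal_toReal (PMF.apply_ne_top _ _)).symm
  simp_rw [h2]
  rw [Finset.sum_congr rfl fun c _ => (ENNReal.ofReal_mul (entry_nonneg M h b c)).symm,
    ← ENNReal.ofReal_sum_of_nonneg fun c _ =>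
      mul_nonneg (entry_nonneg M h b c) (Real.exp_pos _).le]
  refine ENNReal.ofReal_le_ofReal ?_
  have hp0 := entry_nonneg M h b b'
  have hp1 := entry_le_one M h b b'
  have hd1 : ∀ c, |d c| ≤ 1 := by
    intro c
    simp only [d, hp]
    split_ifs <;> exact abs_le.2 ⟨by linarith, by linarith⟩
  have hexp : ∀ c, Real.exp (l * d c) ≤ 1 + l * d c + l ^ 2 := by
    intro c
    have hld : |l * d c| ≤ 1 := by
      rw [abs_mul]; exact mul_le_one₀ hl (abs_nonneg _) (hd1 c)
    have h1 := (abs_le.1 (Real.abs_exp_sub_one_sub_id_le hld)).2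
    have h3 : (l * d c) ^ 2 ≤ l ^ 2 := by
      rw [mul_pow]
      refine mul_le_of_le_one_right (sq_nonneg _) ?_
      rw [← sq_abs]
      exact pow_le_one₀ (abs_nonneg _) (hd1 c)
    linarith
  have hmean : ∑ c, entry M h b c * d c = 0 := by
    simp only [d, mul_sub, Finset.sum_sub_distrib, ← Finset.sum_mul, sum_entry]
    simp [hp]
  calc ∑ c, entry M h b c * Real.exp (l * d c)
      ≤ ∑ c, entry M h b c * (1 + l * d c + l ^ 2) :=
        Finset.sum_le_sum fun c _ => mul_le_mul_of_nonneg_left (hexp c) (entry_nonneg _ _ _ _)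
    _ = (∑ c, entry M h b c) * (1 + l ^ 2) + l * ∑ c, entry M h b c * d c := by
        rw [Finset.sum_mul, Finset.mul_sum, ← Finset.sum_add_distrib]
        exact Finset.sum_congr rfl fun c _ => by ring
    _ = 1 + l ^ 2 := by rw [sum_entry, hmean]; ring
    _ ≤ Real.exp (l ^ 2) := by linarith [Real.add_one_le_exp (l ^ 2)]

lemma Env.lintegral_exp_sum_transitionNoise_le (G : Env A B H U) (a : A) (M : BehaviorModel B H)
    (h : H) (b b' : B) {l : ℝ} (hl : |l| ≤ 1) (μ : Measure (B × U)) [IsProbabilityMeasure μ]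
    (T : ℕ) :
    ∫⁻ x, ∏ t ∈ Finset.range T, ENNReal.ofReal
        (Real.exp (l * G.transitionNoise a M h b b' (x t) (x (t + 1)))) ∂(pathLaw μ (G.step a M)) ≤
      ENNReal.ofReal (Real.exp (l ^ 2)) ^ T := by
  induction T with
  | zero => simp
  | succ T ih =>
    have hm : Measurable (Function.uncurry fun x y : B × U => ENNReal.ofReal
        (Real.exp (l * G.transitionNoise a M h b b' x y))) :=
      ENNReal.measurable_ofReal.comp (Real.measurable_exp.comp (Measurable.const_mul
        (G.measurable_transitionNoise a M h b b') l))
    simp only [Finset.prod_range_succ]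
    set g : B × U → B × U → ℝ≥0∞ := fun x y => ENNReal.ofReal
        (Real.exp (l * G.transitionNoise a M h b b' x y)) with hg
    have hstep : ∀ x, ∫⁻ y, g x y ∂(G.step a M x) ≤ ENNReal.ofReal (Real.exp (l ^ 2)) :=
      G.lintegral_exp_transitionNoise_le a M h b b' hl
    calc ∫⁻ x, (∏ t ∈ Finset.range T, g (x t) (x (t + 1))) * g (x T) (x (T + 1))
          ∂(pathLaw μ (G.step a M))
        = ∫⁻ x, (∏ t ∈ Finset.range T, g (x t) (x (t + 1))) * ∫⁻ y, g (x T) y ∂(G.step a M (x T))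
          ∂(pathLaw μ (G.step a M)) :=
          lintegral_pathLaw_prod μ (G.step a M) T (G := fun _ => g) (fun _ => hm) hm
      _ ≤ ∫⁻ x, (∏ t ∈ Finset.range T, g (x t) (x (t + 1))) * ENNReal.ofReal (Real.exp (l ^ 2))
          ∂(pathLaw μ (G.step a M)) := lintegral_mono fun x => mul_le_mul' le_rfl (hstep (x T))
      _ ≤ _ := by
          rw [lintegral_mul_const' _ _ ENNReal.ofReal_ne_top, pow_succ]
          exact mul_le_mul' ih le_rfl

lemma Env.measure_transitionNoise_ge_le (G : Env A B H U) (a : A) (M : BehaviorModel B H)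
    (h : H) (b b' : B) {sgn ρ : ℝ} (hs : |sgn| = 1) (hρ : 0 < ρ) (hρ2 : ρ ≤ 2)
    (μ : Measure (B × U)) [IsProbabilityMeasure μ] (T : ℕ) :
    pathLaw μ (G.step a M) {x | ρ * T ≤ sgn * ∑ t ∈ Finset.range T,
        G.transitionNoise a M h b b' (x t) (x (t + 1))} ≤
      ENNReal.ofReal (Real.exp (-(ρ ^ 2 / 4 * T))) := by
  have hl : |sgn * (ρ / 2)| ≤ 1 := by
    rw [abs_mul, hs, one_mul, abs_of_pos (by positivity)]; linarith
  have hmom := G.lintegral_exp_sum_transitionNoise_le a M h b b' hl μ T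
  have hmeas : Measurable fun x : ℕ → B × U => ∏ t ∈ Finset.range T, ENNReal.ofReal
        (Real.exp (sgn * (ρ / 2) * G.transitionNoise a M h b b' (x t) (x (t + 1)))) := by
    refine Finset.measurable_prod _ fun t _ => ENNReal.measurable_ofReal.comp
      (Real.measurable_exp.comp (Measurable.const_mul ?_ _))
    exact (G.measurable_transitionNoise a M h b b').comp
      (f := fun x : ℕ → B × U => (x t, x (t + 1)))
      ((measurable_pi_apply t).prodMk (measurable_pi_apply (t + 1)))
  have hsub : {x : ℕ → B × U | ρ * T ≤ sgn * ∑ t ∈ Finset.range T,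
        G.transitionNoise a M h b b' (x t) (x (t + 1))} ⊆
      {x | ENNReal.ofReal (Real.exp (ρ / 2 * (ρ * T))) ≤ ∏ t ∈ Finset.range T, ENNReal.ofReal
        (Real.exp (sgn * (ρ / 2) * G.transitionNoise a M h b b' (x t) (x (t + 1))))} := by
    intro x (hx : ρ * T ≤ _)
    rw [Set.mem_ofPred_eq, ← ENNReal.ofReal_prod_of_nonneg fun _ _ => (Real.exp_pos _).le,
      ← Real.exp_sum, ← Finset.mul_sum]
    refine ENNReal.ofReal_le_ofReal (Real.exp_le_exp.2 ?_)
    have := mul_le_mul_of_nonneg_left hx (half_pos hρ).le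
    linarith
  refine (measure_mono hsub).trans ((meas_ge_le_lintegral_div hmeas.aemeasurable
    (ENNReal.ofReal_pos.2 (Real.exp_pos _)).ne' ENNReal.ofReal_ne_top).trans ?_)
  refine (ENNReal.div_le_div_right hmom _).trans (le_of_eq ?_)
  rw [← ENNReal.ofReal_pow (Real.exp_pos _).le, ← ENNReal.ofReal_div_of_pos (Real.exp_pos _),
    ← Real.exp_nat_mul, ← Real.exp_sub, mul_pow, ← sq_abs sgn, hs]
  congr 2
  ring

/-- The number of times that the behaviour is `b` and the signal `h`. -/
def pairCount {T : ℕ} (x : Fin (T + 1) → B) (y : Fin T → H) (h : H) (b : B) : ℝ :=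
  ∑ t : Fin T, if x t.castSucc = b ∧ y t = h then 1 else 0

/-- The number of transitions from `b` to `b'` under the signal `h`. -/
def transitionCount {T : ℕ} (x : Fin (T + 1) → B) (y : Fin T → H) (h : H) (b b' : B) : ℝ :=
  ∑ t : Fin T, if x t.succ = b' ∧ x t.castSucc = b ∧ y t = h then 1 else 0

/-- Data in which each pair `(h, b)` occurs more than `c T` times, and each number of
transitions differs from its conditional mean by less than `ρ T`. -/
def IsTypical (M : BehaviorModel B H) (c ρ : ℝ) {T : ℕ} (x : Fin (T + 1) → B)
    (y : Fin T → H) : Prop :=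
  (∀ h b, c * T < pairCount x y h b) ∧
  ∀ h b b', |transitionCount x y h b b' - entry M h b b' * pairCount x y h b| < ρ * T

/-- Historical data are typical up to exponentially small probability, uniformly in the initial
law. -/
lemma Env.SignalChainErgodic.exists_typical_bound {G : Env A B H U} {a : A}
    {M : BehaviorModel B H} (hG : G.SignalChainErgodic a M) :
    ∃ c : ℝ, 0 < c ∧ ∀ ρ : ℝ, 0 < ρ → ρ ≤ 2 → ∃ C₁ c₁ : ℝ, 0 < C₁ ∧ 0 < c₁ ∧
      ∀ (μ : Measure (B × U)) [IsProbabilityMeasure μ] (T : ℕ),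
      pathLaw μ (G.step a M) {x | ¬ IsTypical M c ρ (fun t : Fin (T + 1) => (x t).1)
        (fun t : Fin T => G.sig a (x t).1 (x t).2)} ≤
        ENNReal.ofReal (C₁ * Real.exp (-(c₁ * T))) := by
  obtain ⟨c, C, c', hc, hC, hc', hvis⟩ := hG.exists_visits_bound
  refine ⟨c, hc, fun ρ hρ hρ2 => ?_⟩
  set m : ℝ := min c' (ρ ^ 2 / 4) with hm
  have hm0 : 0 < m := lt_min hc' (by positivity)
  refine ⟨Fintype.card (B × H) * C + Fintype.card (H × B × B) * 2 + 1, m, by positivity, hm0,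
    fun μ _ T => ?_⟩
  set P := pathLaw μ (G.step a M) with hP
  have hsub : {x : ℕ → B × U | ¬ IsTypical M c ρ (fun t : Fin (T + 1) => (x t).1)
        (fun t : Fin T => G.sig a (x t).1 (x t).2)} ⊆
      (⋃ q : B × H, {x | G.visits a q T x ≤ c * T}) ∪
      ⋃ k : H × B × B, ({x | ρ * T ≤ 1 * ∑ t ∈ Finset.range T,
          G.transitionNoise a M k.1 k.2.1 k.2.2 (x t) (x (t + 1))} ∪
        {x | ρ * T ≤ -1 * ∑ t ∈ Finset.range T,
          G.transitionNoise a M k.1 k.2.1 k.2.2 (x t) (x (t + 1))}) := by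
    intro x hx
    by_contra hcon
    simp only [Set.mem_union, Set.mem_iUnion, Set.mem_ofPred_eq, not_or, not_exists, not_le]
      at hcon
    refine hx ⟨fun h b => ?_, fun h b b' => ?_⟩
    · refine lt_of_lt_of_eq (hcon.1 (b, h)) ?_
      rw [Env.visits, pairCount, Finset.sum_range]
      simp [Env.signalState]
    · have e : transitionCount (fun t : Fin (T + 1) => (x t).1)
          (fun t : Fin T => G.sig a (x t).1 (x t).2) h b b' - entry M h b b' *
          pairCount (fun t : Fin (T + 1) => (x t).1)
            (fun t : Fin T => G.sig a (x t).1 (x t).2) h b =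
          ∑ t ∈ Finset.range T, G.transitionNoise a M h b b' (x t) (x (t + 1)) := by
        rw [transitionCount, pairCount, Finset.sum_range, Finset.mul_sum,
          ← Finset.sum_sub_distrib]
        refine Finset.sum_congr rfl fun t _ => ?_
        simp only [Env.transitionNoise, Fin.val_succ, Fin.val_castSucc]
        by_cases h1 : (x t).1 = b ∧ G.sig a (x t).1 (x t).2 = h
        · by_cases h2 : (x (t + 1)).1 = b'
          · rw [if_pos ⟨h2, h1⟩, if_pos h1, if_pos h1, if_pos h2, mul_one]
          · rw [if_neg fun h3 => h2 h3.1, if_pos h1, if_pos h1, if_neg h2, mul_one]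
        · rw [if_neg fun h3 => h1 h3.2, if_neg h1, if_neg h1, mul_zero, sub_zero]
      rw [e]
      have := hcon.2 (h, b, b')
      exact abs_lt.2 ⟨by linarith [this.2], by linarith [this.1]⟩
  have hexp1 : Real.exp (-(c' * T)) ≤ Real.exp (-(m * T)) :=
    Real.exp_le_exp.2 (neg_le_neg (mul_le_mul_of_nonneg_right (min_le_left _ _) (by positivity)))
  have hexp2 : Real.exp (-(ρ ^ 2 / 4 * T)) ≤ Real.exp (-(m * T)) :=
    Real.exp_le_exp.2 (neg_le_neg (mul_le_mul_of_nonneg_right (min_le_right _ _) (by positivity)))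
  refine (measure_mono hsub).trans ((measure_union_le _ _).trans ?_)
  have b1 : P (⋃ q : B × H, {x | G.visits a q T x ≤ c * T}) ≤
      ENNReal.ofReal (Fintype.card (B × H) * C * Real.exp (-(m * T))) := by
    refine (measure_iUnion_fintype_le _ _).trans ((Finset.sum_le_sum fun q _ =>
      (hvis μ q T).trans (ENNReal.ofReal_le_ofReal
        (mul_le_mul_of_nonneg_left hexp1 hC.le))).trans (le_of_eq ?_))
    rw [Finset.sum_const, nsmul_eq_mul, mul_assoc,
      ENNReal.ofReal_mul (Nat.cast_nonneg (Fintype.card (B × H))), ENNReal.ofReal_natCast]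
    rfl
  have b2 : P (⋃ k : H × B × B, ({x | ρ * T ≤ 1 * ∑ t ∈ Finset.range T,
          G.transitionNoise a M k.1 k.2.1 k.2.2 (x t) (x (t + 1))} ∪
        {x | ρ * T ≤ -1 * ∑ t ∈ Finset.range T,
          G.transitionNoise a M k.1 k.2.1 k.2.2 (x t) (x (t + 1))})) ≤
      ENNReal.ofReal (Fintype.card (H × B × B) * 2 * Real.exp (-(m * T))) := by
    refine (measure_iUnion_fintype_le _ _).trans ((Finset.sum_le_sum fun k _ =>
      (measure_union_le _ _).trans (add_le_add
        ((G.measure_transitionNoise_ge_le a M k.1 k.2.1 k.2.2 (sgn := 1) (by norm_num) hρ hρ2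
          μ T).trans (ENNReal.ofReal_le_ofReal hexp2))
        ((G.measure_transitionNoise_ge_le a M k.1 k.2.1 k.2.2 (sgn := -1) (by norm_num) hρ hρ2
          μ T).trans (ENNReal.ofReal_le_ofReal hexp2)))).trans (le_of_eq ?_))
    rw [Finset.sum_const, nsmul_eq_mul, ← ENNReal.ofReal_add (Real.exp_pos _).le
      (Real.exp_pos _).le, ← two_mul, mul_assoc,
      ENNReal.ofReal_mul (Nat.cast_nonneg (Fintype.card (H × B × B))), ENNReal.ofReal_natCast]
    rfl
  refine (add_le_add b1 b2).trans ?_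
  rw [← ENNReal.ofReal_add (by positivity) (by positivity)]
  refine ENNReal.ofReal_le_ofReal ?_
  rw [← add_mul]
  exact mul_le_mul_of_nonneg_right (by linarith) (Real.exp_pos _).le

end TypicalData

/-! ### Learned models on typical data -/

section Learning

variable {B H : Type*} [Fintype B] [DecidableEq B] [Fintype H] [DecidableEq H]

omit [Fintype B] [Fintype H] in
lemma ncard_pair {T : ℕ} (x : Fin (T + 1) → B) (y : Fin T → H) (h : H) (b : B) :
    ({t : Fin T | x t.castSucc = b ∧ y t = h}.ncard : ℝ) = pairCount x y h b := by
  rw [Set.ncard_eq_toFinset_card', pairCount, Finset.sum_boole]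
  simp

omit [Fintype B] [Fintype H] in
lemma ncard_transition {T : ℕ} (x : Fin (T + 1) → B) (y : Fin T → H) (h : H) (b b' : B) :
    ({t : Fin T | x t.succ = b' ∧ x t.castSucc = b ∧ y t = h}.ncard : ℝ) =
      transitionCount x y h b b' := by
  rw [Set.ncard_eq_toFinset_card', transitionCount, Finset.sum_boole]
  simp

omit [Fintype B] [Fintype H] in
/-- On typical data the conditional frequencies are close to the true model. -/
lemma IsFrequencyLearner.abs_entry_sub_lt {learn : Learner B H} (hl : IsFrequencyLearner learn)
    {M : BehaviorModel B H} {c r : ℝ} (hc : 0 < c) {T : ℕ} (hT : 1 ≤ T)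
    {x : Fin (T + 1) → B} {y : Fin T → H} (hxy : IsTypical M c (c * r) x y) (h : H) (b b' : B) :
    |entry (learn T x y) h b b' - entry M h b b'| < r := by
  have hT0 : (0 : ℝ) < T := by exact_mod_cast hT
  have hn := hxy.1 h b
  have hn0 : 0 < pairCount x y h b := (mul_pos hc hT0).trans hn
  have hne : {t : Fin T | x t.castSucc = b ∧ y t = h}.ncard ≠ 0 := by
    intro h0
    rw [← ncard_pair, h0] at hn0
    simp at hn0
  rw [hl T x y h b b' hne, ncard_pair, ncard_transition]
  have hd := hxy.2 h b b'
  rw [div_sub' hn0.ne', abs_div, abs_of_pos hn0, div_lt_iff₀ hn0, mul_comm (pairCount x y h b)]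
  have hr : 0 < r := by
    by_contra hr
    have : c * r * T ≤ 0 := mul_nonpos_of_nonpos_of_nonneg
      (mul_nonpos_of_nonneg_of_nonpos hc.le (not_lt.1 hr)) hT0.le
    linarith [abs_nonneg (transitionCount x y h b b' - entry M h b b' * pairCount x y h b)]
  calc _ < c * r * T := hd
    _ = r * (c * T) := by ring
    _ < r * pairCount x y h b := mul_lt_mul_of_pos_left hn hr

omit [DecidableEq B] [DecidableEq H] in
/-- The models of the truncated Gaussian family with bounded parameter have entries bounded away
from zero. -/
lemma exists_pos_le_entry_of_isGaussModel {q : ℕ} (bv : B → ℝ) (hv : H → Fin q → ℝ)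
    {W : Set (ℝ × (Fin q → ℝ) × ℝ)} (hW : Bornology.IsBounded W) :
    ∃ η : ℝ, 0 < η ∧ ∀ w ∈ W, ∀ M : BehaviorModel B H, IsGaussModel bv hv w M →
      ∀ h b b', η ≤ entry M h b b' := by
  have hpos : ∀ k : H × B × B, ∃ η : ℝ, 0 < η ∧ ∀ w ∈ W,
      η ≤ gaussWeight bv hv w k.1 k.2.1 k.2.2 / ∑ c, gaussWeight bv hv w k.1 k.2.1 c := by
    intro k
    have hw0 : ∀ w c, 0 < gaussWeight bv hv w k.1 k.2.1 c := fun w c => Real.exp_pos _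
    have hsum : ∀ w, 0 < ∑ c, gaussWeight bv hv w k.1 k.2.1 c := fun w =>
      Finset.sum_pos (fun c _ => hw0 w c) ⟨k.2.2, Finset.mem_univ _⟩
    have hcw : ∀ c, Continuous fun w => gaussWeight bv hv w k.1 k.2.1 c := by
      intro c; unfold gaussWeight; fun_prop
    have hcont : Continuous fun w =>
        gaussWeight bv hv w k.1 k.2.1 k.2.2 / ∑ c, gaussWeight bv hv w k.1 k.2.1 c :=
      (hcw _).div (continuous_finsetSum _ fun c _ => hcw c) fun w => (hsum w).ne'
    rcases W.eq_empty_or_nonempty with rfl | hne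
    · exact ⟨1, one_pos, by simp⟩
    obtain ⟨w₀, -, hmin⟩ := hW.isCompact_closure.exists_isMinOn hne.closure hcont.continuousOn
    exact ⟨_, div_pos (hw0 w₀ _) (hsum w₀), fun w hw => hmin (subset_closure hw)⟩
  choose f hf hfle using hpos
  obtain ⟨η, hη, hle⟩ := exists_pos_forall_le f hf
  refine ⟨η, hη, fun w hw M hM h b b' => ?_⟩
  rw [hM h b b']
  exact (hle (h, b, b')).trans (hfle (h, b, b') w hw)

omit [DecidableEq B] in
/-- The Kullback-Leibler divergence dominates the squared distance of entries:
`log t ≤ 2 (√t - 1)` bounds it below by the squared Hellinger distance. -/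
lemma sum_mul_log_div_le {p q : B → ℝ} (hp : ∀ b, 0 < p b) (hq : ∀ b, 0 < q b)
    (hp1 : ∑ b, p b = 1) (hq1 : ∑ b, q b = 1) (b : B) :
    ∑ c, p c * Real.log (q c / p c) ≤ -((q b - p b) ^ 2 / 4) := by
  have hle1 : ∀ f : B → ℝ, (∀ b, 0 < f b) → ∑ b, f b = 1 → √(f b) ≤ 1 := by
    intro f hf hf1
    refine Real.sqrt_le_one.2 ?_
    rw [← hf1]
    exact Finset.single_le_sum (fun c _ => (hf c).le) (Finset.mem_univ b)
  have hterm : ∀ c, p c * Real.log (q c / p c) ≤ (q c - p c) - (√(q c) - √(p c)) ^ 2 := by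
    intro c
    have hpc := Real.sqrt_pos.2 (hp c)
    have hqc := Real.sqrt_pos.2 (hq c)
    have e1 : q c = √(q c) ^ 2 := (Real.sq_sqrt (hq c).le).symm
    have e2 : p c = √(p c) ^ 2 := (Real.sq_sqrt (hp c).le).symm
    have hlog : Real.log (q c / p c) ≤ 2 * (√(q c) / √(p c) - 1) := by
      have : q c / p c = (√(q c) / √(p c)) ^ 2 := by rw [div_pow, ← e1, ← e2]
      rw [this, Real.log_pow]
      have := Real.log_le_sub_one_of_pos (div_pos hqc hpc)
      push_cast
      linarith
    refine (mul_le_mul_of_nonneg_left hlog (hp c).le).trans (le_of_eq ?_)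
    set s := √(q c)
    set t := √(p c)
    rw [e1, e2]
    field_simp
    ring
  have hsum : ∑ c, p c * Real.log (q c / p c) ≤ -∑ c, (√(q c) - √(p c)) ^ 2 := by
    refine (Finset.sum_le_sum fun c _ => hterm c).trans (le_of_eq ?_)
    rw [Finset.sum_sub_distrib, Finset.sum_sub_distrib, hp1, hq1]
    ring
  refine hsum.trans (neg_le_neg ?_)
  refine le_trans ?_ (Finset.single_le_sum (f := fun c => (√(q c) - √(p c)) ^ 2)
    (fun c _ => sq_nonneg _) (Finset.mem_univ b))
  have e : q b - p b = (√(q b) - √(p b)) * (√(q b) + √(p b)) := by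
    have e1 := Real.sq_sqrt (hq b).le
    have e2 := Real.sq_sqrt (hp b).le
    linear_combination -e1 + e2
  rw [e, mul_pow, div_le_iff₀ (by norm_num)]
  refine mul_le_mul_of_nonneg_left ?_ (sq_nonneg _)
  have h1 := hle1 p hp hp1
  have h2 := hle1 q hq hq1
  have h3 := Real.sqrt_nonneg (p b)
  have h4 := Real.sqrt_nonneg (q b)
  nlinarith

/-- Reordering a sum over the observed transitions by their type. -/
lemma sum_transitions_eq {T : ℕ} (x : Fin (T + 1) → B) (y : Fin T → H) (φ : H → B → B → ℝ) :
    ∑ t : Fin T, φ (y t) (x t.castSucc) (x t.succ) =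
      ∑ h, ∑ b, ∑ b', transitionCount x y h b b' * φ h b b' := by
  have : ∀ t : Fin T, φ (y t) (x t.castSucc) (x t.succ) = ∑ h, ∑ b, ∑ b',
      (if x t.succ = b' ∧ x t.castSucc = b ∧ y t = h then 1 else 0) * φ h b b' := by
    intro t
    rw [Finset.sum_eq_single (y t) (fun h _ hne => by simp [hne.symm]) (by simp),
      Finset.sum_eq_single (x t.castSucc) (fun h _ hne => by simp [hne.symm]) (by simp),
      Finset.sum_eq_single (x t.succ) (fun h _ hne => by simp [hne.symm]) (by simp)]
    simp
  simp_rw [this, transitionCount, Finset.sum_mul]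
  rw [Finset.sum_comm]
  refine Finset.sum_congr rfl fun h _ => ?_
  rw [Finset.sum_comm]
  refine Finset.sum_congr rfl fun b _ => ?_
  rw [Finset.sum_comm]

/-- On typical data a model with larger likelihood than the true model is close to it. -/
lemma abs_entry_sub_lt_of_likelihood_le {M M' : BehaviorModel B H} {c r η : ℝ}
    (hr : 0 < r) (hη : 0 < η) (hM : ∀ h b b', η ≤ entry M h b b')
    (hM' : ∀ h b b', η ≤ entry M' h b b') {ρ : ℝ}
    (hρ : Fintype.card (H × B × B) * (ρ * (-Real.log η)) < c * (r ^ 2 / 4)) {T : ℕ} (hT : 1 ≤ T)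
    {x : Fin (T + 1) → B} {y : Fin T → H} (hxy : IsTypical M c ρ x y)
    (hlik : likelihood M x y ≤ likelihood M' x y) (h : H) (b b' : B) :
    |entry M' h b b' - entry M h b b'| < r := by
  by_contra hcon
  rw [not_lt] at hcon
  have hT0 : (0 : ℝ) < T := by exact_mod_cast hT
  have hp : ∀ h b b', 0 < entry M h b b' := fun h b b' => hη.trans_le (hM h b b')
  have hp' : ∀ h b b', 0 < entry M' h b b' := fun h b b' => hη.trans_le (hM' h b b')
  let φ : H → B → B → ℝ := fun h b b' => Real.log (entry M' h b b' / entry M h b b')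
  have hφ : ∀ h b b', |φ h b b'| ≤ -Real.log η := by
    intro h b b'
    have l1 := Real.log_le_log hη (hM h b b')
    have l2 := Real.log_le_log hη (hM' h b b')
    have u1 := Real.log_nonpos (hp h b b').le (entry_le_one M h b b')
    have u2 := Real.log_nonpos (hp' h b b').le (entry_le_one M' h b b')
    simp only [φ]
    rw [Real.log_div (hp' h b b').ne' (hp h b b').ne']
    exact abs_le.2 ⟨by linarith, by linarith⟩
  have hpos : 0 ≤ ∑ t : Fin T, φ (y t) (x t.castSucc) (x t.succ) := by
    have e : ∑ t : Fin T, φ (y t) (x t.castSucc) (x t.succ) =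
        Real.log (likelihood M' x y) - Real.log (likelihood M x y) := by
      unfold likelihood
      rw [Real.log_prod fun t _ => (hp' _ _ _).ne', Real.log_prod fun t _ => (hp _ _ _).ne',
        ← Finset.sum_sub_distrib]
      exact Finset.sum_congr rfl fun t _ => Real.log_div (hp' _ _ _).ne' (hp _ _ _).ne'
    rw [e, sub_nonneg]
    exact Real.log_le_log (Finset.prod_pos fun t _ => hp _ _ _) hlik
  rw [sum_transitions_eq] at hpos
  have hrow : ∀ h b, ∑ b', entry M h b b' * φ h b b' ≤ 0 := fun h b =>
    (sum_mul_log_div_le (hp h b) (hp' h b) (sum_entry M h b) (sum_entry M' h b) (x 0)).trans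
      (neg_nonpos.2 (by positivity))
  have hrow' : ∑ b', entry M h b b' * φ h b b' ≤ -(r ^ 2 / 4) := by
    refine (sum_mul_log_div_le (hp h b) (hp' h b) (sum_entry M h b) (sum_entry M' h b) b').trans ?_
    have := pow_le_pow_left₀ hr.le hcon 2
    rw [sq_abs] at this
    linarith
  have hcnt : ∀ h b, 0 ≤ pairCount x y h b := fun h b =>
    Finset.sum_nonneg fun t _ => by split_ifs <;> norm_num
  have hmain : ∑ h, ∑ b, ∑ b', transitionCount x y h b b' * φ h b b' ≤
      (∑ h, ∑ b, pairCount x y h b * ∑ b', entry M h b b' * φ h b b') +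
        ∑ _h : H, ∑ _b : B, ∑ _b' : B, ρ * T * (-Real.log η) := by
    simp only [← Finset.sum_add_distrib, Finset.mul_sum]
    refine Finset.sum_le_sum fun h _ => Finset.sum_le_sum fun b _ => Finset.sum_le_sum
      fun b' _ => ?_
    have h1 : (transitionCount x y h b b' - entry M h b b' * pairCount x y h b) * φ h b b' ≤
        ρ * T * (-Real.log η) := by
      refine (le_abs_self _).trans ?_
      rw [abs_mul]
      exact mul_le_mul (hxy.2 h b b').le (hφ h b b') (abs_nonneg _)
        ((abs_nonneg _).trans (hxy.2 h b b').le)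
    linarith
  have hsum : ∑ h, ∑ b, pairCount x y h b * ∑ b', entry M h b b' * φ h b b' ≤
      -(c * T * (r ^ 2 / 4)) := by
    have hneg : ∀ h b, pairCount x y h b * ∑ b', entry M h b b' * φ h b b' ≤ 0 := fun h b =>
      mul_nonpos_of_nonneg_of_nonpos (hcnt h b) (hrow h b)
    have e1 : ∑ h, ∑ b, pairCount x y h b * ∑ b', entry M h b b' * φ h b b' ≤
        pairCount x y h b * ∑ b', entry M h b b' * φ h b b' := by
      rw [← Fintype.sum_prod_type' (f := fun h b =>
        pairCount x y h b * ∑ b', entry M h b b' * φ h b b')]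
      have hn : ∀ k ∈ (Finset.univ : Finset (H × B)), 0 ≤
          -(pairCount x y k.1 k.2 * ∑ b', entry M k.1 k.2 b' * φ k.1 k.2 b') :=
        fun k _ => neg_nonneg.2 (hneg k.1 k.2)
      have := Finset.single_le_sum hn (Finset.mem_univ (h, b))
      rw [Finset.sum_neg_distrib] at this
      linarith
    have e2 := mul_le_mul_of_nonneg_left hrow' (hcnt h b)
    have e3 := mul_le_mul_of_nonneg_right (hxy.1 h b).le (show 0 ≤ r ^ 2 / 4 by positivity)
    linarith
  have hconst : ∑ _h : H, ∑ _b : B, ∑ _b' : B, ρ * T * (-Real.log η) =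
      T * (Fintype.card (H × B × B) * (ρ * (-Real.log η))) := by
    simp only [Finset.sum_const, Finset.card_univ, nsmul_eq_mul, Fintype.card_prod]
    push_cast
    ring
  have hfin := mul_lt_mul_of_pos_left hρ hT0
  rw [hconst] at hmain
  linarith

/-- Both learning rules recover the true model from typical data. -/
lemma exists_typical_radius {Mstar : BehaviorModel B H} {learn : Learner B H}
    (hl : IsFrequencyLearner learn ∨ IsGaussMLE Mstar learn) {c r : ℝ} (hc : 0 < c) (hr : 0 < r) :
    ∃ ρ : ℝ, 0 < ρ ∧ ρ ≤ 2 ∧ ∀ (T : ℕ), 1 ≤ T → ∀ (x : Fin (T + 1) → B) (y : Fin T → H),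
      IsTypical Mstar c ρ x y →
      ∀ h b b', |entry (learn T x y) h b b' - entry Mstar h b b'| < r := by
  have hmono : ∀ {ρ ρ' : ℝ} {T : ℕ} {x : Fin (T + 1) → B} {y : Fin T → H}, ρ ≤ ρ' →
      IsTypical Mstar c ρ x y → IsTypical Mstar c ρ' x y := fun hle hxy =>
    ⟨hxy.1, fun h b b' => (hxy.2 h b b').trans_le
      (mul_le_mul_of_nonneg_right hle (Nat.cast_nonneg _))⟩
  rcases hl with hl | ⟨q, bv, hv, W, hW, ⟨w₀, hw₀, hM⟩, hlearn⟩
  · refine ⟨min (c * r) 2, lt_min (mul_pos hc hr) two_pos, min_le_right _ _,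
      fun T hT x y hxy h b b' => hl.abs_entry_sub_lt hc hT (hmono (min_le_left _ _) hxy) h b b'⟩
  · obtain ⟨η, hη, hle⟩ := exists_pos_le_entry_of_isGaussModel (B := B) (H := H) bv hv hW
    set Λ : ℝ := Fintype.card (H × B × B) * |Real.log η| + 1 with hΛ
    have hΛ0 : 0 < Λ := by positivity
    set ρ : ℝ := min (c * (r ^ 2 / 4) / (2 * Λ)) 2 with hρ
    have hρ0 : 0 < ρ := lt_min (by positivity) two_pos
    refine ⟨ρ, hρ0, min_le_right _ _, fun T hT x y hxy => ?_⟩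
    obtain ⟨⟨w, hw, hMw⟩, hmax⟩ := hlearn T x y
    refine abs_entry_sub_lt_of_likelihood_le hr hη (hle w₀ hw₀ Mstar hM)
      (hle w hw _ hMw) ?_ hT hxy (hmax w₀ hw₀ Mstar hM)
    have h1 : (Fintype.card (H × B × B) : ℝ) * (-Real.log η) ≤ Λ := by
      have := mul_le_mul_of_nonneg_left (neg_le_abs (Real.log η))
        (Nat.cast_nonneg (α := ℝ) (Fintype.card (H × B × B)))
      linarith
    have h2 : ρ * (2 * Λ) ≤ c * (r ^ 2 / 4) := by
      rw [← le_div_iff₀ (by positivity)]; exact min_le_left _ _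
    have h3 := mul_le_mul_of_nonneg_left h1 hρ0.le
    have h4 : 0 < ρ * Λ := mul_pos hρ0 hΛ0
    linarith

end Learning

/-! ### Excess risk of bi-level empirical risk minimization -/

section ExcessRisk

set_option linter.unusedSectionVars false

variable {A B H U : Type*}
variable [Fintype B] [MeasurableSpace B] [MeasurableSingletonClass B]
variable [Fintype H] [MeasurableSpace H] [MeasurableSingletonClass H]
variable [MeasurableSpace U]

/-- The loss of a mechanism as a function of the state of the chain. -/
def Env.loss (G : Env A B H U) (a : A) (z : B × U) : ℝ := G.L a z.1 z.2

lemma Env.measurable_loss (G : Env A B H U) (a : A) : Measurable (G.loss a) :=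
  measurable_from_prod_countable_right (f := G.loss a) fun b => G.measurable_L a b

lemma Env.loss_mem (G : Env A B H U) (a : A) (z : B × U) : G.loss a z ∈ Set.Icc (-G.K) 0 :=
  G.L_mem a z.1 z.2

lemma Env.abs_loss_le (G : Env A B H U) (a : A) (z : B × U) : |G.loss a z| ≤ G.K :=
  abs_le.2 ⟨(G.loss_mem a z).1, (G.loss_mem a z).2.trans G.K_pos.le⟩

/-- A finite covering number provides, on each sample, finitely many mechanisms whose losses
cover all losses. -/
lemma Env.exists_cover_of_lossCover_le (G : Env A B H U) {η : ℝ} (hη : 0 ≤ η) {T n : ℕ}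
    (hn : G.lossCover η T ≤ n) (x : Fin T → B × U) :
    ∃ F : Finset A, F.card ≤ n ∧ ∀ a, ∃ a' ∈ F, ∑ t, |G.loss a (x t) - G.loss a' (x t)| ≤ T * η := by
  set V : A → PiLp 1 (fun _ : Fin T => ℝ) := fun a => WithLp.toLp 1 (fun t => G.L a (x t).1 (x t).2)
    with hV
  have hx : Metric.coveringNumber ((T : ℝ) * η).toNNReal (Set.range V) ≤ n :=
    (le_iSup (fun x : Fin T → B × U => Metric.coveringNumber
      (X := PiLp 1 (fun _ : Fin T => ℝ)) ((T : ℝ) * η).toNNReal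
      (Set.range (fun a => WithLp.toLp 1 (fun t => G.L a (x t).1 (x t).2)))) x).trans hn
  have htop : Metric.coveringNumber ((T : ℝ) * η).toNNReal (Set.range V) ≠ ⊤ :=
    ne_top_of_le_ne_top (ENat.natCast_ne_top n) hx
  obtain ⟨S, hS, hfin, hcov, hcard⟩ := Metric.exists_set_encard_eq_coveringNumber htop
  have hsurj : ∀ v : hfin.toFinset, ∃ a, V a = v := fun v => hS (hfin.mem_toFinset.1 v.2)
  choose f hf using hsurj
  classical
  refine ⟨Finset.univ.image f, Finset.card_image_le.trans ?_, fun a => ?_⟩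
  · rw [Finset.card_univ, Fintype.card_coe]
    have : (hfin.toFinset.card : ℕ∞) ≤ n := by
      rw [← Set.encard_coe_eq_coe_finsetCard, hfin.coe_toFinset, hcard]; exact hx
    exact_mod_cast this
  · obtain ⟨v, hv, hd⟩ := hcov (Set.mem_range_self a)
    refine ⟨f ⟨v, hfin.mem_toFinset.2 hv⟩, Finset.mem_image_of_mem _ (Finset.mem_univ _), ?_⟩
    have hfv := hf ⟨v, hfin.mem_toFinset.2 hv⟩
    simp only at hfv
    have hd' : edist (V a) v ≤ ((T : ℝ) * η).toNNReal := hd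
    rw [← hfv, edist_nndist, ENNReal.coe_le_coe, ← NNReal.coe_le_coe, coe_nndist,
      PiLp.dist_eq_of_L1, Real.coe_toNNReal _ (by positivity)] at hd'
    simpa [hV, Real.dist_eq, Env.loss] using hd'

/-- Deterministic part of the argument: if for every shared sample the empirical means are within
`Δ / 5` of their expectations, uniformly over the mechanisms, then the empirical risk minimizer
has excess risk less than `2 K α δ + Δ`. -/
lemma Env.excess_risk_lt [PseudoMetricSpace A] (G : Env A B H U) [Nonempty B]
    {Mstar M : BehaviorModel B H} (hUE : G.UniformlyErgodic Mstar) {α β₀ γ δ Δ : ℝ} {sh : A → A}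
    (hLM : G.LipschitzMixing M α β₀ γ) (hα : 0 ≤ α) (hsh : ∀ a, dist a (sh a) ≤ δ)
    (hstat : ∀ a, IsProbabilityMeasure (G.stat (sh a) M))
    (hKαδ : α * δ < 1) (hΔ : 0 < Δ)
    (hclose : ∀ a, G.stat a M ≠ 0 → ∀ E, MeasurableSet E →
      |(G.stat a M).real E - (G.stat a Mstar).real E| ≤ Δ / (4 * G.K))
    {T : ℕ} (hT : 1 ≤ T) {b : A → ℕ → B} {u : ℕ → U} {ahat : A}
    (hmin : ∀ a, G.empRisk sh T b u ahat ≤ G.empRisk sh T b u a)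
    (hdev : ∀ a, |∑ t : Fin T, (G.loss a (b (sh a) t, u t) - ∫ z, G.loss a z ∂(G.stat (sh a) M))|
      ≤ T * Δ / 5) (a : A) :
    G.risk ahat Mstar - G.risk a Mstar < 2 * G.K * α * δ + Δ := by
  have hK := G.K_pos
  have hT0 : (0 : ℝ) < T := by exact_mod_cast hT
  have hδ : 0 ≤ δ := dist_nonneg.trans (hsh a)
  have hαδ : 0 ≤ α * δ := mul_nonneg hα hδ
  have hlip : ∀ a E, MeasurableSet E →
      |(G.stat a M).real E - (G.stat (sh a) M).real E| ≤ α * δ := fun a E hE =>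
    abs_sub_le_of_tvDist_le hαδ ((hLM.1 a (sh a)).trans (ENNReal.ofReal_le_ofReal
      (mul_le_mul_of_nonneg_left (hsh a) hα))) hE
  -- A junk value `0` of the stationary distribution would be at distance one from a probability.
  have hne : ∀ a, G.stat a M ≠ 0 := by
    intro a h0
    have := hlip a Set.univ MeasurableSet.univ
    have hp := hstat a
    rw [h0] at this
    simp at this
    linarith
  have hrisk : ∀ a, |∫ z, G.loss a z ∂(G.stat (sh a) M) - G.risk a Mstar| ≤
      G.K * (α * δ) + Δ / 4 := by
    intro a
    have hp := hstat a
    have hp1 : IsProbabilityMeasure (G.stat a M) :=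
      ((G.stat_eq_zero_or a M).resolve_left (hne a)).1
    have hp2 := G.isProbabilityMeasure_stat hUE a
    have h1 := abs_integral_sub_le_of_nonpos hK.le (hlip a) (G.measurable_loss a) (G.loss_mem a)
    have h2 := abs_integral_sub_le_of_nonpos hK.le (hclose a (hne a)) (G.measurable_loss a)
      (G.loss_mem a)
    have e : G.K * (Δ / (4 * G.K)) = Δ / 4 := by field_simp
    rw [e] at h2
    rw [abs_sub_comm] at h1
    exact (abs_sub_le _ _ _).trans (add_le_add h1 h2)
  have hemp : ∀ a, |G.empRisk sh T b u a - ∫ z, G.loss a z ∂(G.stat (sh a) M)| ≤ Δ / 5 := by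
    intro a
    have e : G.empRisk sh T b u a - ∫ z, G.loss a z ∂(G.stat (sh a) M) = (T : ℝ)⁻¹ *
        ∑ t : Fin T, (G.loss a (b (sh a) t, u t) - ∫ z, G.loss a z ∂(G.stat (sh a) M)) := by
      rw [Finset.sum_sub_distrib, Env.empRisk, Finset.sum_range]
      simp only [Env.loss, Finset.sum_const, Finset.card_univ, Fintype.card_fin, nsmul_eq_mul]
      field_simp
    rw [e, abs_mul, abs_of_pos (inv_pos.2 hT0), inv_mul_le_iff₀ hT0]
    exact (hdev a).trans (le_of_eq (by ring))
  have r1 := abs_le.1 (hrisk ahat)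
  have r2 := abs_le.1 (hrisk a)
  have e1 := abs_le.1 (hemp ahat)
  have e2 := abs_le.1 (hemp a)
  have := hmin a
  linarith [r1.1, r2.2, e1.1, e2.2]

lemma pathLaw_zero {X : Type*} [MeasurableSpace X] (κ : Kernel X X) [IsMarkovKernel κ] :
    pathLaw 0 κ = 0 := by
  unfold pathLaw Kernel.trajMeasure
  simp

/-- Mechanism learning for a fixed learned model: probability of a large excess risk, under the
law `Q` of the simulated samples. -/
lemma Env.measure_excess_risk_le [PseudoMetricSpace A] (G : Env A B H U) [Nonempty B] {Ω : Type*}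
    [MeasurableSpace Ω] (Q : Measure Ω) [IsProbabilityMeasure Q]
    {Mstar M : BehaviorModel B H} (hsep : G.PointwiseSeparable)
    (hUE : G.UniformlyErgodic Mstar) {α β₀ γ s δ Δ : ℝ} {sh : A → A}
    (hLM : G.LipschitzMixing M α β₀ γ) (hα : 0 ≤ α) (hβ₀ : 0 ≤ β₀) (hs : 0 < s) (hγ : 0 < γ)
    (hsh : ∀ a, dist a (sh a) ≤ δ) (hKαδ : α * δ < 1) (hΔ : 0 < Δ)
    (hclose : ∀ a, G.stat a M ≠ 0 → ∀ E, MeasurableSet E →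
      |(G.stat a M).real E - (G.stat a Mstar).real E| ≤ Δ / (4 * G.K))
    {T : ℕ} (hT : 1 ≤ T) {b : A → ℕ → Ω → B} {u : ℕ → Ω → U} {ahat : Ω → A}
    (hb : ∀ a t, Measurable (b a t)) (hu : ∀ t, Measurable (u t))
    (hlaw : ∀ g ∈ Set.range sh, Q.map (fun ω (t : Fin T) => (b g t ω, u t ω)) =
      (pathLaw (G.stat g M) (G.step g M)).map (fun z (t : Fin T) => z t))
    (hmin : ∀ᵐ ω ∂Q, ∀ a, G.empRisk sh T (fun g t => b g t ω) (fun t => u t ω) (ahat ω) ≤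
      G.empRisk sh T (fun g t => b g t ω) (fun t => u t ω) a)
    {n N : ℕ} (hn : G.lossCover (Δ / 6400) T ≤ n) (hN : (Set.range sh).encard ≤ N) (a : A) :
    Q {ω | 2 * G.K * α * δ + Δ ≤ G.risk (ahat ω) Mstar - G.risk a Mstar} ≤
      N * (4 * (n * ENNReal.ofReal
          (Real.exp (-(Δ ^ 2 / (6400 * G.K ^ 2) * (T : ℝ) ^ (s / (1 + s))))) +
        ENNReal.ofReal (2 * β₀ * (T : ℝ) ^ ((s - γ) / (1 + s))))) := by
  have hrest : Measurable fun (z : ℕ → B × U) (t : Fin T) => z t :=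
    measurable_pi_lambda _ fun _ => measurable_pi_apply _
  have hdata : ∀ g, Measurable fun ω (t : Fin T) => (b g t ω, u t ω) := fun g =>
    measurable_pi_lambda _ fun t => (hb g t).prodMk (hu t)
  -- The stationary distribution of a simulated chain exists, as its samples have a law.
  have hstat : ∀ g ∈ Set.range sh,
      IsProbabilityMeasure (G.stat g M) ∧ (G.step g M).Invariant (G.stat g M) := by
    intro g hg
    refine (G.stat_eq_zero_or g M).resolve_left fun h0 => ?_
    have h1 := hlaw g hg
    have h2 : IsProbabilityMeasure (Q.map (fun ω (t : Fin T) => (b g t ω, u t ω))) :=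
      Measure.isProbabilityMeasure_map (hdata g).aemeasurable
    rw [h1, h0, pathLaw_zero, Measure.map_zero] at h2
    exact IsProbabilityMeasure.ne_zero (0 : Measure (Fin T → B × U)) rfl
  have hsep' : ∃ S : Set A, S.Countable ∧ ∀ a, ∃ x : ℕ → A, (∀ n, x n ∈ S) ∧
      ∀ z, Tendsto (fun n => G.loss (x n) z) atTop (𝓝 (G.loss a z)) := by
    obtain ⟨S, hS, h⟩ := hsep
    refine ⟨S, hS, fun a => ?_⟩
    obtain ⟨x, hx, h'⟩ := h a
    exact ⟨x, hx, fun z => h' z.1 z.2⟩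
  let V : A → Set (Fin T → B × U) := fun g =>
    {v | ∃ a : A, T * Δ / 5 < |∑ t, (G.loss a (v t) - ∫ z, G.loss a z ∂(G.stat g M))|}
  have hVQ : ∀ g ∈ Set.range sh, Q {ω | (fun t : Fin T => (b g t ω, u t ω)) ∈ V g} ≤
      4 * (n * ENNReal.ofReal
          (Real.exp (-(Δ ^ 2 / (6400 * G.K ^ 2) * (T : ℝ) ^ (s / (1 + s))))) +
        ENNReal.ofReal (2 * β₀ * (T : ℝ) ^ ((s - γ) / (1 + s)))) := by
    intro g hg
    obtain ⟨hp, hinv⟩ := hstat g hg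
    have hVm : MeasurableSet (V g) :=
      measurableSet_exists_deviation G.measurable_loss G.abs_loss_le hsep' T _
    have e1 : Q {ω | (fun t : Fin T => (b g t ω, u t ω)) ∈ V g} =
        Q.map (fun ω (t : Fin T) => (b g t ω, u t ω)) (V g) :=
      (Measure.map_apply (hdata g) hVm).symm
    rw [e1, hlaw g hg, Measure.map_apply hrest hVm]
    have key := measure_exists_deviation_le_of_algebraic_mixing (s := s) (γ := γ) (β₀ := β₀)
      (n := n) G.measurable_loss G.K_pos G.abs_loss_le hsep'
      (P := pathLaw (G.stat g M) (G.step g M)) (fun t => map_eval_pathLaw hinv t) hT hΔ hs hγ hβ₀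
      (fun m hm => hLM.2 g m hm) (fun x => G.exists_cover_of_lossCover_le (by positivity) hn x)
    refine le_trans (le_of_eq ?_) key
    congr 1
    ext z
    simp only [V, Set.mem_preimage, Set.mem_ofPred_eq, Finset.sum_range]
  have hfin : (Set.range sh).Finite := Set.finite_of_encard_le_coe hN
  have hcard : hfin.toFinset.card ≤ N := by
    have : (hfin.toFinset.card : ℕ∞) ≤ N := by
      rw [← Set.encard_coe_eq_coe_finsetCard, hfin.coe_toFinset]; exact hN
    exact_mod_cast this
  have hsub : {ω | 2 * G.K * α * δ + Δ ≤ G.risk (ahat ω) Mstar - G.risk a Mstar} ≤ᵐ[Q]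
      ⋃ g ∈ hfin.toFinset, {ω | (fun t : Fin T => (b g t ω, u t ω)) ∈ V g} := by
    filter_upwards [hmin] with ω hω hbad
    by_contra hcon
    have hcon' : ω ∉ ⋃ g ∈ hfin.toFinset, {ω | (fun t : Fin T => (b g t ω, u t ω)) ∈ V g} := hcon
    simp only [Set.mem_iUnion, not_exists, Set.Finite.mem_toFinset, Set.mem_ofPred_eq, V,
      not_lt] at hcon'
    refine (G.excess_risk_lt hUE hLM hα hsh (fun a => (hstat _ (Set.mem_range_self a)).1) hKαδ hΔ
      hclose hT hω (fun a => ?_) a).not_ge hbad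
    exact hcon' (sh a) (Set.mem_range_self a) a
  refine (measure_mono_ae hsub).trans ((measure_biUnion_finset_le _ _).trans ?_)
  refine (Finset.sum_le_sum fun g hg => hVQ g (hfin.mem_toFinset.1 hg)).trans ?_
  rw [Finset.sum_const, nsmul_eq_mul]
  exact mul_le_mul' (by exact_mod_cast hcard) le_rfl

/-- Averaging over the values of a finite-valued random variable: outside the values in `Z`, it is
enough to bound the conditional probabilities. -/
lemma measure_le_add_of_cond_le {Ω D : Type*} [MeasurableSpace Ω] [Fintype D]
    (P : Measure Ω) [IsProbabilityMeasure P] (X : Ω → D)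
    (hX : ∀ d, MeasurableSet (X ⁻¹' {d})) (E : Set Ω) (Z : Set D) {p R : ℝ≥0∞}
    (hZ : P (X ⁻¹' Z) ≤ p)
    (hR : ∀ d ∉ Z, P (X ⁻¹' {d}) ≠ 0 → cond P (X ⁻¹' {d}) E ≤ R) : P E ≤ p + R := by
  classical
  have hsub : E ⊆ X ⁻¹' Z ∪ ⋃ d ∈ Finset.univ.filter (· ∉ Z), (X ⁻¹' {d} ∩ E) := by
    intro ω hω
    by_cases h : X ω ∈ Z
    · exact Or.inl h
    · exact Or.inr (Set.mem_biUnion (Finset.mem_coe.2 (by simpa using h)) ⟨rfl, hω⟩)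
  refine (measure_mono hsub).trans ((measure_union_le _ _).trans (add_le_add hZ ?_))
  refine (measure_biUnion_finset_le _ _).trans ?_
  have hd : ∀ d ∈ Finset.univ.filter (· ∉ Z), P (X ⁻¹' {d} ∩ E) ≤ P (X ⁻¹' {d}) * R := by
    intro d hd
    by_cases h0 : P (X ⁻¹' {d}) = 0
    · exact (measure_mono Set.inter_subset_left).trans (by simp [h0])
    · have h1 := hR d (Finset.mem_filter.1 hd).2 h0
      rw [cond_apply (hX d)] at h1
      calc P (X ⁻¹' {d} ∩ E)
          = P (X ⁻¹' {d}) * ((P (X ⁻¹' {d}))⁻¹ * P (X ⁻¹' {d} ∩ E)) := by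
            rw [← mul_assoc, ENNReal.mul_inv_cancel h0 (measure_ne_top _ _), one_mul]
        _ ≤ P (X ⁻¹' {d}) * R := by gcongr
  refine (Finset.sum_le_sum hd).trans ?_
  rw [← Finset.sum_mul, sum_measure_preimage_singleton _ fun d _ => hX d]
  exact mul_le_of_le_one_left zero_le prob_le_one

end ExcessRisk

end GTML

end

theorem theorem5 :
    ∃ C : ℝ, 0 < C ∧
    ∀ {A B H U : Type*} [PseudoMetricSpace A]
      [Fintype B] [DecidableEq B] [MeasurableSpace B] [MeasurableSingletonClass B]
      [Fintype H] [DecidableEq H] [MeasurableSpace H] [MeasurableSingletonClass H]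
      [MeasurableSpace U]
      (G : GTML.Env A B H U) (Mstar : GTML.BehaviorModel B H) (a₀ astar : A)
      (learn : GTML.Learner B H) (α β₀ γ s ε δ r : ℝ),
      G.PointwiseSeparable →
      G.UniformlyErgodic Mstar →
      G.SignalChainErgodic a₀ Mstar →
      (∀ a, G.risk astar Mstar ≤ G.risk a Mstar) →
      (GTML.IsFrequencyLearner learn ∨ GTML.IsGaussMLE Mstar learn) →
      0 ≤ α → 0 ≤ β₀ → 0 < s → s < γ → 0 < ε → 0 < δ → 2 * G.K * α * δ < ε → 0 < r →
      (∀ (T : ℕ) (x : Fin (T + 1) → B) (y : Fin T → H),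
        (∀ h b b', |GTML.entry (learn T x y) h b b' - GTML.entry Mstar h b b'| < r) →
        G.LipschitzMixing (learn T x y) α β₀ γ) →
      ∃ C₁ c₁ : ℝ, 0 < C₁ ∧ 0 < c₁ ∧
      ∀ (sh : A → A), (∀ a, dist a (sh a) ≤ δ) →
        (Set.range sh).encard ≤ GTML.mechCover A δ →
      ∀ (T₁ T₂ : ℕ), 1 ≤ T₂ →
      ∀ {Ω : Type*} [MeasurableSpace Ω] (P : MeasureTheory.Measure Ω)
        [MeasureTheory.IsProbabilityMeasure P]
        (bH : ℕ → Ω → B) (uH : ℕ → Ω → U) (b : A → ℕ → Ω → B) (u : ℕ → Ω → U) (ahat : Ω → A),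
        GTML.IsBilevelERM G Mstar a₀ learn sh T₁ T₂ P bH uH b u ahat →
        P {ω | ε ≤ G.risk (ahat ω) Mstar - G.risk astar Mstar} ≤
          ENNReal.ofReal (C₁ * Real.exp (-(c₁ * T₁))) +
          (GTML.mechCover A δ : ENNReal) *
            (ENNReal.ofReal C * (G.lossCover ((ε - 2 * G.K * α * δ) / C) T₂ : ENNReal) *
                ENNReal.ofReal (Real.exp (-((ε - 2 * G.K * α * δ) ^ 2 / (C * G.K ^ 2) *
                  (T₂ : ℝ) ^ (s / (1 + s))))) +
              ENNReal.ofReal (C * β₀ * (T₂ : ℝ) ^ ((s - γ) / (1 + s)))) := by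
  refine ⟨6400, by norm_num, ?_⟩
  intro A B H U _ _ _ _ _ _ _ _ _ _ G Mstar a₀ astar learn α β₀ γ s ε δ r hsep hUE hSC _ hlearn
    hα hβ₀ hs hsγ hε hδ hΔ hr hLM
  -- Without behaviours there is no probability space to consider.
  rcases isEmpty_or_nonempty B with hB | hB
  · refine ⟨1, 1, one_pos, one_pos, ?_⟩
    intro sh _ _ T₁ T₂ _ Ω _ P _ bH uH b u ahat _
    exact ((nonempty_of_isProbabilityMeasure P).elim fun ω => hB.elim (bH 0 ω))
  set Δ : ℝ := ε - 2 * G.K * α * δ with hΔdef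
  have hΔ0 : 0 < Δ := sub_pos.2 hΔ
  have hK := G.K_pos
  -- The data only enter through a radius `ρ` of typicality that guarantees both the assumption on
  -- the learned model and the closeness of the stationary distributions.
  obtain ⟨r₀, hr₀, hstat⟩ := G.exists_radius_stat_close hUE (θ := Δ / (4 * G.K)) (by positivity)
  obtain ⟨c, hc, htyp⟩ := hSC.exists_typical_bound
  obtain ⟨ρ, hρ, hρ2, hrad⟩ := GTML.exists_typical_radius hlearn hc (lt_min hr hr₀)
  obtain ⟨C₁, c₁, hC₁, hc₁, hbound⟩ := htyp ρ hρ hρ2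
  refine ⟨C₁ + 1, c₁, by positivity, hc₁, ?_⟩
  intro sh hsh hshc T₁ T₂ hT₂ Ω _ P _ bH uH b u ahat hERM
  -- The risk takes values in `[-K, 0]`, so an excess of more than `K` is impossible.
  rcases lt_or_ge G.K ε with hεK | hεK
  · have hrisk : ∀ a, G.risk a Mstar ∈ Set.Icc (-G.K) 0 := by
      intro a
      have := G.isProbabilityMeasure_stat hUE a
      have hint : Integrable (G.loss a) (G.stat a Mstar) :=
        Integrable.of_bound (G.measurable_loss a).aestronglyMeasurable G.K
          (ae_of_all _ fun z => G.abs_loss_le a z)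
      constructor
      · have h1 := integral_mono (integrable_const (-G.K)) hint fun z => (G.loss_mem a z).1
        have h2 : -G.K ≤ ∫ z, G.loss a z ∂(G.stat a Mstar) := by simpa using h1
        exact h2
      · exact integral_nonpos fun z => (G.loss_mem a z).2
    have hempty : {ω | ε ≤ G.risk (ahat ω) Mstar - G.risk astar Mstar} = ∅ := by
      ext ω
      simp only [Set.mem_ofPred_eq, Set.mem_empty_iff_false, iff_false, not_le]
      linarith [(hrisk (ahat ω)).2, (hrisk astar).1]
    rw [hempty, measure_empty]
    exact zero_le
  -- This keeps `π(a, M)` from being the junk value `0` for mechanisms that are not simulated.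
  have hαδ : α * δ < 1 := by
    have h1 : G.K * (2 * (α * δ)) < G.K * 1 := by linarith
    linarith [lt_of_mul_lt_mul_left h1 hK.le]
  -- Without historical data the exponential term alone is at least one.
  rcases Nat.eq_zero_or_pos T₁ with rfl | hT₁
  · refine prob_le_one.trans (le_add_right ?_)
    rw [← ENNReal.ofReal_one]
    refine ENNReal.ofReal_le_ofReal ?_
    simp only [Nat.cast_zero, mul_zero, neg_zero, Real.exp_zero, mul_one]
    linarith
  have hU : Nonempty U := nonempty_of_isProbabilityMeasure G.userLaw
  have hA : Nonempty A := ⟨a₀⟩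
  have hexp0 : ENNReal.ofReal (Real.exp (-(Δ ^ 2 / (6400 * G.K ^ 2) *
      (T₂ : ℝ) ^ (s / (1 + s))))) ≠ 0 := (ENNReal.ofReal_pos.2 (Real.exp_pos _)).ne'
  have hmech0 : (GTML.mechCover A δ : ENNReal) ≠ 0 := by
    simp [GTML.mechCover]
  have hloss0 : (G.lossCover (Δ / 6400) T₂ : ENNReal) ≠ 0 := by
    have h1 : 0 < G.lossCover (Δ / 6400) T₂ :=
      lt_of_lt_of_le (Metric.coveringNumber_pos_iff.2 (Set.range_nonempty _))
        (le_iSup (fun x : Fin T₂ → B × U => Metric.coveringNumber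
          (X := PiLp 1 (fun _ : Fin T₂ => ℝ)) ((T₂ : ℝ) * (Δ / 6400)).toNNReal
          (Set.range (fun a => WithLp.toLp 1 (fun t => G.L a (x t).1 (x t).2))))
          (fun _ => Classical.arbitrary _))
    simpa using h1.ne'
  -- If one of the covering numbers is infinite, so is the bound.
  rcases eq_or_ne (G.lossCover (Δ / 6400) T₂) ⊤ with hltop | hltop
  · rw [hltop, ENat.toENNReal_top, ENNReal.mul_top (by simp), ENNReal.top_mul hexp0, top_add,
      ENNReal.mul_top hmech0, add_top]
    exact le_top
  rcases eq_or_ne (GTML.mechCover A δ) ⊤ with hmtop | hmtop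
  · rw [hmtop, ENat.toENNReal_top, ENNReal.top_mul, add_top]
    · exact le_top
    · exact (add_pos_of_pos_of_nonneg (pos_iff_ne_zero.2 (mul_ne_zero (mul_ne_zero (by simp) hloss0)
        hexp0)) zero_le).ne'
  obtain ⟨n, hn⟩ := ENat.ne_top_iff_exists.1 hltop
  obtain ⟨N, hN⟩ := ENat.ne_top_iff_exists.1 hmtop
  rw [← hN] at hshc
  rw [← hn, ← hN, ENat.toENNReal_coe, ENat.toENNReal_coe]
  obtain ⟨μ₀, hμ₀, hlawH⟩ := hERM.historical_law
  -- The historical data.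
  let X : Ω → (Fin (T₁ + 1) → B) × (Fin T₁ → H) := fun ω =>
    (fun t => bH t ω, fun t => G.sig a₀ (bH t ω) (uH t ω))
  have hx : Measurable fun ω (t : Fin (T₁ + 1)) => bH t ω :=
    measurable_pi_lambda _ fun t => hERM.measurable_bH t
  have hy : Measurable fun ω (t : Fin T₁) => G.sig a₀ (bH t ω) (uH t ω) :=
    measurable_pi_lambda _ fun t =>
      (measurable_fst.comp (G.measurable_signal a₀)).comp
        ((hERM.measurable_bH t).prodMk (hERM.measurable_uH t))
  have hXm : Measurable X := hx.prodMk hy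
  have hXs : ∀ d, X ⁻¹' {d} = {ω | (∀ t : Fin (T₁ + 1), bH t ω = d.1 t) ∧
      ∀ t : Fin T₁, G.sig a₀ (bH t ω) (uH t ω) = d.2 t} := by
    intro d
    ext ω
    simp only [X, Set.mem_preimage, Set.mem_singleton_iff, Prod.ext_iff, funext_iff,
      Set.mem_ofPred_eq]
  have hXd : ∀ d, MeasurableSet (X ⁻¹' {d}) := fun d => hXm (measurableSet_singleton d)
  refine (GTML.measure_le_add_of_cond_le P X hXd _
    {d | ¬ GTML.IsTypical Mstar c ρ d.1 d.2} (p := ENNReal.ofReal (C₁ * Real.exp (-(c₁ * T₁))))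
    (R := N * (4 * (n * ENNReal.ofReal
          (Real.exp (-(Δ ^ 2 / (6400 * G.K ^ 2) * (T₂ : ℝ) ^ (s / (1 + s))))) +
        ENNReal.ofReal (2 * β₀ * (T₂ : ℝ) ^ ((s - γ) / (1 + s)))))) ?_ ?_).trans ?_
  · have hfm : Measurable fun ω (t : ℕ) => (bH t ω, uH t ω) :=
      measurable_pi_lambda _ fun t => (hERM.measurable_bH t).prodMk (hERM.measurable_uH t)
    have h1 := Measure.le_map_apply (μ := P) hfm.aemeasurable
      {x : ℕ → B × U | ¬ GTML.IsTypical Mstar c ρ (fun t : Fin (T₁ + 1) => (x t).1)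
        (fun t : Fin T₁ => G.sig a₀ (x t).1 (x t).2)}
    rw [hlawH] at h1
    exact h1.trans (hbound (μ₀.prod G.userLaw) T₁)
  · rintro ⟨x, y⟩ hxy hpos
    have hxy' : GTML.IsTypical Mstar c ρ x y := not_not.1 hxy
    have hclose := hrad T₁ hT₁ x y hxy'
    have hlm := hLM T₁ x y fun h b b' => (hclose h b b').trans_le (min_le_left _ _)
    rw [hXs] at hpos ⊢
    have hQ : IsProbabilityMeasure (cond P {ω | (∀ t : Fin (T₁ + 1), bH t ω = x t) ∧
      ∀ t : Fin T₁, G.sig a₀ (bH t ω) (uH t ω) = y t}) := cond_isProbabilityMeasure hpos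
    have key := G.measure_excess_risk_le (cond P {ω | (∀ t : Fin (T₁ + 1), bH t ω = x t) ∧
      ∀ t : Fin T₁, G.sig a₀ (bH t ω) (uH t ω) = y t}) hsep hUE hlm hα hβ₀ hs (hs.trans hsγ) hsh
      hαδ hΔ0
      (fun a ha => hstat _ (fun h b b' => (hclose h b b').trans_le (min_le_right _ _)) a ha)
      hT₂ hERM.measurable_b hERM.measurable_u (hERM.simulated_law x y hpos)
      (cond_absolutelyContinuous.ae_le hERM.ahat_min) hn.ge hshc astar
    refine le_trans (le_of_eq ?_) key
    have e : 2 * G.K * α * δ + Δ = ε := by rw [hΔdef]; ring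
    rw [e]
  · refine add_le_add (ENNReal.ofReal_le_ofReal
      (mul_le_mul_of_nonneg_right (by linarith) (Real.exp_pos _).le)) (mul_le_mul' le_rfl ?_)
    rw [mul_add, ← mul_assoc]
    have hz : 0 ≤ (T₂ : ℝ) ^ ((s - γ) / (1 + s)) := Real.rpow_nonneg (Nat.cast_nonneg _) _
    refine add_le_add (mul_le_mul' (mul_le_mul' ?_ le_rfl) le_rfl) ?_
    · rw [show (4 : ℝ≥0∞) = ENNReal.ofReal 4 by simp]
      exact ENNReal.ofReal_le_ofReal (by norm_num)
    · rw [show (4 : ℝ≥0∞) = ENNReal.ofReal 4 by simp, ← ENNReal.ofReal_mul (by norm_num)]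
      refine ENNReal.ofReal_le_ofReal ?_
      have : 0 ≤ β₀ * (T₂ : ℝ) ^ ((s - γ) / (1 + s)) := mul_nonneg hβ₀ hz
      linarith
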